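/- **Setting.** Let $F$ be the complex vector space with basis the semi-infinite monomials $e_{i_0}\wedge e_{i_1}\wedge e_{i_2}\wedge\cdots$, where $i_0>i_1>\cdots$ are integers and $i_{\ell+1}=i_\ell-1$ for $\ell\gg0$. Put $|m\rangle=e_m\wedge e_{m-1}\wedge\cdots$, let $\langle m|$ be the functional that takes the coefficient of $|m\rangle$, and let $F^{(0)}$ be the span of the monomials of charge $0$ (those with as many indices $>0$ as missing indices $\le 0$). For $k\in\mathbb Z$ let $\psi^+_{-k+\frac12}$ be the operator $f\mapsto e_k\wedge f$ and let $\psi^-_{k-\frac12}$ be the operator that contracts $e_k$, so that $\psi^\lambda_i\psi^\mu_j+\psi^\mu_j\psi^\lambda_i=\delta_{\lambda,-\mu}\delta_{i,-j}$. For $i\in\mathbb Z$ put $$\phi_i=\tfrac{1}{\sqrt2}\bigl(\psi^+_{i+\frac12}+(-1)^i\psi^-_{i-\frac12}\bigr),\qquad \hat\phi_i=\tfrac{\sqrt{-1}}{\sqrt2}\bigl(\psi^+_{i+\frac12}-(-1)^i\psi^-_{i-\frac12}\bigr).$$ For $k>0$ put $\alpha_k=\sum_{a+b=k}\psi^+_a\psi^-_b$,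 and for odd $k>0$ put $\beta_k=\sum_{a+b=k}(-1)^b\phi_a\phi_b$ and $\hat\beta_k=\sum_{a+b=k}(-1)^b\hat\phi_a\hat\phi_b$. Let $$\sigma(f)=\sum_{m\in\mathbb Z}\langle m|\exp\Bigl(\sum_{k>0}t_k\alpha_k\Bigr)f\;q^m,\qquad \overline\sigma(f)=(\langle0|+\theta\langle-1|)\exp\Bigl(\tfrac12\sum_{k>0\ \mathrm{odd}}(\overline t_k\beta_k+\hat t_k\hat\beta_k)\Bigr)f .$$ A *KP tau-function* is a function $\tau(t)=\sigma(f)$ with $0\ne f\in F^{(0)}$ and $\sum_{i\in\frac12+\mathbb Z}\psi^+_if\otimes\psi^-_{-i}f=0$. A *BKP tau-function* is a function $\tau(\overline t)=\overline\sigma(g|0\rangle)$, where $g$ is in the even part of the algebra generated by the $\phi_i$, $g|0\rangle\neq0$, and $\sum_{j\in\mathbb Z}(-1)^j\phi_jg|0\rangle\otimes\phi_{-j}g|0\rangle=g\phi_0|0\rangle\otimes g\phi_0|0\rangle$. Define $s_j$ by $\exp(\sum_{k>0}t_kz^k)=\sum_{j\ge0}s_j(t)z^j$, and put $$\overline\chi_{N,M}(s,t)=\tfrac12s_N(s)s_M(t)+\sum_{k=1}^M(-1)^ks_{N+k}(s)s_{M-k}(t),$$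 $$\chi^\pm_{N,M}(s,t,u,v)=\tfrac12\sum_{k=0}^M(-1)^Ns_{N+k}(s)s_{M-k}(-t)\pm\tfrac12\sum_{k=1}^M(-1)^Ms_{N+k}(-u)s_{M-k}(v).$$ The Pfaffian of a square matrix of even size is the polynomial in its entries above the diagonal that gives the usual Pfaffian when the matrix is skew-symmetric; the other entries are ignored. **Theorem.** Let $n\ge0$, let $\lambda_1>\lambda_2>\cdots>\lambda_{2n}\ge0$ be integers, and let $c_i=(c_{i1},c_{i2},\ldots)$, $1\le i\le 2n$, be arbitrary sequences of complex numbers. Put $\tilde c_i=(-c_{i1},c_{i2},-c_{i3},\ldots)$ and $$v_i=\sum_{j\ge-\lambda_i}s_{j+\lambda_i}(c_i)\phi_j,\qquad \hat v_i=\sum_{j\ge-\lambda_i}s_{j+\lambda_i}(c_i)\hat\phi_j .$$ For $\overline t=(\overline t_1,0,\overline t_3,0,\ldots)$ let $$\tau_B^{2n}(\overline t)=\mathrm{Pf}\bigl(\overline\chi_{\lambda_i,\lambda_j}(\overline t+c_i,\overline t+c_j)\bigr)_{1\le i,j\le2n}.$$ 1. $\tau_B^{2n}(\overline t)=\overline\sigma(v_1v_2\cdots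 v_{2n}|0\rangle)$, and this is a BKP tau-function. 2. The vector $v_1\cdots v_{2n}\hat v_1\cdots\hat v_{2n}|0\rangle$ is a nonzero element $f$ of $F^{(0)}$ with $\sum_{i}\psi^+_if\otimes\psi^-_{-i}f=0$, so that $\tau^{2n,2n}(t)=\sigma(v_1\cdots v_{2n}\hat v_1\cdots\hat v_{2n}|0\rangle)$ is a KP tau-function; explicitly, for all $t=(t_1,t_2,t_3,\ldots)$, $$\tau^{2n,2n}(t)=\mathrm{Pf}\begin{pmatrix}A^+(t)&-\sqrt{-1}A^-(t)\\ \sqrt{-1}A^-(t)^T&A^+(t)\end{pmatrix},\qquad A^\pm(t)=\bigl(\chi^\pm_{\lambda_i,\lambda_j}(t+c_i,\,t-\tilde c_j,\,t-\tilde c_i,\,t+c_j)\bigr)_{1\le i,j\le2n}.$$ 3. For every $\overline t=(\overline t_1,0,\overline t_3,0,\ldots)$ one has $\tau_B^{2n}(\overline t)^2=\tau^{2n,2n}(\overline t)$. -/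

import Mathlib

open scoped TensorProduct Nat

noncomputable section

namespace SpinKP

/-! ### The semi-infinite wedge space -/

/-- A semi-infinite monomial `e_{i₀} ∧ e_{i₁} ∧ ⋯` with `i₀ > i₁ > ⋯` and `i_{l+1} = i_l - 1` for
large `l`, encoded by its set of indices `{i₀, i₁, …}`. -/
abbrev Monomial : Type := {S : Set ℤ // BddAbove S ∧ BddBelow Sᶜ}

/-- The space `F` with the semi-infinite monomials as a basis. -/
abbrev Fock : Type := Monomial →₀ ℂ

/-- The set of indices of `|m⟩ = e_m ∧ e_{m-1} ∧ ⋯`. -/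
def vacuumIndex (m : ℤ) : Monomial :=
  ⟨Set.Iic m, bddAbove_Iic, by rw [Set.compl_Iic]; exact bddBelow_Ioi⟩

/-- The vector `|m⟩`. -/
def ket (m : ℤ) : Fock := Finsupp.single (vacuumIndex m) 1

/-- The functional `⟨m|`: it takes the coefficient of `|m⟩`. -/
def bra (m : ℤ) (f : Fock) : ℂ := f (vacuumIndex m)

/-- The charge of a monomial; `|m⟩` has charge `m`. -/
def charge (S : Monomial) : ℤ :=
  ((S.1 ∩ Set.Ioi 0).ncard : ℤ) - ((Set.Iic 0 \ S.1).ncard : ℤ)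

/-- The sector `F^{(m)}`. -/
def sector (m : ℤ) : Submodule ℂ Fock := Finsupp.supported ℂ ℂ {S | charge S = m}

/-- Adjoin the index `m`. -/
def Monomial.adjoin (S : Monomial) (m : ℤ) : Monomial :=
  ⟨insert m S.1, S.2.1.insert m,
    S.2.2.mono (Set.compl_subset_compl.mpr (Set.subset_insert m S.1))⟩

/-- Delete the index `m`. -/
def Monomial.erase (S : Monomial) (m : ℤ) : Monomial :=
  ⟨S.1 \ {m}, S.2.1.mono Set.sdiff_subset, by
    have h : (S.1 \ {m})ᶜ = insert m S.1ᶜ := by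
      ext x
      by_cases hx : x = m <;> simp [hx]
    rw [h]
    exact S.2.2.insert m⟩

/-- The number of factors `e_i` of a monomial with `i > m`. -/
def Monomial.above (S : Monomial) (m : ℤ) : ℕ := (S.1 ∩ Set.Ioi m).ncard

open Classical in
/-- The wedging operator `f ↦ e_m ∧ f`, that is `ψ⁺_{-m+1/2}`. -/
def wedge (m : ℤ) : Fock →ₗ[ℂ] Fock :=
  Finsupp.linearCombination ℂ fun S : Monomial =>
    if m ∈ S.1 then 0 else Finsupp.single (S.adjoin m) ((-1 : ℂ) ^ S.above m)

open Classical in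
/-- The contracting operator that removes `e_m`, that is `ψ⁻_{m-1/2}`. -/
def contract (m : ℤ) : Fock →ₗ[ℂ] Fock :=
  Finsupp.linearCombination ℂ fun S : Monomial =>
    if m ∈ S.1 then Finsupp.single (S.erase m) ((-1 : ℂ) ^ S.above m) else 0

/-- `φ_i = (ψ⁺_{i+1/2} + (-1)^i ψ⁻_{i-1/2}) / √2`. -/
def phi (i : ℤ) : Fock →ₗ[ℂ] Fock :=
  ((Real.sqrt 2 : ℂ)⁻¹) • (wedge (-i) + ((-1 : ℂ) ^ i) • contract i)

/-- `φ̂_i = √-1 (ψ⁺_{i+1/2} - (-1)^i ψ⁻_{i-1/2}) / √2`. -/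
def phiHat (i : ℤ) : Fock →ₗ[ℂ] Fock :=
  (Complex.I * (Real.sqrt 2 : ℂ)⁻¹) • (wedge (-i) - ((-1 : ℂ) ^ i) • contract i)

/-! ### Bosonization

A point of `ℂ^{ℕ+}` is a sequence of times `t = (t₁, t₂, t₃, …)`, and a polynomial in the times is
regarded as a function on such sequences. All the sums `∑ᶠ` below have finitely many nonzero terms
when they are applied to a given vector. -/

/-- Sequences of times (or of constants), indexed by `1, 2, 3, …`. -/
abbrev Times : Type := ℕ+ → ℂ

/-- The sequence `t` has the form `(t₁, 0, t₃, 0, …)`. -/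
def EvenTimesVanish (t : Times) : Prop := ∀ k : ℕ+, Even (k : ℕ) → t k = 0

/-- `α_k = ∑_{a+b=k} ψ⁺_a ψ⁻_b`, for `k > 0`. -/
def alpha (k : ℕ+) (f : Fock) : Fock :=
  ∑ᶠ m : ℤ, wedge m (contract (m + ((k : ℕ) : ℤ)) f)

/-- `β_k = ∑_{a+b=k} (-1)^b φ_a φ_b`, for odd `k > 0`. -/
def beta (k : ℕ+) (f : Fock) : Fock :=
  ∑ᶠ b : ℤ, ((-1 : ℂ) ^ b) • phi (((k : ℕ) : ℤ) - b) (phi b f)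

/-- `β̂_k = ∑_{a+b=k} (-1)^b φ̂_a φ̂_b`, for odd `k > 0`. -/
def betaHat (k : ℕ+) (f : Fock) : Fock :=
  ∑ᶠ b : ℤ, ((-1 : ℂ) ^ b) • phiHat (((k : ℕ) : ℤ) - b) (phiHat b f)

/-- `H(t) = ∑_{k>0} t_k α_k`. -/
def hamiltonian (t : Times) (f : Fock) : Fock := ∑ᶠ k : ℕ+, t k • alpha k f

open Classical in
/-- `H̄(t) + Ĥ(s) = ∑_{k>0 odd} (t_k β_k + s_k β̂_k) / 2`. -/
def hamiltonianB (t s : Times) (f : Fock) : Fock :=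
  ∑ᶠ k : ℕ+, if Odd (k : ℕ) then (t k / 2) • beta k f + (s k / 2) • betaHat k f else 0

/-- `exp(A) f = ∑ₙ Aⁿ f / n!` for a locally nilpotent operator `A`. -/
def expOp (A : Fock → Fock) (f : Fock) : Fock := ∑ᶠ n : ℕ, ((n ! : ℂ)⁻¹) • A^[n] f

/-- `σ(f) = ∑_m ⟨m| exp(H(t)) f⟩ q^m`; the value at `t` and `m` is the coefficient of `q^m`. -/
def sigma (f : Fock) (t : Times) (m : ℤ) : ℂ := bra m (expOp (hamiltonian t) f)

/-- `σ̄(f) = (⟨0| + θ ⟨-1|) exp(H̄(t) + Ĥ(s)) f`; the pair `(x, y)` stands for `x + θ y`. -/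
def sigmaBar (f : Fock) (t s : Times) : ℂ × ℂ :=
  (bra 0 (expOp (hamiltonianB t s) f), bra (-1) (expOp (hamiltonianB t s) f))

/-! ### Tau-functions -/

/-- `S(f ⊗ g) = ∑_i ψ⁺_i f ⊗ ψ⁻_{-i} g`, the sum being over the half-integers `i`. -/
def kpOp (f g : Fock) : Fock ⊗[ℂ] Fock := ∑ᶠ m : ℤ, wedge m f ⊗ₜ[ℂ] contract m g

/-- `S_B(f ⊗ g) = ∑_j (-1)^j φ_j f ⊗ φ_{-j} g`. -/
def bkpOp (f g : Fock) : Fock ⊗[ℂ] Fock :=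
  ∑ᶠ j : ℤ, ((-1 : ℂ) ^ j) • (phi j f ⊗ₜ[ℂ] phi (-j) g)

/-- `τ` is a (polynomial) tau-function of the KP hierarchy: `τ = σ(f)` for a nonzero vector `f` of
charge `0` with `S(f ⊗ f) = 0`. -/
def IsKPTau (τ : Times → ℂ) : Prop :=
  ∃ f : Fock, f ≠ 0 ∧ f ∈ sector 0 ∧ kpOp f f = 0 ∧
    ∀ (t : Times) (m : ℤ), sigma f t m = if m = 0 then τ t else 0

/-- The even part of the Clifford algebra generated by the `φ_i`. -/
def evenClifford : Subalgebra ℂ (Module.End ℂ Fock) :=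
  Algebra.adjoin ℂ {x | ∃ i j : ℤ, x = phi i * phi j}

/-- `τ`, as a function of the odd times, is a (polynomial) tau-function of the BKP hierarchy:
`τ = σ̄(g|0⟩)` for an even element `g` of the Clifford algebra of the `φ_i` such that `g|0⟩ ≠ 0`
and `S_B(g|0⟩ ⊗ g|0⟩) = gφ₀|0⟩ ⊗ gφ₀|0⟩`. -/
def IsBKPTau (τ : Times → ℂ) : Prop :=
  ∃ g ∈ evenClifford, g (ket 0) ≠ 0 ∧
    bkpOp (g (ket 0)) (g (ket 0)) = g (phi 0 (ket 0)) ⊗ₜ[ℂ] g (phi 0 (ket 0)) ∧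
    ∀ t s : Times, EvenTimesVanish t → EvenTimesVanish s → sigmaBar (g (ket 0)) t s = (τ t, 0)

/-! ### Pfaffians and the explicit polynomials -/

/-- The Pfaffian, by expansion along the first row. Only the entries above the diagonal are used. -/
def pf : (n : ℕ) → Matrix (Fin n) (Fin n) ℂ → ℂ
  | 0, _ => 1
  | 1, _ => 0
  | n + 2, A => ∑ j : Fin (n + 1), (-1 : ℂ) ^ (j : ℕ) * A 0 j.succ *
      pf n (A.submatrix (fun a => (j.succAbove a).succ) (fun a => (j.succAbove a).succ))

/-- The power series `∑_{k>0} t_k z^k`. -/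
def timesSeries (t : Times) : PowerSeries ℂ :=
  PowerSeries.mk fun k => if h : 0 < k then t ⟨k, h⟩ else 0

/-- The elementary Schur polynomials: `exp(∑_{k>0} t_k z^k) = ∑_j s_j(t) z^j`. -/
def schur (j : ℕ) (t : Times) : ℂ :=
  PowerSeries.coeff j ((PowerSeries.exp ℂ).subst (timesSeries t))

/-- `χ̄_{N,M}(s,t) = ½ s_N(s) s_M(t) + ∑_{k=1}^{M} (-1)^k s_{N+k}(s) s_{M-k}(t)`. -/
def chiBar (N M : ℕ) (s t : Times) : ℂ :=
  1 / 2 * schur N s * schur M t +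
    ∑ k ∈ Finset.Icc 1 M, (-1 : ℂ) ^ k * schur (N + k) s * schur (M - k) t

/-- `χ^±_{N,M}(s,t,u,v) = ½ ∑_{k=0}^{M} (-1)^N s_{N+k}(s) s_{M-k}(-t)
± ½ ∑_{k=1}^{M} (-1)^M s_{N+k}(-u) s_{M-k}(v)`, where `ε = ±1` is the sign. -/
def chi (ε : ℂ) (N M : ℕ) (s t u v : Times) : ℂ :=
  1 / 2 * ∑ k ∈ Finset.Icc 0 M, (-1 : ℂ) ^ N * schur (N + k) s * schur (M - k) (-t) +
    ε * (1 / 2 * ∑ k ∈ Finset.Icc 1 M, (-1 : ℂ) ^ M * schur (N + k) (-u) * schur (M - k) v)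

/-- `c̃ = (-c₁, c₂, -c₃, c₄, …)`. -/
def tilde (c : Times) : Times := fun k => (-1 : ℂ) ^ (k : ℕ) * c k

/-- The matrix `A^±(t) = (χ^±_{λ_i,λ_j}(t + c_i, t - c̃_j, t - c̃_i, t + c_j))_{i,j}`. -/
def matA (ε : ℂ) {m : ℕ} (lam : Fin m → ℕ) (c : Fin m → Times) (t : Times) :
    Matrix (Fin m) (Fin m) ℂ :=
  Matrix.of fun i j =>
    chi ε (lam i) (lam j) (t + c i) (t - tilde (c j)) (t - tilde (c i)) (t + c j)

/-- `τ_B(t) = Pf(χ̄_{λ_i,λ_j}(t + c_i, t + c_j))`. -/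
def tauB {m : ℕ} (lam : Fin m → ℕ) (c : Fin m → Times) (t : Times) : ℂ :=
  pf m (Matrix.of fun i j => chiBar (lam i) (lam j) (t + c i) (t + c j))

/-- The Pfaffian of the block matrix with rows `(A⁺, -√-1 A⁻)` and `(√-1 (A⁻)ᵀ, A⁺)`. -/
def tauKP {m : ℕ} (lam : Fin m → ℕ) (c : Fin m → Times) (t : Times) : ℂ :=
  pf (m + m) (Matrix.reindex finSumFinEquiv finSumFinEquiv
    (Matrix.fromBlocks (matA 1 lam c t) (-Complex.I • matA (-1) lam c t)
      (Complex.I • (matA (-1) lam c t).transpose) (matA 1 lam c t)))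

/-! ### The vectors `v_1 ⋯ v_m v̂_1 ⋯ v̂_m |0⟩` -/

/-- The operator `v = ∑_{j ≥ -N} s_{j+N}(c) φ_j`. -/
def vOp (N : ℕ) (c : Times) (f : Fock) : Fock :=
  ∑ᶠ k : ℕ, schur k c • phi ((k : ℤ) - (N : ℤ)) f

/-- The operator `v̂ = ∑_{j ≥ -N} s_{j+N}(c) φ̂_j`. -/
def vHatOp (N : ℕ) (c : Times) (f : Fock) : Fock :=
  ∑ᶠ k : ℕ, schur k c • phiHat ((k : ℤ) - (N : ℤ)) f

/-- `v_1 v_2 ⋯ v_m f`. -/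
def vProd {m : ℕ} (lam : Fin m → ℕ) (c : Fin m → Times) (f : Fock) : Fock :=
  (List.ofFn fun i => vOp (lam i) (c i)).foldr (fun T h => T h) f

/-- `v̂_1 v̂_2 ⋯ v̂_m f`. -/
def vHatProd {m : ℕ} (lam : Fin m → ℕ) (c : Fin m → Times) (f : Fock) : Fock :=
  (List.ofFn fun i => vHatOp (lam i) (c i)).foldr (fun T h => T h) f

end SpinKP

end

noncomputable section

namespace SpinKP

/-! ### Canonical anticommutation relations -/

/-! Everything follows from the action of the Clifford algebra on `F`. The commutator of $H(t)$ with
a fermionic generating series is multiplication by $\pm\sum t_kz^k$, so $\exp H(t)$ moves past $v_i$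
at the cost of multiplying its $\psi^+$ coefficients by $\exp\sum t_kz^k$ and its $\psi^-$
coefficients by the inverse series (`intertwines_field`, `Fermions.intertwines_mixOp`). The neutral
Hamiltonian similarly replaces $c_i$ by $\overline t+c_i$ in $v_i$. Since the Hamiltonians kill the
vacuum, each tau-function is a vacuum expectation of a product of linear fields, hence a Pfaffian of
contractions (`wick`); computing the contractions gives `tauB` and `tauKP`.

The hierarchies hold because $w\otimes w$ commutes with the bilinear operator: for $S_B$ this is
true of every neutral field $w$ (`Neutral.bilinB_field`), and for $S$ of $w=QP-PQ$ with $P$ a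
$\psi^+$ field and $Q$ a $\psi^-$ field (`Fermions.bilin_commutator`). The latter covers $v_i\hat
v_i$, because $v_i=P+Q$ and $\hat v_i=\sqrt{-1}(P-Q)$. Nonvanishing comes from the leading modes
$\phi_{-\lambda_i}$ and the strict decrease of $\lambda$ (`Neutral.prod_apply_ne_zero`).

For the square, at times with $t_{2k}=0$ the evolved operators are again the fields $v_i,\hat v_i$
with $c_i$ replaced by $\overline t+c_i$. The two families anticommute, so the expectation of
$v_1\cdots v_{2n}\hat v_1\cdots\hat v_{2n}$ factors (`Neutral.ev_prod_apply_of_even`), and both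
factors are the same Pfaffian. -/

theorem Monomial.ext_mem {S T : Monomial} (h : ∀ x, x ∈ S.1 ↔ x ∈ T.1) : S = T :=
  Subtype.ext (Set.ext h)

theorem Monomial.finite_above (S : Monomial) (m : ℤ) : (S.1 ∩ Set.Ioi m).Finite := by
  obtain ⟨b, hb⟩ := S.2.1
  exact (Set.finite_Ioc m b).subset fun x hx => ⟨hx.2, hb hx.1⟩

theorem Monomial.above_adjoin_of_lt {S : Monomial} {m n : ℤ} (hn : n ∉ S.1) (h : m < n) :
    (S.adjoin n).above m = S.above m + 1 := by
  have : (S.adjoin n).1 ∩ Set.Ioi m = insert n (S.1 ∩ Set.Ioi m) := by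
    ext x
    simp only [Monomial.adjoin, Set.mem_inter_iff, Set.mem_insert_iff, Set.mem_Ioi]
    grind
  rw [Monomial.above, this, Set.ncard_insert_of_notMem (fun hx => hn hx.1) (S.finite_above m),
    Monomial.above]

theorem Monomial.above_adjoin_of_le (S : Monomial) {m n : ℤ} (h : n ≤ m) :
    (S.adjoin n).above m = S.above m := by
  have : (S.adjoin n).1 ∩ Set.Ioi m = S.1 ∩ Set.Ioi m := by
    ext x
    simp only [Monomial.adjoin, Set.mem_inter_iff, Set.mem_insert_iff, Set.mem_Ioi]
    grind
  rw [Monomial.above, this, Monomial.above]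

theorem Monomial.adjoin_erase {S : Monomial} {m : ℤ} (h : m ∈ S.1) : (S.erase m).adjoin m = S :=
  Monomial.ext_mem fun x => by
    simp only [Monomial.adjoin, Monomial.erase, Set.mem_insert_iff, Set.mem_sdiff,
      Set.mem_singleton_iff]
    grind

theorem Monomial.erase_adjoin {S : Monomial} {m : ℤ} (h : m ∉ S.1) : (S.adjoin m).erase m = S :=
  Monomial.ext_mem fun x => by
    simp only [Monomial.adjoin, Monomial.erase, Set.mem_insert_iff, Set.mem_sdiff,
      Set.mem_singleton_iff]
    grind

@[simp] theorem Monomial.mem_adjoin {S : Monomial} {m x : ℤ} :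
    x ∈ (S.adjoin m).1 ↔ x = m ∨ x ∈ S.1 := Iff.rfl

@[simp] theorem Monomial.mem_erase {S : Monomial} {m x : ℤ} :
    x ∈ (S.erase m).1 ↔ x ∈ S.1 ∧ x ≠ m := Iff.rfl

theorem Monomial.above_erase_of_lt {S : Monomial} {m n : ℤ} (hn : n ∈ S.1) (h : m < n) :
    (S.erase n).above m + 1 = S.above m := by
  have := Monomial.above_adjoin_of_lt (S := S.erase n) (n := n) (by simp) h
  rwa [Monomial.adjoin_erase hn, eq_comm] at this

theorem Monomial.above_erase_of_le (S : Monomial) {m n : ℤ} (h : n ≤ m) :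
    (S.erase n).above m = S.above m := by
  have : (S.erase n).1 ∩ Set.Ioi m = S.1 ∩ Set.Ioi m := by
    ext x
    simp only [Set.mem_inter_iff, Monomial.mem_erase, Set.mem_Ioi]
    grind
  rw [Monomial.above, this, Monomial.above]

theorem wedge_single_of_mem {S : Monomial} {m : ℤ} (h : m ∈ S.1) (x : ℂ) :
    wedge m (Finsupp.single S x) = 0 := by
  simp [wedge, h]

theorem wedge_single_of_notMem {S : Monomial} {m : ℤ} (h : m ∉ S.1) (x : ℂ) :
    wedge m (Finsupp.single S x) = Finsupp.single (S.adjoin m) (x * (-1) ^ S.above m) := by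
  simp [wedge, h]

theorem contract_single_of_mem {S : Monomial} {m : ℤ} (h : m ∈ S.1) (x : ℂ) :
    contract m (Finsupp.single S x) = Finsupp.single (S.erase m) (x * (-1) ^ S.above m) := by
  simp [contract, h]

theorem contract_single_of_notMem {S : Monomial} {m : ℤ} (h : m ∉ S.1) (x : ℂ) :
    contract m (Finsupp.single S x) = 0 := by
  simp [contract, h]

theorem Monomial.adjoin_comm (S : Monomial) (m n : ℤ) :
    (S.adjoin m).adjoin n = (S.adjoin n).adjoin m :=
  Monomial.ext_mem fun x => by simp only [Monomial.mem_adjoin]; tauto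

theorem Monomial.erase_comm (S : Monomial) (m n : ℤ) :
    (S.erase m).erase n = (S.erase n).erase m :=
  Monomial.ext_mem fun x => by simp only [Monomial.mem_erase]; tauto

theorem Monomial.erase_adjoin_comm (S : Monomial) {m n : ℤ} (h : m ≠ n) :
    (S.erase m).adjoin n = (S.adjoin n).erase m :=
  Monomial.ext_mem fun x => by simp only [Monomial.mem_erase, Monomial.mem_adjoin]; grind

theorem wedge_mul_self (m : ℤ) : wedge m * wedge m = 0 := by
  refine Finsupp.lhom_ext fun S x => ?_
  by_cases h : m ∈ S.1
  · simp [-Finsupp.single_mul, wedge_single_of_mem h]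
  · simp [-Finsupp.single_mul, wedge_single_of_notMem h, wedge_single_of_mem]

theorem contract_mul_self (m : ℤ) : contract m * contract m = 0 := by
  refine Finsupp.lhom_ext fun S x => ?_
  by_cases h : m ∈ S.1
  · simp [-Finsupp.single_mul, contract_single_of_mem h, contract_single_of_notMem]
  · simp [-Finsupp.single_mul, contract_single_of_notMem h]

/-- Adjoining the larger index raises by one the count above the smaller one, while adjoining the
smaller index leaves the count above the larger unchanged; the two orders therefore differ by one
sign. -/
theorem wedge_anticomm_of_lt {m n : ℤ} (hmn : m < n) :
    wedge m * wedge n + wedge n * wedge m = 0 := by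
  refine Finsupp.lhom_ext fun S x => ?_
  by_cases hm : m ∈ S.1
  · by_cases hn : n ∈ S.1
    · simp [-Finsupp.single_mul, wedge_single_of_mem hm, wedge_single_of_mem hn]
    · have : m ∈ (S.adjoin n).1 := Or.inr hm
      simp [-Finsupp.single_mul, wedge_single_of_mem hm, wedge_single_of_notMem hn, wedge_single_of_mem this]
  · by_cases hn : n ∈ S.1
    · have : n ∈ (S.adjoin m).1 := Or.inr hn
      simp [-Finsupp.single_mul, wedge_single_of_mem hn, wedge_single_of_notMem hm, wedge_single_of_mem this]
    · have h1 : m ∉ (S.adjoin n).1 := by simp [-Finsupp.single_mul, hm, hmn.ne]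
      have h2 : n ∉ (S.adjoin m).1 := by simp [-Finsupp.single_mul, hn, hmn.ne']
      simp only [LinearMap.add_apply, Module.End.mul_apply, wedge_single_of_notMem hn,
        wedge_single_of_notMem hm, wedge_single_of_notMem h1, wedge_single_of_notMem h2,
        Monomial.above_adjoin_of_lt hn hmn, Monomial.above_adjoin_of_le S hmn.le,
        S.adjoin_comm m n, ← Finsupp.single_add, LinearMap.zero_apply]
      rw [Finsupp.single_eq_zero]
      ring

theorem wedge_anticomm (m n : ℤ) : wedge m * wedge n + wedge n * wedge m = 0 := by
  rcases lt_trichotomy m n with h | h | h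
  · exact wedge_anticomm_of_lt h
  · simp [-Finsupp.single_mul, h, wedge_mul_self]
  · rw [add_comm]; exact wedge_anticomm_of_lt h

theorem contract_anticomm_of_lt {m n : ℤ} (hmn : m < n) :
    contract m * contract n + contract n * contract m = 0 := by
  refine Finsupp.lhom_ext fun S x => ?_
  by_cases hm : m ∈ S.1
  · by_cases hn : n ∈ S.1
    · have h1 : m ∈ (S.erase n).1 := ⟨hm, hmn.ne⟩
      have h2 : n ∈ (S.erase m).1 := ⟨hn, hmn.ne'⟩
      simp only [LinearMap.add_apply, Module.End.mul_apply, contract_single_of_mem hn,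
        contract_single_of_mem hm, contract_single_of_mem h1, contract_single_of_mem h2,
        ← Monomial.above_erase_of_lt hn hmn, Monomial.above_erase_of_le S hmn.le,
        S.erase_comm m n, ← Finsupp.single_add, LinearMap.zero_apply]
      rw [Finsupp.single_eq_zero]
      ring
    · have : n ∉ (S.erase m).1 := fun h => hn h.1
      simp [-Finsupp.single_mul, contract_single_of_notMem hn, contract_single_of_mem hm,
        contract_single_of_notMem this]
  · by_cases hn : n ∈ S.1
    · have : m ∉ (S.erase n).1 := fun h => hm h.1
      simp [-Finsupp.single_mul, contract_single_of_notMem hm, contract_single_of_mem hn,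
        contract_single_of_notMem this]
    · simp [-Finsupp.single_mul, contract_single_of_notMem hm, contract_single_of_notMem hn]

theorem contract_anticomm (m n : ℤ) : contract m * contract n + contract n * contract m = 0 := by
  rcases lt_trichotomy m n with h | h | h
  · exact contract_anticomm_of_lt h
  · simp [-Finsupp.single_mul, h, contract_mul_self]
  · rw [add_comm]; exact contract_anticomm_of_lt h

theorem wedge_contract_self (m : ℤ) : wedge m * contract m + contract m * wedge m = 1 := by
  refine Finsupp.lhom_ext fun S x => ?_
  have sq (k : ℕ) : (-1 : ℂ) ^ k * (-1) ^ k = 1 := by rw [← mul_pow]; simp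
  by_cases h : m ∈ S.1
  · have h1 : m ∉ (S.erase m).1 := by simp
    simp [-Finsupp.single_mul, wedge_single_of_mem h, contract_single_of_mem h, wedge_single_of_notMem h1,
      Monomial.adjoin_erase h, Monomial.above_erase_of_le, mul_assoc, sq]
  · have h1 : m ∈ (S.adjoin m).1 := by simp
    simp [-Finsupp.single_mul, wedge_single_of_notMem h, contract_single_of_notMem h, contract_single_of_mem h1,
      Monomial.erase_adjoin h, Monomial.above_adjoin_of_le, mul_assoc, sq]

theorem wedge_contract_of_ne {m n : ℤ} (hmn : m ≠ n) :
    wedge m * contract n + contract n * wedge m = 0 := by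
  refine Finsupp.lhom_ext fun S x => ?_
  by_cases hm : m ∈ S.1
  · by_cases hn : n ∈ S.1
    · have h1 : m ∈ (S.erase n).1 := ⟨hm, hmn⟩
      simp [-Finsupp.single_mul, wedge_single_of_mem hm, contract_single_of_mem hn, wedge_single_of_mem h1]
    · simp [-Finsupp.single_mul, wedge_single_of_mem hm, contract_single_of_notMem hn]
  · by_cases hn : n ∈ S.1
    · have h1 : m ∉ (S.erase n).1 := fun h => hm h.1
      have h2 : n ∈ (S.adjoin m).1 := Or.inr hn
      simp only [LinearMap.add_apply, Module.End.mul_apply, contract_single_of_mem hn,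
        wedge_single_of_notMem hm, contract_single_of_mem h2, wedge_single_of_notMem h1,
        S.erase_adjoin_comm hmn.symm, ← Finsupp.single_add, LinearMap.zero_apply]
      rw [Finsupp.single_eq_zero]
      rcases lt_or_gt_of_ne hmn with h | h
      · rw [← Monomial.above_erase_of_lt hn h, Monomial.above_adjoin_of_le S h.le]
        ring
      · rw [Monomial.above_erase_of_le S h.le, Monomial.above_adjoin_of_lt hm h]
        ring
    · have h1 : n ∉ (S.adjoin m).1 := by simp [-Finsupp.single_mul, hn, hmn.symm]
      simp [-Finsupp.single_mul, wedge_single_of_notMem hm, contract_single_of_notMem hn,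
        contract_single_of_notMem h1]

theorem wedge_contract (m n : ℤ) :
    wedge m * contract n + contract n * wedge m = (if m = n then (1 : ℂ) else 0) • 1 := by
  split_ifs with h
  · rw [h, wedge_contract_self, one_smul]
  · rw [wedge_contract_of_ne h, zero_smul]

/-! ### The vacuum -/

theorem wedge_ket {m i : ℤ} (h : i ≤ m) : wedge i (ket m) = 0 :=
  wedge_single_of_mem h 1

theorem contract_ket {m i : ℤ} (h : m < i) : contract i (ket m) = 0 :=
  contract_single_of_notMem (not_le.mpr h) 1

theorem above_vacuumIndex (m : ℤ) : (vacuumIndex m).above m = 0 := by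
  simp [Monomial.above, vacuumIndex, Set.Iic_inter_Ioi]

theorem bra_zero_wedge {i : ℤ} (h : 0 < i) (f : Fock) : bra 0 (wedge i f) = 0 := by
  suffices H : Finsupp.lapply (vacuumIndex 0) ∘ₗ wedge i = 0 from LinearMap.congr_fun H f
  refine Finsupp.lhom_ext fun S x => ?_
  by_cases hS : i ∈ S.1
  · simp [wedge_single_of_mem hS]
  · rw [LinearMap.comp_apply, wedge_single_of_notMem hS, Finsupp.lapply_apply,
      Finsupp.single_eq_of_ne, LinearMap.zero_apply]
    intro hS'
    have : i ∈ (vacuumIndex 0).1 := hS' ▸ (Or.inl rfl : i ∈ (S.adjoin i).1)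
    exact absurd this (not_le.mpr h)

theorem bra_zero_contract {i : ℤ} (h : i ≤ 0) (f : Fock) : bra 0 (contract i f) = 0 := by
  suffices H : Finsupp.lapply (vacuumIndex 0) ∘ₗ contract i = 0 from LinearMap.congr_fun H f
  refine Finsupp.lhom_ext fun S x => ?_
  by_cases hS : i ∈ S.1
  · rw [LinearMap.comp_apply, contract_single_of_mem hS, Finsupp.lapply_apply,
      Finsupp.single_eq_of_ne, LinearMap.zero_apply]
    intro hS'
    have : i ∈ (S.erase i).1 := hS' ▸ (show i ∈ (vacuumIndex 0).1 from h)
    exact this.2 rfl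
  · simp [contract_single_of_notMem hS]

/-- This turns the $\theta$-component of $\overline\sigma$ into an expectation against $\langle0|$
with one more fermion, to which Wick's theorem applies. -/
theorem bra_zero_wedge_zero (f : Fock) : bra 0 (wedge 0 f) = bra (-1) f := by
  suffices H : Finsupp.lapply (vacuumIndex 0) ∘ₗ wedge 0 = Finsupp.lapply (vacuumIndex (-1)) from
    LinearMap.congr_fun H f
  refine Finsupp.lhom_ext fun S x => ?_
  by_cases hS : (0 : ℤ) ∈ S.1
  · rw [LinearMap.comp_apply, wedge_single_of_mem hS, Finsupp.lapply_apply,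
      Finsupp.lapply_apply, Finsupp.single_eq_of_ne, Finsupp.zero_apply]
    rintro rfl
    exact absurd hS (by simp [vacuumIndex])
  · rw [LinearMap.comp_apply, wedge_single_of_notMem hS, Finsupp.lapply_apply,
      Finsupp.lapply_apply]
    by_cases hS' : S = vacuumIndex (-1)
    · subst hS'
      have h1 : (vacuumIndex (-1)).adjoin 0 = vacuumIndex 0 := Monomial.ext_mem fun x => by
        simp only [Monomial.mem_adjoin, vacuumIndex, Set.mem_Iic]; omega
      have h2 : (vacuumIndex (-1)).above 0 = 0 := by
        rw [← Monomial.above_adjoin_of_le _ (le_refl 0), h1, above_vacuumIndex]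
      rw [h1, h2]
      simp
    · rw [Finsupp.single_eq_of_ne, Finsupp.single_eq_of_ne (Ne.symm hS')]
      intro h1
      apply hS'
      have h3 := congrArg (fun T : Monomial => T.erase 0) h1
      simp only [Monomial.erase_adjoin hS] at h3
      rw [← h3]
      exact Monomial.ext_mem fun x => by
        simp only [Monomial.mem_erase, vacuumIndex, Set.mem_Iic]; omega

theorem bra_ket_zero : bra 0 (ket 0) = 1 := by simp [bra, ket]

/-! ### Locally finite sums of operators -/

section Field

variable {V ι : Type*} [AddCommGroup V] [Module ℂ V]

/-- On every vector, all but finitely many of the operators `F i` vanish. -/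
def LocFin (F : ι → Module.End ℂ V) : Prop := ∀ f, (Function.support fun i => F i f).Finite

open Classical in
/-- The sum of a locally finite family of operators. -/
def locSum (F : ι → Module.End ℂ V) : Module.End ℂ V :=
  if h : LocFin F then
    { toFun := fun f => ∑ᶠ i, F i f
      map_add' := fun f g => by
        simp only [map_add]
        exact finsum_add_distrib (h f) (h g)
      map_smul' := fun c f => by
        simp only [map_smul, RingHom.id_apply]
        exact (smul_finsum' c (h f)).symm }
  else 0

theorem locSum_apply {F : ι → Module.End ℂ V} (h : LocFin F) (f : V) :
    locSum F f = ∑ᶠ i, F i f := by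
  rw [locSum, dif_pos h]; rfl

theorem LocFin.mul_right {F : ι → Module.End ℂ V} (h : LocFin F) (T : Module.End ℂ V) :
    LocFin fun i => F i * T := fun f => h (T f)

theorem LocFin.mul_left {F : ι → Module.End ℂ V} (h : LocFin F) (T : Module.End ℂ V) :
    LocFin fun i => T * F i := fun f =>
  (h f).subset fun i hi h0 => hi (by simp only [Module.End.mul_apply, h0, map_zero])

theorem LocFin.smul {F : ι → Module.End ℂ V} (h : LocFin F) (c : ι → ℂ) :
    LocFin fun i => c i • F i := fun f =>
  (h f).subset fun i hi h0 => hi (by simp only [LinearMap.smul_apply, h0, smul_zero])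

theorem LocFin.add {F G : ι → Module.End ℂ V} (hF : LocFin F) (hG : LocFin G) :
    LocFin fun i => F i + G i := fun f =>
  ((hF f).union (hG f)).subset fun i hi => by
    by_contra h
    simp only [Set.mem_union, Function.mem_support, not_or, not_not] at h
    exact hi (by simp only [LinearMap.add_apply, h.1, h.2, add_zero])

theorem locSum_mul {F : ι → Module.End ℂ V} (h : LocFin F) (T : Module.End ℂ V) :
    locSum F * T = locSum fun i => F i * T := by
  ext f
  rw [locSum_apply (h.mul_right T), Module.End.mul_apply, locSum_apply h]; rfl

theorem mul_locSum {F : ι → Module.End ℂ V} (h : LocFin F) (T : Module.End ℂ V) :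
    T * locSum F = locSum fun i => T * F i := by
  ext f
  rw [locSum_apply (h.mul_left T), Module.End.mul_apply, locSum_apply h]
  exact AddMonoidHom.map_finsum (T : V →+ V) (h f)

theorem locSum_add {F G : ι → Module.End ℂ V} (hF : LocFin F) (hG : LocFin G) :
    locSum F + locSum G = locSum fun i => F i + G i := by
  ext f
  rw [locSum_apply (hF.add hG), LinearMap.add_apply, locSum_apply hF, locSum_apply hG]
  exact (finsum_add_distrib (hF f) (hG f)).symm

/-- On every vector, the operators `F i` vanish for large `i`. -/
def Upper (F : ℤ → Module.End ℂ V) : Prop := ∀ f, ∃ K : ℤ, ∀ i ≥ K, F i f = 0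

/-- The function vanishes for large negative arguments. -/
def Below (A : ℤ → ℂ) : Prop := ∃ N : ℤ, ∀ i < N, A i = 0

/-- The coefficients cut off the sum below and the operators, applied to a fixed vector, cut it off
above. -/
theorem locFin_field {F : ℤ → Module.End ℂ V} {A : ℤ → ℂ} (hF : Upper F) (hA : Below A) :
    LocFin fun i => A i • F i := fun f => by
  obtain ⟨K, hK⟩ := hF f
  obtain ⟨N, hN⟩ := hA
  refine (Set.finite_Ico N K).subset fun i hi => ⟨?_, ?_⟩
  · by_contra h
    exact hi (by simp [hN i (by omega)])
  · by_contra h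
    exact hi (by simp [hK i (by omega)])

/-- The operator `∑_i A_i F_i`. -/
def field (F : ℤ → Module.End ℂ V) (A : ℤ → ℂ) : Module.End ℂ V := locSum fun i => A i • F i

theorem field_apply {F : ℤ → Module.End ℂ V} {A : ℤ → ℂ} (hF : Upper F) (hA : Below A) (f : V) :
    field F A f = ∑ᶠ i, A i • F i f := locSum_apply (locFin_field hF hA) f

theorem Below.mul {A : ℤ → ℂ} (hA : Below A) (y : ℤ → ℂ) : Below fun i => A i * y i := by
  obtain ⟨N, hN⟩ := hA
  exact ⟨N, fun i hi => by simp [hN i hi]⟩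

theorem field_add {F : ℤ → Module.End ℂ V} (hF : Upper F) {A B : ℤ → ℂ} (hA : Below A)
    (hB : Below B) : field F (fun i => A i + B i) = field F A + field F B := by
  simp only [field, add_smul]
  exact (locSum_add (locFin_field hF hA) (locFin_field hF hB)).symm

theorem field_smul {F : ℤ → Module.End ℂ V} (hF : Upper F) {A : ℤ → ℂ} (hA : Below A) (c : ℂ) :
    field F (fun i => c * A i) = c • field F A := by
  ext f
  have : Below fun i => c * A i := by simpa only [mul_comm] using hA.mul fun _ => c
  rw [field_apply hF this, LinearMap.smul_apply, field_apply hF hA,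
    smul_finsum' (f := fun i => A i • F i f) c (locFin_field hF hA f)]
  simp only [mul_smul]

theorem support_mul_finite {A y : ℤ → ℂ} (hA : Below A) (hy : ∃ M : ℤ, ∀ i > M, y i = 0) :
    (Function.support fun i => A i * y i).Finite := by
  obtain ⟨N, hN⟩ := hA
  obtain ⟨M, hM⟩ := hy
  refine (Set.finite_Icc N M).subset fun i hi => ⟨?_, ?_⟩
  · by_contra h
    exact hi (by simp [hN i (by omega)])
  · by_contra h
    exact hi (by simp [hM i (by omega)])

theorem field_anticomm {F : ℤ → Module.End ℂ V} {A : ℤ → ℂ} (hF : Upper F) (hA : Below A)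
    {Y : Module.End ℂ V} {y : ℤ → ℂ} (hy : ∃ M : ℤ, ∀ i > M, y i = 0)
    (h : ∀ i, F i * Y + Y * F i = y i • 1) :
    field F A * Y + Y * field F A = (∑ᶠ i, A i * y i) • 1 := by
  rw [field, locSum_mul (locFin_field hF hA), mul_locSum (locFin_field hF hA),
    locSum_add ((locFin_field hF hA).mul_right Y) ((locFin_field hF hA).mul_left Y)]
  ext f
  rw [locSum_apply (((locFin_field hF hA).mul_right Y).add ((locFin_field hF hA).mul_left Y))]
  rw [LinearMap.smul_apply, Module.End.one_apply, finsum_smul' (support_mul_finite hA hy)]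
  refine finsum_congr fun i => ?_
  rw [smul_mul_assoc, mul_smul_comm, ← smul_add, h, smul_smul]
  rfl

theorem field_anticomm_single {F G : ℤ → Module.End ℂ V} {s : ℤ → ℂ}
    (h : ∀ i j, F i * G j + G j * F i = (if i = -j then s i else 0) • 1)
    (hF : Upper F) {A : ℤ → ℂ} (hA : Below A) (j : ℤ) :
    field F A * G j + G j * field F A = (A (-j) * s (-j)) • 1 := by
  rw [field_anticomm (y := fun i => if i = -j then s i else 0) hF hA
    ⟨-j, fun i hi => if_neg (by omega)⟩ (fun i => h i j)]
  rw [finsum_eq_single _ (-j) (fun i hi => by simp [hi])]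
  simp

theorem field_anticomm_field {F G : ℤ → Module.End ℂ V} {s : ℤ → ℂ}
    (h : ∀ i j, F i * G j + G j * F i = (if i = -j then s i else 0) • 1)
    (hF : Upper F) (hG : Upper G) {A B : ℤ → ℂ} (hA : Below A) (hB : Below B) :
    field F A * field G B + field G B * field F A = (∑ᶠ j, B j * (A (-j) * s (-j))) • 1 := by
  rw [add_comm]
  refine field_anticomm hG hB ?_ fun j => ?_
  · obtain ⟨N, hN⟩ := hA
    exact ⟨-N, fun i hi => by simp [hN (-i) (by omega)]⟩
  · rw [add_comm, field_anticomm_single h hF hA]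

theorem field_anticomm_zero {F G : ℤ → Module.End ℂ V}
    (h : ∀ i j, F i * G j + G j * F i = 0)
    (hF : Upper F) (hG : Upper G) {A B : ℤ → ℂ} (hA : Below A) (hB : Below B) :
    field F A * field G B + field G B * field F A = 0 := by
  rw [field_anticomm_field (s := fun _ => 0) (fun i j => by simp [h]) hF hG hA hB]
  simp

/-- The coefficients of `z^{-N} a(z)`. -/
def sh (N : ℤ) (a : PowerSeries ℂ) : ℤ → ℂ :=
  fun i => if 0 ≤ i + N then PowerSeries.coeff (i + N).toNat a else 0

theorem below_sh (N : ℤ) (a : PowerSeries ℂ) : Below (sh N a) :=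
  ⟨-N, fun i hi => if_neg (by omega)⟩

theorem sh_natCast_sub (N : ℤ) (a : PowerSeries ℂ) (n : ℕ) :
    sh N a (n - N) = PowerSeries.coeff n a := by
  simp [sh]

theorem sh_of_lt {N : ℤ} (a : PowerSeries ℂ) {i : ℤ} (h : i < -N) : sh N a i = 0 :=
  if_neg (by omega)

theorem sh_add (N : ℤ) (a b : PowerSeries ℂ) :
    sh N (a + b) = fun i => sh N a i + sh N b i := by
  funext i; simp only [sh]; split_ifs <;> simp

theorem sh_smul (N : ℤ) (c : ℂ) (a : PowerSeries ℂ) :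
    sh N (c • a) = fun i => c * sh N a i := by
  funext i; simp only [sh]; split_ifs <;> simp

theorem field_sh_eq_finsum {F : ℤ → Module.End ℂ V} (hF : Upper F) (N : ℤ) (a : PowerSeries ℂ)
    (f : V) : field F (sh N a) f = ∑ᶠ n : ℕ, PowerSeries.coeff n a • F (n - N) f := by
  have hinj : Function.Injective fun n : ℕ => (n : ℤ) - N := fun m n h => by
    simp only at h; omega
  have h : ∀ n : ℕ, PowerSeries.coeff n a • F (n - N) f =
      (fun i : ℤ => sh N a i • F i f) ((n : ℤ) - N) := fun n => by simp only [sh_natCast_sub]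
  simp only [h]
  rw [field_apply hF (below_sh N a)]
  rw [← finsum_mem_range (f := fun i : ℤ => sh N a i • F i f) hinj, ← finsum_mem_univ]
  refine finsum_mem_inter_support_eq' _ _ _ fun i hi => ⟨fun _ => ?_, fun _ => Set.mem_univ _⟩
  by_cases h0 : 0 ≤ i + N
  · exact ⟨(i + N).toNat, by simp only; omega⟩
  · exact absurd (by simp only; rw [sh_of_lt a (by omega), zero_smul]) hi

theorem field_sh_eq_sum {F : ℤ → Module.End ℂ V} (hF : Upper F) (N : ℤ) (a : PowerSeries ℂ)
    {f : V} {R : ℕ} (hR : ∀ i ≥ (R : ℤ) - N, F i f = 0) :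
    field F (sh N a) f = ∑ n ∈ Finset.range R, PowerSeries.coeff n a • F (n - N) f := by
  rw [field_sh_eq_finsum hF]
  refine finsum_eq_sum_of_support_subset _ fun n hn => ?_
  simp only [Finset.coe_range, Set.mem_Iio]
  by_contra h
  exact hn (by simp only; rw [hR _ (by omega), smul_zero])

theorem Upper.exists_nat {F : ℤ → Module.End ℂ V} (hF : Upper F) (N : ℤ) (f : V) :
    ∃ R : ℕ, ∀ i ≥ (R : ℤ) - N, F i f = 0 := by
  obtain ⟨K, hK⟩ := hF f
  exact ⟨(K + N).toNat, fun i hi => hK i (by omega)⟩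

/-- `a ↦ ∑_i a_i F_{i-N}` as a linear map. -/
def fieldMap (F : ℤ → Module.End ℂ V) (hF : Upper F) (N : ℤ) :
    PowerSeries ℂ →ₗ[ℂ] Module.End ℂ V where
  toFun a := field F (sh N a)
  map_add' a b := by rw [sh_add, field_add hF (below_sh N a) (below_sh N b)]
  map_smul' c a := by rw [sh_smul, field_smul hF (below_sh N a)]; rfl

/-- A high power of $z$ pushes all coefficients past the modes that act nontrivially on `f`. This is
the source of the local finiteness of the exponentials. -/
theorem field_sh_X_pow_mul {F : ℤ → Module.End ℂ V} (hF : Upper F) (N : ℤ) (f : V) :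
    ∃ K : ℕ, ∀ k ≥ K, ∀ a, field F (sh N (PowerSeries.X ^ k * a)) f = 0 := by
  obtain ⟨R, hR⟩ := hF.exists_nat N f
  refine ⟨R, fun k hk a => ?_⟩
  rw [field_sh_eq_sum hF N _ hR]
  refine Finset.sum_eq_zero fun n hn => ?_
  rw [PowerSeries.coeff_X_pow_mul', if_neg (by simp at hn; omega), zero_smul]

/-- If $[H,F_i]=\sum_kT_kF_{i+k}$, then $\mathrm{ad}\,H$ acts on the coefficient series of a field
as multiplication by $T$: the double sum over modes is a Cauchy product. -/
theorem commute_field {F : ℤ → Module.End ℂ V} (hF : Upper F) {H : Module.End ℂ V}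
    {T : PowerSeries ℂ} (h : ∀ i, H * F i = F i * H + field F (sh (-i) T)) (N : ℤ)
    (a : PowerSeries ℂ) :
    H * field F (sh N a) = field F (sh N a) * H + field F (sh N (T * a)) := by
  ext f
  obtain ⟨R₁, h₁⟩ := hF.exists_nat N f
  obtain ⟨R₂, h₂⟩ := hF.exists_nat N (H f)
  -- One bound serves both `f` and `H f`, so that every sum below runs over the same finite range.
  set R := max R₁ R₂
  have hf : ∀ i ≥ (R : ℤ) - N, F i f = 0 := fun i hi => h₁ i (by omega)
  have hHf : ∀ i ≥ (R : ℤ) - N, F i (H f) = 0 := fun i hi => h₂ i (by omega)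
  rw [LinearMap.add_apply, Module.End.mul_apply, Module.End.mul_apply,
    field_sh_eq_sum hF N a hf, field_sh_eq_sum hF N a hHf, field_sh_eq_sum hF N (T * a) hf,
    map_sum]
  have key : ∀ n ∈ Finset.range R, H (PowerSeries.coeff n a • F (n - N) f) =
      PowerSeries.coeff n a • F (n - N) (H f) + ∑ m ∈ Finset.range R,
        (if n ≤ m then PowerSeries.coeff n a * PowerSeries.coeff (m - n) T else 0) •
          F (m - N) f := fun n _ => by
    rw [map_smul, ← Module.End.mul_apply, h, LinearMap.add_apply, smul_add, Module.End.mul_apply]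
    congr 1
    rw [field_sh_eq_sum hF _ T (R := R) (fun i hi => hf i (by omega)), Finset.smul_sum]
    have e : ∀ m : ℕ, (m : ℤ) - -((n : ℤ) - N) = ((m + n : ℕ) : ℤ) - N := fun m => by
      push_cast; ring
    simp only [e, ite_smul, zero_smul, smul_smul]
    rw [← Finset.sum_filter]
    symm
    -- The shift by `n` misses only indices whose mode lies beyond `R` and so kills `f`.
    refine Finset.sum_of_injOn (fun m => m - n) ?_ ?_ ?_ ?_
    · intro x hx y hy hxy
      simp only [Finset.coe_filter, Finset.mem_range, Set.mem_ofPred_eq] at hx hy hxy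
      omega
    · intro x hx
      simp only [Finset.coe_filter, Finset.mem_range, Set.mem_ofPred_eq, Finset.coe_range,
        Set.mem_Iio] at hx ⊢
      omega
    · intro m hm hm'
      rw [hf, smul_zero]
      by_contra hlt
      refine hm' ⟨m + n, ?_, by simp⟩
      simp only [Finset.coe_filter, Finset.mem_range, Set.mem_ofPred_eq]
      omega
    · intro m hm
      simp only [Finset.mem_filter] at hm
      rw [Nat.sub_add_cancel hm.2]
  rw [Finset.sum_congr rfl key, Finset.sum_add_distrib, Finset.sum_comm]
  congr 1
  refine Finset.sum_congr rfl fun m hm => ?_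
  rw [← Finset.sum_smul, mul_comm T a, PowerSeries.coeff_mul,
    Finset.Nat.sum_antidiagonal_eq_sum_range_succ
      (fun i j => PowerSeries.coeff i a * PowerSeries.coeff j T), ← Finset.sum_filter]
  congr 2
  ext n
  simp only [Finset.mem_filter, Finset.mem_range] at hm ⊢
  omega

end Field

/-! ### Exponentials of locally nilpotent operators -/

/-- The support lies in a `K` by `L` rectangle, which lies in the triangle $k+l<K+L$. This finite
rearrangement is what proves $e^{x+y}=e^xe^y$, both for series and for operators. -/
theorem sum_range_sum_antidiagonal {M : Type*} [AddCommMonoid M] (g : ℕ → ℕ → M) {K L : ℕ}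
    (hK : ∀ k ≥ K, ∀ l, g k l = 0) (hL : ∀ l ≥ L, ∀ k, g k l = 0) :
    ∑ n ∈ Finset.range (K + L), ∑ p ∈ Finset.HasAntidiagonal.antidiagonal n, g p.1 p.2 =
      ∑ k ∈ Finset.range K, ∑ l ∈ Finset.range L, g k l := by
  rw [← Finset.sum_product', ← Finset.sum_fiberwise_of_maps_to (g := fun p : ℕ × ℕ => p.1 + p.2)
    (t := Finset.range (K + L))]
  · refine Finset.sum_congr rfl fun n _ => ?_
    symm
    refine Finset.sum_subset_zero_on_sdiff (fun p hp => ?_) (fun p hp => ?_) fun _ _ => rfl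
    · simp only [Finset.mem_filter] at hp
      exact Finset.HasAntidiagonal.mem_antidiagonal.mpr hp.2
    · simp only [Finset.mem_sdiff, Finset.HasAntidiagonal.mem_antidiagonal, Finset.mem_filter, Finset.mem_product,
        Finset.mem_range] at hp
      by_cases h1 : p.1 < K
      · exact hL _ (by by_contra h; exact hp.2 ⟨⟨h1, by omega⟩, hp.1⟩) _
      · exact hK _ (by omega) _
  · intro p hp
    simp only [Finset.mem_product, Finset.mem_range] at hp ⊢
    omega

theorem inv_factorial_mul_choose (k l : ℕ) :
    ((k + l)! : ℂ)⁻¹ * ((k + l).choose k : ℂ) = (k ! : ℂ)⁻¹ * (l ! : ℂ)⁻¹ := by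
  have h := congrArg (Nat.cast (R := ℂ)) (Nat.add_choose_mul_factorial_mul_factorial k l)
  push_cast at h
  have h0 := Nat.cast_ne_zero (R := ℂ).mpr (Nat.factorial_ne_zero (k + l))
  have h1 := Nat.cast_ne_zero (R := ℂ).mpr (Nat.factorial_ne_zero k)
  have h2 := Nat.cast_ne_zero (R := ℂ).mpr (Nat.factorial_ne_zero l)
  rw [Nat.choose_symm_add]
  field_simp
  linear_combination h

/-- The power series `exp(∑_{k>0} t_k z^k)`, the generating series of the `s_j(t)`. -/
def expSeries (t : Times) : PowerSeries ℂ := (PowerSeries.exp ℂ).subst (timesSeries t)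

theorem coeff_expSeries (n : ℕ) (t : Times) : PowerSeries.coeff n (expSeries t) = schur n t := rfl

theorem constantCoeff_timesSeries (t : Times) :
    PowerSeries.constantCoeff (timesSeries t) = 0 := by
  rw [← PowerSeries.coeff_zero_eq_constantCoeff_apply]
  simp [timesSeries]

theorem coeff_timesSeries (t : Times) (k : ℕ+) : PowerSeries.coeff (k : ℕ) (timesSeries t) = t k := by
  rw [timesSeries, PowerSeries.coeff_mk, dif_pos k.pos]; rfl

theorem timesSeries_ext {t : Times} {a : PowerSeries ℂ} (h0 : PowerSeries.constantCoeff a = 0)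
    (h : ∀ k : ℕ+, PowerSeries.coeff (k : ℕ) (timesSeries t) = PowerSeries.coeff (k : ℕ) a) :
    timesSeries t = a := by
  ext n
  rcases Nat.eq_zero_or_pos n with rfl | hn
  · simp [constantCoeff_timesSeries, h0]
  · exact h ⟨n, hn⟩

theorem coeff_timesSeries_pow (t : Times) {n d : ℕ} (h : n < d) :
    PowerSeries.coeff n (timesSeries t ^ d) = 0 := by
  refine PowerSeries.coeff_of_lt_order _ (lt_of_lt_of_le ?_ (PowerSeries.le_order_pow _ d))
  have h1 : 1 ≤ (timesSeries t).order :=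
    PowerSeries.one_le_order_iff_constCoeff_eq_zero.mpr (constantCoeff_timesSeries t)
  calc (n : ℕ∞) < d := by exact_mod_cast h
    _ = d • (1 : ℕ∞) := by simp
    _ ≤ d • (timesSeries t).order := nsmul_le_nsmul_right h1 d

/-- The $d$-th power of a series without constant term has order at least $d$, so the exponential
can be truncated at any `D` beyond the degree read off. -/
theorem schur_eq_sum (t : Times) {n D : ℕ} (h : n < D) :
    schur n t =
      ∑ d ∈ Finset.range D, (d ! : ℂ)⁻¹ * PowerSeries.coeff n (timesSeries t ^ d) := by
  rw [schur, PowerSeries.coeff_subst'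
    (PowerSeries.HasSubst.of_constantCoeff_zero' (constantCoeff_timesSeries t))]
  rw [finsum_eq_sum_of_support_subset (s := Finset.range D)]
  · refine Finset.sum_congr rfl fun d _ => ?_
    simp [PowerSeries.coeff_exp]
  · intro d hd
    simp only [Finset.coe_range, Set.mem_Iio]
    by_contra hD
    exact hd (by simp only; rw [coeff_timesSeries_pow t (by omega), smul_zero])

theorem expSeries_add (s t : Times) : expSeries (s + t) = expSeries s * expSeries t := by
  have hadd : timesSeries (s + t) = timesSeries s + timesSeries t := by
    refine timesSeries_ext (by simp [constantCoeff_timesSeries]) fun k => ?_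
    rw [map_add, coeff_timesSeries, coeff_timesSeries, coeff_timesSeries]; rfl
  ext n
  rw [coeff_expSeries, PowerSeries.coeff_mul]
  simp only [coeff_expSeries]
  have e : ∀ p ∈ Finset.HasAntidiagonal.antidiagonal n, schur p.1 s * schur p.2 t =
      ∑ k ∈ Finset.range (n + 1), ∑ l ∈ Finset.range (n + 1), ((k ! : ℂ)⁻¹ * (l ! : ℂ)⁻¹) *
        (PowerSeries.coeff p.1 (timesSeries s ^ k) * PowerSeries.coeff p.2 (timesSeries t ^ l)) := fun p hp => by
    have := Finset.HasAntidiagonal.mem_antidiagonal.mp hp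
    rw [schur_eq_sum s (D := n + 1) (by omega), schur_eq_sum t (D := n + 1) (by omega),
      Finset.sum_mul_sum]
    refine Finset.sum_congr rfl fun k _ => Finset.sum_congr rfl fun l _ => ?_
    ring
  -- The truncation is twice as long as that of each factor so that its triangle covers the product
  -- of the two ranges.
  rw [Finset.sum_congr rfl e, Finset.sum_comm, schur_eq_sum (s + t) (D := n + 1 + (n + 1))
    (by omega), hadd]
  simp only [Finset.sum_comm (s := Finset.HasAntidiagonal.antidiagonal n), ← Finset.mul_sum,
    ← PowerSeries.coeff_mul]
  rw [← sum_range_sum_antidiagonal (fun k l => ((k ! : ℂ)⁻¹ * (l ! : ℂ)⁻¹) *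
    PowerSeries.coeff n (timesSeries s ^ k * timesSeries t ^ l))]
  · refine Finset.sum_congr rfl fun d _ => ?_
    rw [(Commute.all _ _).add_pow', map_sum, Finset.mul_sum]
    refine Finset.sum_congr rfl fun p hp => ?_
    rw [map_nsmul, nsmul_eq_mul, ← mul_assoc]
    congr 1
    rw [← Finset.HasAntidiagonal.mem_antidiagonal.mp hp, inv_factorial_mul_choose]
  · intro k hk l
    rw [PowerSeries.coeff_mul, Finset.sum_eq_zero, mul_zero]
    intro p hp
    have := Finset.HasAntidiagonal.mem_antidiagonal.mp hp
    rw [coeff_timesSeries_pow s (by omega), zero_mul]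
  · intro l hl k
    rw [PowerSeries.coeff_mul, Finset.sum_eq_zero, mul_zero]
    intro p hp
    have := Finset.HasAntidiagonal.mem_antidiagonal.mp hp
    rw [coeff_timesSeries_pow t (by omega), mul_zero]

/-- Passing from $c$ to $\tilde c$ is the substitution $z\mapsto-z$. -/
theorem schur_tilde (n : ℕ) (c : Times) : schur n (tilde c) = (-1) ^ n * schur n c := by
  have h : timesSeries (tilde c) = PowerSeries.rescale (-1 : ℂ) (timesSeries c) := by
    refine timesSeries_ext ?_ fun k => ?_
    · rw [← PowerSeries.coeff_zero_eq_constantCoeff_apply, PowerSeries.coeff_rescale,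
        PowerSeries.coeff_zero_eq_constantCoeff_apply, constantCoeff_timesSeries, mul_zero]
    rw [PowerSeries.coeff_rescale, coeff_timesSeries, coeff_timesSeries]; rfl
  rw [schur_eq_sum _ n.lt_succ_self, schur_eq_sum _ n.lt_succ_self, Finset.mul_sum]
  refine Finset.sum_congr rfl fun d _ => ?_
  rw [h, ← map_pow, PowerSeries.coeff_rescale]
  ring

theorem schur_zero (t : Times) : schur 0 t = 1 := by
  rw [schur_eq_sum t (D := 1) (by omega)]
  simp

section Exp

variable {V : Type*} [AddCommGroup V] [Module ℂ V]

/-- The vector `f` is annihilated by a power of `A`. -/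
def NilAt (A : Module.End ℂ V) (f : V) : Prop := ∃ L : ℕ, ∀ l ≥ L, (A ^ l) f = 0

/-- `exp(A) f = ∑ₙ Aⁿ f / n!`. -/
def expEnd (A : Module.End ℂ V) (f : V) : V := ∑ᶠ n : ℕ, ((n ! : ℂ)⁻¹) • (A ^ n) f

theorem nilAt_support {A : Module.End ℂ V} {f : V} (h : NilAt A f) :
    (Function.support fun n : ℕ => ((n ! : ℂ)⁻¹) • (A ^ n) f).Finite := by
  obtain ⟨L, hL⟩ := h
  refine (Set.finite_Iio L).subset fun n hn => ?_
  by_contra h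
  exact hn (by simp only; rw [hL n (by simpa using h), smul_zero])

theorem expEnd_eq_sum {A : Module.End ℂ V} {f : V} {L : ℕ} (h : ∀ l ≥ L, (A ^ l) f = 0) :
    expEnd A f = ∑ n ∈ Finset.range L, ((n ! : ℂ)⁻¹) • (A ^ n) f := by
  refine finsum_eq_sum_of_support_subset _ fun n hn => ?_
  simp only [Finset.coe_range, Set.mem_Iio]
  by_contra hlt
  exact hn (by simp only; rw [h n (by omega), smul_zero])

theorem nilAt_of_eq_zero {A : Module.End ℂ V} {f : V} (h : A f = 0) : NilAt A f :=
  ⟨1, fun l hl => by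
    obtain ⟨k, rfl⟩ := Nat.exists_eq_add_of_le' hl
    rw [pow_succ, Module.End.mul_apply, h, map_zero]⟩

theorem expEnd_of_eq_zero {A : Module.End ℂ V} {f : V} (h : A f = 0) : expEnd A f = f := by
  rw [expEnd_eq_sum (L := 1) fun l hl => by
    obtain ⟨k, rfl⟩ := Nat.exists_eq_add_of_le' hl
    rw [pow_succ, Module.End.mul_apply, h, map_zero]]
  simp

/-- `exp(A) W = W' exp(A)` on the vectors that are annihilated by a power of `A`, and `W` preserves
this class of vectors. -/
def Intertwines (A W W' : Module.End ℂ V) : Prop :=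
  ∀ f, NilAt A f → NilAt A (W f) ∧ expEnd A (W f) = W' (expEnd A f)

theorem Intertwines.add {A W₁ W₁' W₂ W₂' : Module.End ℂ V} (h₁ : Intertwines A W₁ W₁')
    (h₂ : Intertwines A W₂ W₂') : Intertwines A (W₁ + W₂) (W₁' + W₂') := fun f hf => by
  obtain ⟨n₁, e₁⟩ := h₁ f hf
  obtain ⟨n₂, e₂⟩ := h₂ f hf
  refine ⟨?_, ?_⟩
  · obtain ⟨L₁, hL₁⟩ := n₁
    obtain ⟨L₂, hL₂⟩ := n₂
    exact ⟨max L₁ L₂, fun l hl => by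
      rw [LinearMap.add_apply, map_add, hL₁ l (by omega), hL₂ l (by omega), add_zero]⟩
  · rw [LinearMap.add_apply, LinearMap.add_apply, ← e₁, ← e₂, expEnd, expEnd, expEnd,
      ← finsum_add_distrib (nilAt_support n₁) (nilAt_support n₂)]
    simp only [map_add, smul_add]

theorem Intertwines.smul {A W W' : Module.End ℂ V} (h : Intertwines A W W') (c : ℂ) :
    Intertwines A (c • W) (c • W') := fun f hf => by
  obtain ⟨n, e⟩ := h f hf
  refine ⟨?_, ?_⟩
  · obtain ⟨L, hL⟩ := n
    exact ⟨L, fun l hl => by rw [LinearMap.smul_apply, map_smul, hL l hl, smul_zero]⟩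
  · rw [LinearMap.smul_apply, LinearMap.smul_apply, ← e, expEnd, expEnd,
      smul_finsum' c (nilAt_support n)]
    simp only [map_smul, smul_comm c]

/-- Preservation of the nilpotent vectors is part of the notion precisely so that the first relation
may be used at the vector `W₂ f`. -/
theorem Intertwines.mul {A W₁ W₁' W₂ W₂' : Module.End ℂ V} (h₁ : Intertwines A W₁ W₁')
    (h₂ : Intertwines A W₂ W₂') : Intertwines A (W₁ * W₂) (W₁' * W₂') := fun f hf => by
  obtain ⟨n₂, e₂⟩ := h₂ f hf
  obtain ⟨n₁, e₁⟩ := h₁ _ n₂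
  exact ⟨n₁, by rw [Module.End.mul_apply, e₁, e₂]; rfl⟩

theorem Intertwines.one (A : Module.End ℂ V) : Intertwines A 1 1 := fun _ hf => ⟨hf, rfl⟩

theorem Intertwines.ofFn_prod {A : Module.End ℂ V} {m : ℕ} {w w' : Fin m → Module.End ℂ V}
    (h : ∀ i, Intertwines A (w i) (w' i)) :
    Intertwines A (List.ofFn w).prod (List.ofFn w').prod := by
  induction m with
  | zero => simpa using Intertwines.one A
  | succ m ih =>
    rw [List.ofFn_succ, List.ofFn_succ, List.prod_cons, List.prod_cons]
    exact (h 0).mul (ih fun i => h i.succ)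

/-- With $\mu(a\otimes f)=B(a)f$, the hypothesis reads $A\mu=\mu(X+Y)$, where $X$ multiplies the
series by $T$ and $Y$ applies $A$ to the vector. These act on different tensor factors, hence
commute, and the binomial theorem applies. -/
theorem pow_mul_family {A : Module.End ℂ V} {B : PowerSeries ℂ →ₗ[ℂ] Module.End ℂ V}
    {T : PowerSeries ℂ} (h : ∀ a, A * B a = B a * A + B (T * a)) (n : ℕ) (a : PowerSeries ℂ)
    (f : V) : (A ^ n) (B a f) =
      ∑ p ∈ Finset.HasAntidiagonal.antidiagonal n, (n.choose p.1) • B (T ^ p.1 * a) ((A ^ p.2) f) := by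
  let μ : PowerSeries ℂ ⊗[ℂ] V →ₗ[ℂ] V := TensorProduct.lift B
  let X : Module.End ℂ (PowerSeries ℂ ⊗[ℂ] V) := TensorProduct.map (LinearMap.mulLeft ℂ T) 1
  let Y : Module.End ℂ (PowerSeries ℂ ⊗[ℂ] V) := TensorProduct.map 1 A
  have hX : ∀ k b g, (X ^ k) (b ⊗ₜ g) = (T ^ k * b) ⊗ₜ g := fun k => by
    induction k with
    | zero => simp
    | succ k ih => intro b g; rw [pow_succ', Module.End.mul_apply, ih, pow_succ']; simp [X, mul_assoc]
  have hY : ∀ k b g, (Y ^ k) (b ⊗ₜ g) = b ⊗ₜ ((A ^ k) g) := fun k => by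
    induction k with
    | zero => simp
    | succ k ih => intro b g; rw [pow_succ', Module.End.mul_apply, ih, pow_succ']; simp [Y]
  have hXY : Commute X Y := by
    refine TensorProduct.ext' fun b g => ?_
    simp [X, Y]
  have hμ : A ∘ₗ μ = μ ∘ₗ (X + Y) := by
    refine TensorProduct.ext' fun b g => ?_
    have := LinearMap.congr_fun (h b) g
    simp only [Module.End.mul_apply, LinearMap.add_apply] at this
    simp [μ, X, Y, this, add_comm]
  have hpow : ∀ k, (A ^ k) ∘ₗ μ = μ ∘ₗ ((X + Y) ^ k) := fun k => by
    induction k with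
    | zero => rfl
    | succ k ih =>
      calc (A ^ (k + 1)) ∘ₗ μ = (A ^ k) ∘ₗ (A ∘ₗ μ) := by rw [pow_succ]; rfl
        _ = ((A ^ k) ∘ₗ μ) ∘ₗ (X + Y) := by rw [hμ]; rfl
        _ = _ := by rw [ih, pow_succ]; rfl
  have := LinearMap.congr_fun (hpow n) (a ⊗ₜ f)
  rw [hXY.add_pow'] at this
  simp only [LinearMap.comp_apply, μ, TensorProduct.lift.tmul, LinearMap.sum_apply, map_sum] at this
  rw [this]
  refine Finset.sum_congr rfl fun p _ => ?_
  rw [LinearMap.smul_apply, map_nsmul, Module.End.mul_apply, hY, hX, TensorProduct.lift.tmul]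

/-- Dividing the binomial expansion of $A^nB(a)$ by $n!$ and summing over $n$ separates it into
$\sum_kT^k/k!$ inside $B$ and $\sum_lA^l/l!$ on the vector. -/
theorem intertwines_family {A : Module.End ℂ V} {B : PowerSeries ℂ →ₗ[ℂ] Module.End ℂ V}
    {t : Times} (h : ∀ a, A * B a = B a * A + B (timesSeries t * a))
    (hB : ∀ f, ∃ K : ℕ, ∀ k ≥ K, ∀ a, B (PowerSeries.X ^ k * a) f = 0) (a : PowerSeries ℂ) :
    Intertwines A (B a) (B (expSeries t * a)) := by
  rintro f ⟨L, hL⟩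
  -- The bound can be chosen uniformly in `l` since only the finitely many vectors with `l < L` are
  -- nonzero.
  obtain ⟨K, hK⟩ : ∃ K : ℕ, ∀ k ≥ K, ∀ l, ∀ a, B (PowerSeries.X ^ k * a) ((A ^ l) f) = 0 := by
    choose κ hκ using fun l => hB ((A ^ l) f)
    refine ⟨(Finset.range L).sup κ, fun k hk l b => ?_⟩
    by_cases hl : l < L
    · exact hκ l k (le_trans (Finset.le_sup (Finset.mem_range.mpr hl)) hk) b
    · rw [hL l (by omega), map_zero]
  obtain ⟨T', hT'⟩ := PowerSeries.X_dvd_iff.mpr (constantCoeff_timesSeries t)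
  have hT : ∀ k ≥ K, ∀ l, B (timesSeries t ^ k * a) ((A ^ l) f) = 0 := fun k hk l => by
    rw [hT', mul_pow, mul_assoc]
    exact hK k hk l _
  have hnil : ∀ n ≥ K + L, (A ^ n) (B a f) = 0 := fun n hn => by
    rw [pow_mul_family h]
    refine Finset.sum_eq_zero fun p hp => ?_
    have := Finset.HasAntidiagonal.mem_antidiagonal.mp hp
    by_cases hp1 : K ≤ p.1
    · rw [hT _ hp1, smul_zero]
    · rw [hL p.2 (by omega), map_zero, smul_zero]
  refine ⟨⟨K + L, hnil⟩, ?_⟩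
  have hexp : ∀ l, B (expSeries t * a) ((A ^ l) f) =
      ∑ k ∈ Finset.range K, (k ! : ℂ)⁻¹ • B (timesSeries t ^ k * a) ((A ^ l) f) := fun l => by
    -- The error of truncating the exponential is divisible by $z^K$, so `B` sends it to an operator
    -- that kills all the vectors involved.
    obtain ⟨r, hr⟩ : PowerSeries.X ^ K ∣ expSeries t -
        ∑ k ∈ Finset.range K, (k ! : ℂ)⁻¹ • timesSeries t ^ k := by
      rw [PowerSeries.X_pow_dvd_iff]
      intro m hm
      rw [map_sub, coeff_expSeries, schur_eq_sum t hm, map_sum, sub_eq_zero]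
      refine Finset.sum_congr rfl fun d _ => ?_
      rw [map_smul, smul_eq_mul]
    rw [sub_eq_iff_eq_add] at hr
    rw [hr, add_mul, map_add, LinearMap.add_apply, mul_assoc, hK K le_rfl, zero_add,
      Finset.sum_mul, map_sum, LinearMap.sum_apply]
    refine Finset.sum_congr rfl fun k _ => ?_
    rw [smul_mul_assoc, map_smul, LinearMap.smul_apply]
  rw [expEnd_eq_sum hnil, expEnd_eq_sum hL, map_sum]
  simp only [map_smul, hexp, pow_mul_family h, Finset.smul_sum]
  rw [Finset.sum_comm, ← sum_range_sum_antidiagonal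
    (fun k l => (l ! : ℂ)⁻¹ • (k ! : ℂ)⁻¹ • B (timesSeries t ^ k * a) ((A ^ l) f))]
  · refine Finset.sum_congr rfl fun n _ => Finset.sum_congr rfl fun p hp => ?_
    rw [← Nat.cast_smul_eq_nsmul ℂ, smul_smul, smul_smul]
    congr 1
    rw [← Finset.HasAntidiagonal.mem_antidiagonal.mp hp, inv_factorial_mul_choose, mul_comm]
  · intro k hk l
    rw [hT k hk, smul_zero, smul_zero]
  · intro l hl k
    rw [hL l hl, map_zero, smul_zero, smul_zero]

theorem intertwines_field {F : ℤ → Module.End ℂ V} (hF : Upper F) {H : Module.End ℂ V}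
    {t : Times} (h : ∀ i, H * F i = F i * H + field F (sh (-i) (timesSeries t))) (N : ℤ)
    (a : PowerSeries ℂ) :
    Intertwines H (field F (sh N a)) (field F (sh N (expSeries t * a))) :=
  intertwines_family (B := fieldMap F hF N) (commute_field hF h N)
    (fun f => field_sh_X_pow_mul hF N f) a

end Exp

/-! ### Products of operators with scalar anticommutators -/

section Clifford

variable {R : Type*} [Ring R] [Algebra ℂ R]

/-- Carrying `d` to the right costs a sign at each factor and leaves the scalar anticommutator
behind in place of that factor. This is the expansion underlying the Pfaffian. -/
theorem mul_ofFn_prod {k : ℕ} (d : R) (w : Fin (k + 1) → R) (c : Fin (k + 1) → ℂ)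
    (h : ∀ j, d * w j + w j * d = c j • 1) :
    d * (List.ofFn w).prod =
      ∑ j : Fin (k + 1), ((-1 : ℂ) ^ (j : ℕ) * c j) • (List.ofFn fun a => w (j.succAbove a)).prod +
        (-1 : ℂ) ^ (k + 1) • ((List.ofFn w).prod * d) := by
  induction k with
  | zero => simpa [← sub_eq_add_neg, eq_sub_iff_add_eq] using h 0
  | succ k ih =>
    have ih' := ih (fun a => w a.succ) (fun a => c a.succ) fun a => h a.succ
    rw [List.ofFn_succ, List.prod_cons, ← mul_assoc, eq_sub_of_add_eq (h 0), sub_mul, mul_assoc,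
      ih', mul_add, Finset.mul_sum,
      Fin.sum_univ_succ (fun j : Fin (k + 2) => _ • (List.ofFn fun a => w (j.succAbove a)).prod)]
    simp only [Fin.succAbove_zero, Fin.val_zero, pow_zero, one_mul, smul_mul_assoc,
      List.ofFn_succ (f := fun a => w (Fin.succAbove (Fin.succ _) a)), Fin.succ_succAbove_zero,
      Fin.succ_succAbove_succ, List.prod_cons, Fin.val_succ, pow_succ, mul_neg, mul_one, neg_mul,
      neg_smul, mul_smul_comm, Finset.sum_neg_distrib, mul_assoc]
    abel

theorem mul_ofFn_prod_of_anticomm {k : ℕ} {d : R} {w : Fin k → R}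
    (h : ∀ j, d * w j + w j * d = 0) :
    d * (List.ofFn w).prod = (-1 : ℂ) ^ k • ((List.ofFn w).prod * d) := by
  cases k with
  | zero => simp
  | succ k =>
    rw [mul_ofFn_prod d w (fun _ => 0) fun j => by rw [h j, zero_smul]]
    simp

/-- Reorders $v_1\cdots v_k\hat v_1\cdots\hat v_k$ into $\prod v_i\hat v_i$. The exponent is left
unspecified because the sign squares away in the bilinear identity and does not affect the charge.
-/
theorem ofFn_prod_mul_ofFn_prod {k : ℕ} {a b : Fin k → R}
    (h : ∀ i j, a i * b j + b j * a i = 0) :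
    ∃ e : ℕ, (List.ofFn a).prod * (List.ofFn b).prod =
      (-1 : ℂ) ^ e • (List.ofFn fun i => a i * b i).prod := by
  induction k with
  | zero => exact ⟨0, by simp⟩
  | succ k ih =>
    obtain ⟨e, he⟩ := ih (a := fun i => a i.succ) (b := fun i => b i.succ)
      fun i j => h i.succ j.succ
    refine ⟨k + e, ?_⟩
    have h1 := mul_ofFn_prod_of_anticomm (d := b 0) (w := fun i : Fin k => a i.succ)
      fun j => by rw [add_comm]; exact h j.succ 0
    have h2 : (List.ofFn fun i : Fin k => a i.succ).prod * b 0 =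
        (-1 : ℂ) ^ k • (b 0 * (List.ofFn fun i : Fin k => a i.succ).prod) := by
      rw [h1, smul_smul, ← mul_pow]; simp
    rw [List.ofFn_succ, List.prod_cons, List.ofFn_succ (f := b), List.prod_cons, List.ofFn_succ,
      List.prod_cons, mul_assoc, ← mul_assoc _ (b 0), h2, smul_mul_assoc, mul_smul_comm, mul_assoc,
      he, mul_smul_comm, mul_smul_comm, smul_smul, pow_add, mul_assoc]

end Clifford

/-! ### Pfaffians -/

theorem pf_succ_succ (n : ℕ) (A : Matrix (Fin (n + 2)) (Fin (n + 2)) ℂ) :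
    pf (n + 2) A = ∑ j : Fin (n + 1), (-1 : ℂ) ^ (j : ℕ) * A 0 j.succ *
      pf n (A.submatrix (fun a => (j.succAbove a).succ) (fun a => (j.succAbove a).succ)) := by
  rw [pf]

theorem pf_congr {m : ℕ} {A B : Matrix (Fin m) (Fin m) ℂ} (h : ∀ i j, i < j → A i j = B i j) :
    pf m A = pf m B := by
  induction m using Nat.twoStepInduction with
  | zero => simp [pf]
  | one => simp [pf]
  | more n ih _ =>
    rw [pf_succ_succ, pf_succ_succ]
    refine Finset.sum_congr rfl fun j _ => ?_
    rw [h 0 j.succ (Fin.succ_pos j), ih]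
    intro a b hab
    exact h _ _ (Fin.succ_lt_succ_iff.mpr (Fin.strictMono_succAbove j hab))

theorem pf_scale {m : ℕ} (x : Fin m → ℂ) (A : Matrix (Fin m) (Fin m) ℂ) :
    pf m (Matrix.of fun i j => x i * x j * A i j) = (∏ i, x i) * pf m A := by
  induction m using Nat.twoStepInduction with
  | zero => simp [pf]
  | one => simp [pf]
  | more n ih _ =>
    rw [pf_succ_succ, pf_succ_succ, Finset.mul_sum]
    refine Finset.sum_congr rfl fun j _ => ?_
    have := ih (fun a => x (j.succAbove a).succ)
      (A.submatrix (fun a => (j.succAbove a).succ) (fun a => (j.succAbove a).succ))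
    rw [Fin.prod_univ_succ, Fin.prod_univ_succAbove _ j]
    calc _ = (-1) ^ (j : ℕ) * (x 0 * x j.succ * A 0 j.succ) *
        ((∏ a, x (j.succAbove a).succ) * pf n (A.submatrix (fun a => (j.succAbove a).succ)
          (fun a => (j.succAbove a).succ))) := by rw [← this]; rfl
      _ = _ := by ring

theorem pf_of_odd {m : ℕ} (hm : Odd m) (A : Matrix (Fin m) (Fin m) ℂ) : pf m A = 0 := by
  induction m using Nat.twoStepInduction with
  | zero => exact absurd hm (by decide)
  | one => simp [pf]
  | more n ih _ =>
    rw [pf_succ_succ]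
    refine Finset.sum_eq_zero fun j _ => ?_
    rw [ih (by rw [Nat.odd_iff] at hm ⊢; omega), mul_zero]

/-- Wick's theorem. -/
theorem wick {V : Type*} [AddCommGroup V] [Module ℂ V] (vac : V) (ev : V →ₗ[ℂ] ℂ)
    (hev : ev vac = 1) {m : ℕ} (w d : Fin m → Module.End ℂ V) (c : Fin m → Fin m → ℂ)
    (hd : ∀ i f, ev (w i f) = ev (d i f)) (hvac : ∀ i, d i vac = 0)
    (hc : ∀ i j, d i * w j + w j * d i = c i j • 1) :
    ev ((List.ofFn w).prod vac) = pf m (Matrix.of c) := by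
  induction m using Nat.twoStepInduction with
  | zero => simpa [pf] using hev
  | one => simp [pf, hd, hvac]
  | more n ih _ =>
    -- Against `ev` the first operator may be replaced by its annihilating part `d 0`, which is then
    -- pushed to the vacuum and dies there; the contractions left behind give the expansion along
    -- the first row.
    rw [List.ofFn_succ, List.prod_cons, Module.End.mul_apply, hd, ← Module.End.mul_apply,
      mul_ofFn_prod (d 0) (fun j => w j.succ) (fun j => c 0 j.succ) fun j => hc 0 j.succ,
      pf_succ_succ, LinearMap.add_apply, LinearMap.smul_apply, Module.End.mul_apply, hvac, map_zero,
      smul_zero, add_zero, LinearMap.sum_apply, map_sum]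
    refine Finset.sum_congr rfl fun j _ => ?_
    rw [LinearMap.smul_apply, map_smul, smul_eq_mul,
      ih (fun a => w (j.succAbove a).succ) (fun a => d (j.succAbove a).succ)
        (fun a b => c (j.succAbove a).succ (j.succAbove b).succ) (fun a => hd _)
        (fun a => hvac _) (fun a b => hc _ _)]
    rfl

/-! ### Quadratic operators -/

section Quadratic

variable {V : Type*} [AddCommGroup V] [Module ℂ V]

/-- The operator `∑_{a+b=k} ε_b F_a G_b`. -/
def quad (F G : ℤ → Module.End ℂ V) (ε : ℤ → ℂ) (k : ℤ) : Module.End ℂ V :=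
  locSum fun b : ℤ => ε b • (F (k - b) * G b)

theorem eq_neg_of_anticomm {S T : Module.End ℂ V} (h : S * T + T * S = 0) (f : V) :
    S (T f) = -T (S f) :=
  eq_neg_of_add_eq_zero_left (LinearMap.congr_fun h f)

/-- For large `b` the right factor kills `f`; for very negative `b` the factors can be exchanged,
and then the other one does. The anticommutation makes normal ordering unnecessary. -/
theorem locFin_quad {F G : ℤ → Module.End ℂ V} (hF : Upper F) (hG : Upper G) {k : ℤ}
    (h : ∀ b, F (k - b) * G b + G b * F (k - b) = 0) (ε : ℤ → ℂ) :
    LocFin fun b : ℤ => ε b • (F (k - b) * G b) := by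
  refine LocFin.smul (fun f => ?_) ε
  obtain ⟨K, hK⟩ := hF f
  obtain ⟨L, hL⟩ := hG f
  refine (Set.finite_Icc (k - K) L).subset fun b hb => ⟨?_, ?_⟩
  · by_contra hlt
    refine hb ?_
    simp only [Module.End.mul_apply]
    rw [eq_neg_of_anticomm (h b), hK _ (by omega), map_zero, neg_zero]
  · by_contra hlt
    refine hb ?_
    simp only [Module.End.mul_apply]
    rw [hL _ (by omega), map_zero]

theorem quad_apply_eq_zero {F G : ℤ → Module.End ℂ V} (hF : Upper F) (hG : Upper G)
    (h : ∀ k b : ℤ, 0 < k → F (k - b) * G b + G b * F (k - b) = 0) (ε : ℤ → ℂ) (f : V) :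
    ∃ K : ℤ, ∀ k > K, quad F G ε k f = 0 := by
  obtain ⟨K, hK⟩ := hF f
  obtain ⟨L, hL⟩ := hG f
  refine ⟨max 0 (K + L), fun k hk => ?_⟩
  have h' : ∀ b, F (k - b) * G b + G b * F (k - b) = 0 := fun b => h k b (by omega)
  rw [quad, locSum_apply (locFin_quad hF hG h' ε)]
  refine finsum_eq_zero_of_forall_eq_zero fun b => ?_
  rw [LinearMap.smul_apply, Module.End.mul_apply]
  by_cases hb : L ≤ b
  · rw [hL b hb, map_zero, smul_zero]
  · rw [eq_neg_of_anticomm (h' b), hK _ (by omega), map_zero, neg_zero, smul_zero]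

theorem quad_vacuum {F G : ℤ → Module.End ℂ V} (hF : Upper F) (hG : Upper G) {k : ℤ} (hk : 0 < k)
    (h : ∀ b, F (k - b) * G b + G b * F (k - b) = 0) (ε : ℤ → ℂ) {f : V}
    (hFf : ∀ i > 0, F i f = 0) (hGf : ∀ i > 0, G i f = 0) : quad F G ε k f = 0 := by
  rw [quad, locSum_apply (locFin_quad hF hG h ε)]
  refine finsum_eq_zero_of_forall_eq_zero fun b => ?_
  rw [LinearMap.smul_apply, Module.End.mul_apply]
  by_cases hb : 0 < b
  · rw [hGf b hb, map_zero, smul_zero]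
  · rw [eq_neg_of_anticomm (h b), hFf _ (by omega), map_zero, neg_zero, smul_zero]

/-- This is $[FG,X]=F\{G,X\}-\{F,X\}G$ summed over the modes, where each anticommutator is nonzero
for at most one index. -/
theorem quad_mul {F G : ℤ → Module.End ℂ V} (hF : Upper F) (hG : Upper G) {k : ℤ}
    (h : ∀ b, F (k - b) * G b + G b * F (k - b) = 0) (ε : ℤ → ℂ) {X : Module.End ℂ V}
    {x y : ℤ → ℂ} (hx : ∀ i, F i * X + X * F i = x i • 1) (hy : ∀ i, G i * X + X * G i = y i • 1)
    {a b : ℤ} (hxa : ∀ i ≠ a, x i = 0) (hyb : ∀ i ≠ b, y i = 0) :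
    quad F G ε k * X = X * quad F G ε k +
      ((ε b * y b) • F (k - b) - (ε (k - a) * x a) • G (k - a)) := by
  have hl := locFin_quad hF hG h ε
  have key : ∀ i, (ε i • (F (k - i) * G i)) * X = X * (ε i • (F (k - i) * G i)) +
      ((ε i * y i) • F (k - i) - (ε i * x (k - i)) • G i) := fun i => by
    rw [smul_mul_assoc, mul_assoc, eq_sub_of_add_eq (hy i), mul_sub, ← mul_assoc (F _) X,
      eq_sub_of_add_eq (hx (k - i)), mul_smul_comm, mul_smul_comm, sub_mul, smul_mul_assoc,
      mul_one, one_mul, mul_assoc, mul_smul, mul_smul, ← smul_sub, ← smul_add]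
    congr 1
    abel
  have h1 : LocFin fun i => (ε i * y i) • F (k - i) := fun f =>
    (Set.finite_singleton b).subset fun i hi => by
      by_contra hib
      exact hi (by simp [hyb i hib])
  have h2 : LocFin fun i => (-(ε i * x (k - i))) • G i := fun f =>
    (Set.finite_singleton (k - a)).subset fun i hi => by
      by_contra hib
      refine hi ?_
      have : k - i ≠ a := fun h0 => hib (by simp [← h0])
      simp [hxa _ this]
  have e1 : locSum (fun i => (ε i * y i) • F (k - i)) = (ε b * y b) • F (k - b) := by
    ext f
    rw [locSum_apply h1]
    exact finsum_eq_single _ b fun i hi => by simp [hyb i hi]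
  have e2 : locSum (fun i => (-(ε i * x (k - i))) • G i) = -((ε (k - a) * x a) • G (k - a)) := by
    ext f
    rw [locSum_apply h2, finsum_eq_single _ (k - a)]
    · simp
    · intro i hi
      have : k - i ≠ a := fun h0 => hi (by simp [← h0])
      simp [hxa _ this]
  rw [quad, locSum_mul hl, mul_locSum hl, sub_eq_add_neg, ← e1, ← e2, locSum_add h1 h2,
    locSum_add (hl.mul_left X) (h1.add h2)]
  congr 1
  funext i
  rw [key i, neg_smul, ← sub_eq_add_neg ((ε i * y i) • F (k - i))]

theorem locSum_pnat_mul {D : ℕ+ → Module.End ℂ V} (hD : LocFin D) {F : ℤ → Module.End ℂ V}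
    (hF : Upper F) {x : Times} {i : ℤ}
    (h : ∀ k : ℕ+, D k * F i = F i * D k + x k • F (i + (k : ℕ))) :
    locSum D * F i = F i * locSum D + field F (sh (-i) (timesSeries x)) := by
  ext f
  -- Finiteness is read off the commutation relation: where `D k` kills both `F i f` and `f`, the
  -- remaining term vanishes too.
  have hx : (Function.support fun k : ℕ+ => x k • F (i + (k : ℕ)) f).Finite := by
    refine ((hD (F i f)).union ((hD.mul_left (F i)) f)).subset fun k hk => ?_
    by_contra hn
    simp only [Set.mem_union, Function.mem_support, not_or, not_not] at hn
    have := LinearMap.congr_fun (h k) f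
    rw [Module.End.mul_apply, hn.1, LinearMap.add_apply, hn.2, zero_add] at this
    exact hk this.symm
  rw [LinearMap.add_apply, field_sh_eq_finsum hF, mul_locSum hD, Module.End.mul_apply,
    locSum_apply hD, locSum_apply (hD.mul_left _)]
  have e : ∑ᶠ n : ℕ, PowerSeries.coeff n (timesSeries x) • F (n - -i) f =
      ∑ᶠ k : ℕ+, x k • F (i + (k : ℕ)) f := by
    have := finsum_subtype_eq_finsum_cond (f := fun n : ℕ =>
      PowerSeries.coeff n (timesSeries x) • F (n - -i) f) (fun n => 0 < n)
    calc _ = ∑ᶠ (n : ℕ) (_ : 0 < n), PowerSeries.coeff n (timesSeries x) • F (n - -i) f := by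
          refine finsum_congr fun n => ?_
          rcases Nat.eq_zero_or_pos n with rfl | hn
          · simp [constantCoeff_timesSeries]
          · simp [hn]
      _ = ∑ᶠ k : ℕ+, PowerSeries.coeff (k : ℕ) (timesSeries x) • F ((k : ℕ) - -i) f := this.symm
      _ = _ := finsum_congr fun k => by
          rw [coeff_timesSeries, sub_neg_eq_add, add_comm]
  rw [e, ← finsum_add_distrib ((hD.mul_left (F i)) f) hx]
  exact finsum_congr fun k => LinearMap.congr_fun (h k) f

end Quadratic

/-! ### Charged free fermions -/

/-- Charged free fermions acting on a space with a vacuum vector and a dual vacuum;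
`F i` is `ψ⁺_{i+1/2}` and `G i` is `ψ⁻_{i-1/2}`. -/
structure Fermions (V : Type*) [AddCommGroup V] [Module ℂ V] where
  /-- The operators `ψ⁺`. -/
  F : ℤ → Module.End ℂ V
  /-- The operators `ψ⁻`. -/
  G : ℤ → Module.End ℂ V
  F_anticomm : ∀ i j, F i * F j + F j * F i = 0
  G_anticomm : ∀ i j, G i * G j + G j * G i = 0
  F_G : ∀ i j, F i * G j + G j * F i = (if i = -j then (1 : ℂ) else 0) • 1
  upper_F : Upper F
  upper_G : Upper G
  /-- The vacuum. -/
  vac : V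
  /-- The dual vacuum. -/
  ev : V →ₗ[ℂ] ℂ
  F_vac : ∀ i, 0 ≤ i → F i vac = 0
  G_vac : ∀ i, 0 < i → G i vac = 0
  ev_F : ∀ i, i < 0 → ∀ f, ev (F i f) = 0
  ev_G : ∀ i, i ≤ 0 → ∀ f, ev (G i f) = 0
  ev_vac : ev vac = 1

namespace Fermions

variable {V : Type*} [AddCommGroup V] [Module ℂ V] (Ψ : Fermions V)

/-- The operator `∑_i (A_i ψ⁺_{i+1/2} + B_i ψ⁻_{i-1/2})`. -/
def op (A B : ℤ → ℂ) : Module.End ℂ V := field Ψ.F A + field Ψ.G B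

end Fermions

/-- The pairing of two sequences, `∑_i A_i B_{-i}`. -/
def pair (A B : ℤ → ℂ) : ℂ := ∑ᶠ i, A i * B (-i)

theorem pair_comm (A B : ℤ → ℂ) : pair A B = pair B A := by
  rw [pair, pair, ← finsum_comp_equiv (Equiv.neg ℤ)]
  refine finsum_congr fun i => ?_
  simp [mul_comm]

/-- The terms of a sequence with index at least `r`. -/
def cut (r : ℤ) (A : ℤ → ℂ) : ℤ → ℂ := fun i => if r ≤ i then A i else 0

theorem below_cut (r : ℤ) (A : ℤ → ℂ) : Below (cut r A) := ⟨r, fun i hi => if_neg (by omega)⟩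

/-- The lower limit is the cut, and the upper limit `M` is the order of the pole of $z^{-M}b(z)$. -/
theorem pair_cut_sh (r N M : ℕ) (a b : PowerSeries ℂ) :
    pair (cut r (sh N a)) (sh M b) = ∑ k ∈ Finset.Icc r M,
      PowerSeries.coeff (N + k) a * PowerSeries.coeff (M - k) b := by
  rw [pair, finsum_eq_sum_of_support_subset (s := (Finset.Icc r M).map Nat.castEmbedding)]
  · rw [Finset.sum_map]
    refine Finset.sum_congr rfl fun k hk => ?_
    rw [Finset.mem_Icc] at hk
    have h1 : (k : ℤ) = ((N + k : ℕ) : ℤ) - (N : ℤ) := by push_cast; ring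
    have h2 : -(k : ℤ) = ((M - k : ℕ) : ℤ) - (M : ℤ) := by push_cast [hk.2]; ring
    rw [cut, Nat.castEmbedding_apply, if_pos (by exact_mod_cast hk.1), h2, sh_natCast_sub, h1,
      sh_natCast_sub]
  · intro i hi
    simp only [Finset.coe_map, Set.mem_image, Finset.coe_Icc, Set.mem_Icc,
      Nat.castEmbedding_apply]
    by_contra hn
    refine hi ?_
    simp only [cut]
    split_ifs with h1
    · by_cases h2 : i ≤ M
      · exact absurd ⟨i.toNat, by omega, by omega⟩ hn
      · rw [sh_of_lt b (by omega), mul_zero]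
    · rw [zero_mul]

/-! ### Anticommutators and vacuum expectations of charged fields -/

namespace Fermions

variable {V : Type*} [AddCommGroup V] [Module ℂ V] (Ψ : Fermions V)

theorem field_F_F {A B : ℤ → ℂ} (hA : Below A) (hB : Below B) :
    field Ψ.F A * field Ψ.F B + field Ψ.F B * field Ψ.F A = 0 :=
  field_anticomm_zero Ψ.F_anticomm Ψ.upper_F Ψ.upper_F hA hB

theorem field_G_G {A B : ℤ → ℂ} (hA : Below A) (hB : Below B) :
    field Ψ.G A * field Ψ.G B + field Ψ.G B * field Ψ.G A = 0 :=
  field_anticomm_zero Ψ.G_anticomm Ψ.upper_G Ψ.upper_G hA hB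

theorem field_F_G {A B : ℤ → ℂ} (hA : Below A) (hB : Below B) :
    field Ψ.F A * field Ψ.G B + field Ψ.G B * field Ψ.F A = pair A B • 1 := by
  rw [field_anticomm_field (s := fun _ => 1) Ψ.F_G Ψ.upper_F Ψ.upper_G hA hB, pair_comm, pair]
  simp

theorem op_anticomm {A B A' B' : ℤ → ℂ} (hA : Below A) (hB : Below B) (hA' : Below A')
    (hB' : Below B') : Ψ.op A B * Ψ.op A' B' + Ψ.op A' B' * Ψ.op A B =
      (pair A B' + pair B A') • 1 := by
  have h1 := Ψ.field_F_F hA hA'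
  have h2 := Ψ.field_G_G hB hB'
  have h3 := Ψ.field_F_G hA hB'
  have h4 := Ψ.field_F_G hA' hB
  rw [pair_comm B A', add_smul, ← h3, ← h4, op, op]
  calc _ = (field Ψ.F A * field Ψ.F A' + field Ψ.F A' * field Ψ.F A) +
      (field Ψ.G B * field Ψ.G B' + field Ψ.G B' * field Ψ.G B) +
      (field Ψ.F A * field Ψ.G B' + field Ψ.G B' * field Ψ.F A +
        (field Ψ.F A' * field Ψ.G B + field Ψ.G B * field Ψ.F A')) := by noncomm_ring
    _ = _ := by rw [h1, h2, zero_add, zero_add]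

/-- The cuts differ by one because $\psi^+_{i+1/2}$ annihilates the vacuum from $i=0$ on, but
$\psi^-_{i-1/2}$ only from $i=1$ on. -/
theorem op_cut_vac (A B : ℤ → ℂ) : Ψ.op (cut 0 A) (cut 1 B) Ψ.vac = 0 := by
  rw [op, LinearMap.add_apply, field_apply Ψ.upper_F (below_cut _ _),
    field_apply Ψ.upper_G (below_cut _ _), finsum_eq_zero_of_forall_eq_zero,
    finsum_eq_zero_of_forall_eq_zero, add_zero]
  · intro i
    rw [cut]
    split_ifs with h
    · rw [Ψ.G_vac i (by omega), smul_zero]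
    · rw [zero_smul]
  · intro i
    rw [cut]
    split_ifs with h
    · rw [Ψ.F_vac i (by omega), smul_zero]
    · rw [zero_smul]

theorem ev_field {F : ℤ → Module.End ℂ V} (hF : Upper F) {A : ℤ → ℂ} (hA : Below A) (f : V) :
    Ψ.ev (field F A f) = ∑ᶠ i, A i * Ψ.ev (F i f) := by
  rw [field_apply hF hA]
  refine (AddMonoidHom.map_finsum (Ψ.ev : V →+ ℂ) (locFin_field hF hA f)).trans ?_
  refine finsum_congr fun i => ?_
  simp

theorem ev_op {A B : ℤ → ℂ} (hA : Below A) (hB : Below B) (f : V) :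
    Ψ.ev (Ψ.op A B f) = Ψ.ev (Ψ.op (cut 0 A) (cut 1 B) f) := by
  rw [op, op, LinearMap.add_apply, LinearMap.add_apply, map_add, map_add, Ψ.ev_field Ψ.upper_F hA,
    Ψ.ev_field Ψ.upper_G hB, Ψ.ev_field Ψ.upper_F (below_cut _ _),
    Ψ.ev_field Ψ.upper_G (below_cut _ _)]
  congr 1
  · refine finsum_congr fun i => ?_
    rw [cut]
    split_ifs with h
    · rfl
    · rw [Ψ.ev_F i (by omega), mul_zero, zero_mul]
  · refine finsum_congr fun i => ?_
    rw [cut]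
    split_ifs with h
    · rfl
    · rw [Ψ.ev_G i (by omega), mul_zero, zero_mul]

theorem ev_prod_op {m : ℕ} {A B : Fin m → ℤ → ℂ} (hA : ∀ i, Below (A i)) (hB : ∀ i, Below (B i)) :
    Ψ.ev ((List.ofFn fun i => Ψ.op (A i) (B i)).prod Ψ.vac) =
      pf m (Matrix.of fun i j => pair (cut 0 (A i)) (B j) + pair (cut 1 (B i)) (A j)) :=
  wick Ψ.vac Ψ.ev Ψ.ev_vac _ (fun i => Ψ.op (cut 0 (A i)) (cut 1 (B i))) _
    (fun i f => Ψ.ev_op (hA i) (hB i) f) (fun _ => Ψ.op_cut_vac _ _)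
    (fun _ j => Ψ.op_anticomm (below_cut _ _) (below_cut _ _) (hA j) (hB j))

/-! ### The Hamiltonian of the KP hierarchy -/

/-- The operator `α_k`. -/
def alpha (k : ℕ+) : Module.End ℂ V := quad Ψ.F Ψ.G 1 ((k : ℕ) : ℤ)

theorem F_G_of_ne {i j : ℤ} (h : i ≠ -j) : Ψ.F i * Ψ.G j + Ψ.G j * Ψ.F i = 0 := by
  rw [Ψ.F_G, if_neg h, zero_smul]

/-- The operator `H(t) = ∑ t_k α_k`. -/
def hamiltonian (t : Times) : Module.End ℂ V := locSum fun k => t k • Ψ.alpha k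

theorem locFin_alpha : LocFin Ψ.alpha := fun f => by
  obtain ⟨K, hK⟩ := quad_apply_eq_zero Ψ.upper_F Ψ.upper_G
    (fun k b hk => Ψ.F_G_of_ne (by omega)) 1 f
  refine Set.Finite.subset (s := {k : ℕ+ | (k : ℤ) ≤ K}) ?_ fun k hk => ?_
  · refine Set.Finite.subset (Set.finite_Iic (K.toNat.succPNat)) fun k hk => ?_
    have hk' : ((k : ℕ) : ℤ) ≤ K := hk
    have : (k : ℕ) ≤ (K.toNat.succPNat : ℕ) := by rw [Nat.succPNat_coe]; omega
    exact this
  · by_contra hn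
    exact hk (hK _ (not_le.mp hn))

theorem alpha_F (k : ℕ+) (i : ℤ) :
    Ψ.alpha k * Ψ.F i = Ψ.F i * Ψ.alpha k + Ψ.F (i + (k : ℕ)) := by
  have hk := k.pos
  -- Only the $\psi^-$ factor contracts with $\psi^+$, at the single index `-i`; the values `x = 0`
  -- and `a = 0` are placeholders.
  rw [alpha, quad_mul Ψ.upper_F Ψ.upper_G (fun b => Ψ.F_G_of_ne (by omega)) 1 (X := Ψ.F i)
    (x := 0) (y := fun j => if i = -j then 1 else 0) (a := 0) (b := -i)
    (fun j => by rw [Ψ.F_anticomm]; simp) (fun j => by rw [add_comm, Ψ.F_G])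
    (fun _ _ => rfl) (fun j hj => if_neg (by omega))]
  simp [add_comm]

theorem alpha_G (k : ℕ+) (i : ℤ) :
    Ψ.alpha k * Ψ.G i = Ψ.G i * Ψ.alpha k - Ψ.G (i + (k : ℕ)) := by
  have hk := k.pos
  rw [alpha, quad_mul Ψ.upper_F Ψ.upper_G (fun b => Ψ.F_G_of_ne (by omega)) 1 (X := Ψ.G i)
    (x := fun j => if j = -i then 1 else 0) (y := 0) (a := -i) (b := 0)
    (fun j => Ψ.F_G j i) (fun j => by rw [Ψ.G_anticomm]; simp)
    (fun j hj => if_neg (by omega)) (fun _ _ => rfl)]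
  simp [add_comm, sub_eq_add_neg]

theorem hamiltonian_F (t : Times) (i : ℤ) :
    Ψ.hamiltonian t * Ψ.F i = Ψ.F i * Ψ.hamiltonian t +
      field Ψ.F (sh (-i) (timesSeries t)) :=
  locSum_pnat_mul (Ψ.locFin_alpha.smul t) Ψ.upper_F fun k => by
    rw [smul_mul_assoc, Ψ.alpha_F, smul_add, mul_smul_comm]

theorem hamiltonian_G (t : Times) (i : ℤ) :
    Ψ.hamiltonian t * Ψ.G i = Ψ.G i * Ψ.hamiltonian t +
      field Ψ.G (sh (-i) (timesSeries (-t))) :=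
  locSum_pnat_mul (Ψ.locFin_alpha.smul t) Ψ.upper_G fun k => by
    rw [smul_mul_assoc, Ψ.alpha_G, smul_sub, mul_smul_comm, Pi.neg_apply, neg_smul,
      sub_eq_add_neg]

theorem hamiltonian_vac (t : Times) : Ψ.hamiltonian t Ψ.vac = 0 := by
  rw [hamiltonian, locSum_apply (Ψ.locFin_alpha.smul t)]
  refine finsum_eq_zero_of_forall_eq_zero fun k => ?_
  have hk := k.pos
  rw [LinearMap.smul_apply, alpha, quad_vacuum Ψ.upper_F Ψ.upper_G (by omega)
    (fun b => Ψ.F_G_of_ne (by omega)) 1 (fun i hi => Ψ.F_vac i hi.le) Ψ.G_vac, smul_zero]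

theorem intertwines_op (t : Times) (N : ℤ) (a b : PowerSeries ℂ) :
    Intertwines (Ψ.hamiltonian t) (Ψ.op (sh N a) (sh N b))
      (Ψ.op (sh N (expSeries t * a)) (sh N (expSeries (-t) * b))) :=
  (intertwines_field Ψ.upper_F (Ψ.hamiltonian_F t) N a).add
    (intertwines_field Ψ.upper_G (Ψ.hamiltonian_G t) N b)

end Fermions

theorem sqrt_two_inv_sq : ((Real.sqrt 2 : ℂ)⁻¹) * ((Real.sqrt 2 : ℂ)⁻¹) = 1 / 2 := by
  rw [← mul_inv, ← Complex.ofReal_mul, Real.mul_self_sqrt (by norm_num)]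
  norm_num

theorem neg_one_zpow_neg (i : ℤ) : (-1 : ℂ) ^ (-i) = (-1 : ℂ) ^ i := by
  rw [zpow_neg, ← inv_zpow, inv_neg, inv_one]

theorem neg_one_zpow_mul_self (i : ℤ) : (-1 : ℂ) ^ i * (-1 : ℂ) ^ i = 1 := by
  rw [← mul_zpow]; simp

/-! ### Families of neutral fermions -/

/-- A family of neutral free fermions. -/
structure Neutral {V : Type*} [AddCommGroup V] [Module ℂ V] (Φ : ℤ → Module.End ℂ V) : Prop where
  upper : Upper Φ
  anticomm : ∀ i j, Φ i * Φ j + Φ j * Φ i = (if i = -j then (-1 : ℂ) ^ i else 0) • 1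

section Neutral

variable {V : Type*} [AddCommGroup V] [Module ℂ V] {Φ Φ' : ℤ → Module.End ℂ V}

theorem Neutral.anticomm_of_ne (h : Neutral Φ) {i j : ℤ} (hij : i ≠ -j) :
    Φ i * Φ j + Φ j * Φ i = 0 := by
  rw [h.anticomm, if_neg hij, zero_smul]

theorem Neutral.field_anticomm_single (h : Neutral Φ) {A : ℤ → ℂ} (hA : Below A) (j : ℤ) :
    field Φ A * Φ j + Φ j * field Φ A = (A (-j) * (-1) ^ j) • 1 := by
  rw [SpinKP.field_anticomm_single h.anticomm h.upper hA, neg_one_zpow_neg]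

theorem Neutral.field_anticomm (h : Neutral Φ) {A B : ℤ → ℂ} (hA : Below A) (hB : Below B) :
    field Φ A * field Φ B + field Φ B * field Φ A =
      (∑ᶠ j, B j * (A (-j) * (-1) ^ (-j))) • 1 :=
  field_anticomm_field h.anticomm h.upper h.upper hA hB

/-- The operator `β_k`, for odd `k`. -/
def betaOp (Φ : ℤ → Module.End ℂ V) (k : ℕ+) : Module.End ℂ V :=
  quad Φ Φ (fun b => (-1) ^ b) ((k : ℕ) : ℤ)

/-- Both factors of the quadratic term contract with `Φ i`. The two contributions carry signs
$(-1)^b$ at indices of opposite parity, so for odd $k$ they add up; the resulting 2 cancels the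
$\frac12$ in the Hamiltonian. -/
theorem Neutral.beta_self (h : Neutral Φ) {k : ℕ+} (hk : Odd (k : ℕ)) (i : ℤ) :
    betaOp Φ k * Φ i = Φ i * betaOp Φ k + (2 : ℂ) • Φ (i + (k : ℕ)) := by
  have hk0 := k.pos
  rw [betaOp, quad_mul h.upper h.upper (fun b => h.anticomm_of_ne (by omega)) _ (X := Φ i)
    (x := fun j => if j = -i then (-1) ^ j else 0) (y := fun j => if j = -i then (-1) ^ j else 0)
    (a := -i) (b := -i) (fun j => h.anticomm j i) (fun j => h.anticomm j i)
    (fun j hj => if_neg hj) (fun j hj => if_neg hj)]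
  have e : (-1 : ℂ) ^ (((k : ℕ) : ℤ) - -i) = -(-1) ^ i := by
    rw [sub_neg_eq_add, zpow_add₀ (by norm_num), zpow_natCast, hk.neg_one_pow, neg_one_mul]
  rw [if_pos rfl, e, neg_one_zpow_mul_self, neg_one_zpow_neg, neg_mul, neg_one_zpow_mul_self,
    ← sub_smul, sub_neg_eq_add, add_comm i]
  norm_num

theorem Neutral.beta_other (h : Neutral Φ) (h' : ∀ i j, Φ i * Φ' j + Φ' j * Φ i = 0) (k : ℕ+)
    (i : ℤ) : betaOp Φ k * Φ' i = Φ' i * betaOp Φ k := by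
  have hk0 := k.pos
  rw [betaOp, quad_mul h.upper h.upper (fun b => h.anticomm_of_ne (by omega)) _ (X := Φ' i)
    (x := 0) (y := 0) (a := 0) (b := 0) (fun j => by rw [h']; simp) (fun j => by rw [h']; simp)
    (fun _ _ => rfl) (fun _ _ => rfl)]
  simp

theorem Neutral.beta_vacuum (h : Neutral Φ) (k : ℕ+) {u : V} (hu : ∀ j > 0, Φ j u = 0) :
    betaOp Φ k u = 0 := by
  have hk0 := k.pos
  exact quad_vacuum h.upper h.upper (by omega) (fun b => h.anticomm_of_ne (by omega)) _ hu hu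

theorem Neutral.locFin_beta (h : Neutral Φ) : LocFin (betaOp Φ) := fun f => by
  obtain ⟨K, hK⟩ := quad_apply_eq_zero h.upper h.upper
    (fun k b hk => h.anticomm_of_ne (by omega)) (fun b => (-1) ^ b) f
  refine Set.Finite.subset (Set.finite_Iic (K.toNat.succPNat)) fun k hk => ?_
  have hk' : ((k : ℕ) : ℤ) ≤ K := by
    by_contra hn
    exact hk (hK _ (not_le.mp hn))
  have : (k : ℕ) ≤ (K.toNat.succPNat : ℕ) := by rw [Nat.succPNat_coe]; omega
  exact this

open Classical in
/-- The summands `(t_k β_k + s_k β̂_k) / 2` of the Hamiltonian of the BKP hierarchy. -/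
def hamiltonianBTerm (Φ Φ' : ℤ → Module.End ℂ V) (t s : Times) (k : ℕ+) : Module.End ℂ V :=
  if Odd (k : ℕ) then (t k / 2) • betaOp Φ k + (s k / 2) • betaOp Φ' k else 0

theorem locFin_hamiltonianBTerm (h : Neutral Φ) (h' : Neutral Φ') (t s : Times) :
    LocFin (hamiltonianBTerm Φ Φ' t s) := fun f => by
  refine (((h.locFin_beta.smul fun k => t k / 2).add
    (h'.locFin_beta.smul fun k => s k / 2)) f).subset fun k hk hk0 => hk ?_
  simp only [hamiltonianBTerm]
  split_ifs
  · exact hk0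
  · rfl

/-- The operator `H̄(t) + Ĥ(s)`. -/
def hamiltonianBOp (Φ Φ' : ℤ → Module.End ℂ V) (t s : Times) : Module.End ℂ V :=
  locSum (hamiltonianBTerm Φ Φ' t s)

theorem hamiltonianBOp_mul (h : Neutral Φ) (h' : Neutral Φ')
    (hΦ : ∀ i j, Φ' i * Φ j + Φ j * Φ' i = 0) {t : Times} (ht : EvenTimesVanish t) (s : Times)
    (i : ℤ) : hamiltonianBOp Φ Φ' t s * Φ i = Φ i * hamiltonianBOp Φ Φ' t s +
      field Φ (sh (-i) (timesSeries t)) := by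
  refine locSum_pnat_mul (locFin_hamiltonianBTerm h h' t s) h.upper fun k => ?_
  simp only [hamiltonianBTerm]
  split_ifs with hk
  · rw [add_mul, smul_mul_assoc, smul_mul_assoc, h.beta_self hk, h'.beta_other hΦ, smul_add,
      smul_smul, mul_add, mul_smul_comm, mul_smul_comm, div_mul_cancel₀ _ two_ne_zero]
    abel
  -- The Hamiltonian has no even terms, which matches the series of `t` only because its even times
  -- vanish.
  · rw [ht k (Nat.not_odd_iff_even.mp hk)]
    simp

theorem hamiltonianBOp_vacuum (h : Neutral Φ) (h' : Neutral Φ') (t s : Times) {u : V}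
    (hu : ∀ j > 0, Φ j u = 0) (hu' : ∀ j > 0, Φ' j u = 0) : hamiltonianBOp Φ Φ' t s u = 0 := by
  rw [hamiltonianBOp, locSum_apply (locFin_hamiltonianBTerm h h' t s)]
  refine finsum_eq_zero_of_forall_eq_zero fun k => ?_
  simp only [hamiltonianBTerm]
  split_ifs
  · simp [h.beta_vacuum k hu, h'.beta_vacuum k hu']
  · rfl

theorem intertwines_hamiltonianBOp (h : Neutral Φ) (h' : Neutral Φ')
    (hΦ : ∀ i j, Φ' i * Φ j + Φ j * Φ' i = 0) {t : Times} (ht : EvenTimesVanish t) (s : Times)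
    (N : ℤ) (c : Times) :
    Intertwines (hamiltonianBOp Φ Φ' t s) (field Φ (sh N (expSeries c)))
      (field Φ (sh N (expSeries (t + c)))) := by
  rw [expSeries_add]
  exact intertwines_field h.upper (hamiltonianBOp_mul h h' hΦ ht s) N _

/-! ### Nonvanishing -/

/-- The first field starts with the mode $-\lambda_0$. The opposite mode $\phi_{\lambda_0}$
anticommutes with it to $\pm1$, anticommutes to zero with all later fields because their $\lambda_j$
are smaller, and kills `u`. Hence if the whole product vanished on `u`, so would the product without
its first factor. -/
theorem Neutral.prod_apply_ne_zero (h : Neutral Φ) {m : ℕ} {lam : Fin m → ℕ}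
    (hlam : StrictAnti lam) {a : Fin m → PowerSeries ℂ}
    (ha : ∀ i, PowerSeries.constantCoeff (a i) = 1) {u : V} (hu0 : u ≠ 0)
    (hu : ∀ j > 0, Φ j u = 0) :
    (List.ofFn fun i => field Φ (sh (lam i) (a i))).prod u ≠ 0 := by
  have hcoeff : ∀ i, sh (lam i) (a i) (-(lam i : ℤ)) = 1 := fun i => by
    have := sh_natCast_sub (lam i) (a i) 0
    rw [Nat.cast_zero, zero_sub] at this
    rw [this, PowerSeries.coeff_zero_eq_constantCoeff_apply, ha]
  induction m with
  | zero => simpa using hu0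
  | succ m ih =>
    have ih' := ih (lam := fun i => lam i.succ) (a := fun i => a i.succ)
      (fun i j hij => hlam (Fin.succ_lt_succ_iff.mpr hij)) (fun i => ha _) (fun i => hcoeff _)
    rw [List.ofFn_succ, List.prod_cons, Module.End.mul_apply]
    intro h0
    refine ih' ?_
    set X := (List.ofFn fun i : Fin m => field Φ (sh (lam i.succ) (a i.succ))).prod with hX
    -- When $\lambda_0=0$ the mode $\phi_0$ need not kill `u`; instead the first field squares to
    -- $\frac12$ and is invertible.
    rcases Nat.eq_zero_or_pos (lam 0) with hl | hl
    · have h1 := LinearMap.congr_fun (h.field_anticomm (below_sh (lam 0) (a 0))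
        (below_sh (lam 0) (a 0))) (X u)
      rw [LinearMap.add_apply, Module.End.mul_apply, h0, map_zero, add_zero,
        finsum_eq_single _ 0] at h1
      · have h2 := hcoeff 0
        rw [hl, Nat.cast_zero, neg_zero] at h2
        rw [hl, Nat.cast_zero, neg_zero, h2] at h1
        simpa using h1.symm
      · intro j hj
        rcases lt_or_gt_of_ne hj with hj | hj
        · rw [sh_of_lt _ (by omega), zero_mul]
        · rw [sh_of_lt (i := -j) _ (by omega), zero_mul, mul_zero]
    · have h1 := LinearMap.congr_fun (h.field_anticomm_single (below_sh (lam 0) (a 0)) (lam 0)) (X u)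
      have h2 : Φ (lam 0) (X u) = 0 := by
        rw [← Module.End.mul_apply, hX, mul_ofFn_prod_of_anticomm, LinearMap.smul_apply,
          Module.End.mul_apply, hu _ (by omega), map_zero, smul_zero]
        intro j
        have := hlam (Fin.succ_pos j)
        rw [add_comm, h.field_anticomm_single (below_sh _ _), sh_of_lt _ (by omega), zero_mul,
          zero_smul]
      rw [LinearMap.add_apply, Module.End.mul_apply, h2, map_zero, Module.End.mul_apply, h0,
        map_zero, zero_add, hcoeff, one_mul, LinearMap.smul_apply, Module.End.one_apply] at h1
      have h3 := congrArg (fun x => (-1 : ℂ) ^ (lam 0 : ℤ) • x) h1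
      simp only [smul_smul, neg_one_zpow_mul_self, one_smul, smul_zero] at h3
      exact h3.symm

/-! ### Factorization of vacuum expectations -/

theorem Neutral.field_cut_apply (h : Neutral Φ) (A : ℤ → ℂ) {u : V} (hu : ∀ j > 0, Φ j u = 0) :
    field Φ (cut 0 A) u = A 0 • Φ 0 u := by
  rw [field_apply h.upper (below_cut _ _), finsum_eq_single _ 0]
  · simp [cut]
  · intro j hj
    rw [cut]
    split_ifs
    · rw [hu j (by omega), smul_zero]
    · rw [zero_smul]

/-- Pushing the annihilating part of the first field to the right leaves contractions and a multiple
of $\phi_0u$. Since $\phi_0u$ is again killed by all positive modes and $\phi_0^2=\frac12$, two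
fewer or one fewer fields remain over a vector of the same kind, and the scalar `x` never depends on
`u`. -/
theorem Neutral.ev_prod_apply (h : Neutral Φ) (ev : V →ₗ[ℂ] ℂ)
    (hev : ∀ (j : ℤ) (f : V), j < 0 → ev (Φ j f) = 0) {m : ℕ} {A : Fin m → ℤ → ℂ}
    (hA : ∀ i, Below (A i)) :
    ∃ x : ℂ, ∀ u, (∀ j > 0, Φ j u = 0) → ev ((List.ofFn fun i => field Φ (A i)).prod u) =
      x * if Even m then ev u else ev (Φ 0 u) := by
  have hcut : ∀ {B : ℤ → ℂ}, Below B → ∀ f, ev (field Φ B f) = ev (field Φ (cut 0 B) f) :=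
    fun {B} hB f => by
      rw [field_apply h.upper hB, field_apply h.upper (below_cut _ _)]
      refine (AddMonoidHom.map_finsum (ev : V →+ ℂ) (locFin_field h.upper hB f)).trans
        (Eq.trans (finsum_congr fun i => ?_) (AddMonoidHom.map_finsum (ev : V →+ ℂ)
          (locFin_field h.upper (below_cut 0 B) f)).symm)
      by_cases hi : 0 ≤ i
      · simp [cut, hi]
      · simp [cut, hi, hev i f (by omega)]
  induction m using Nat.twoStepInduction with
  | zero => exact ⟨1, fun u _ => by simp⟩
  | one =>
    refine ⟨A 0 0, fun u hu => ?_⟩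
    simp [hcut (hA 0), h.field_cut_apply _ hu]
  | more m ih₀ ih₁ =>
    choose x₀ h₀ using fun j : Fin (m + 1) => ih₀ (A := fun a => A (j.succAbove a).succ)
      fun a => hA _
    obtain ⟨x₁, h₁⟩ := ih₁ (A := fun a => A a.succ) fun a => hA _
    have hc := fun j : Fin (m + 1) => h.field_anticomm (below_cut 0 (A 0)) (hA j.succ)
    set c : Fin (m + 1) → ℂ := fun j => ∑ᶠ i, A j.succ i * (cut 0 (A 0) (-i) * (-1) ^ (-i))
    -- The sum collects the contractions; the second term comes from $\phi_0u$, and its factor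
    -- $\frac12$ appears when the remaining odd product produces a second $\phi_0$.
    refine ⟨(∑ j : Fin (m + 1), (-1) ^ (j : ℕ) * c j * x₀ j) +
      (-1) ^ (m + 1) * (A 0 0 * x₁ * if Even m then 1 / 2 * 1 else 1), fun u hu => ?_⟩
    have hu' : ∀ j > 0, Φ j (Φ 0 u) = 0 := fun j hj => by
      rw [eq_neg_of_anticomm (h.anticomm_of_ne (by omega)), hu j hj, map_zero, neg_zero]
    have hsq : Φ 0 (Φ 0 u) = (1 / 2 : ℂ) • u := by
      have := LinearMap.congr_fun (h.anticomm 0 0) u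
      simp only [neg_zero, if_true, zpow_zero, one_smul, LinearMap.add_apply,
        Module.End.mul_apply, Module.End.one_apply] at this
      rw [← two_smul ℂ (Φ 0 (Φ 0 u))] at this
      calc _ = (1 / 2 : ℂ) • (2 : ℂ) • Φ 0 (Φ 0 u) := by rw [smul_smul]; norm_num
        _ = _ := by rw [this]
    rw [List.ofFn_succ, List.prod_cons, Module.End.mul_apply, hcut (hA 0), ← Module.End.mul_apply,
      mul_ofFn_prod _ (fun j => field Φ (A j.succ)) c hc, LinearMap.add_apply, map_add,
      LinearMap.sum_apply, map_sum, LinearMap.smul_apply, Module.End.mul_apply,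
      h.field_cut_apply _ hu, map_smul, map_smul, map_smul, h₁ _ hu', add_mul, Finset.sum_mul]
    simp only [LinearMap.smul_apply, map_smul, h₀ _ u hu, hsq, smul_eq_mul]
    have e1 : Even (m + 2) ↔ Even m := by simp [Nat.even_add]
    have e2 : Even (m + 1) ↔ ¬ Even m := Nat.even_add_one
    simp only [e1, e2]
    congr 1
    · exact Finset.sum_congr rfl fun j _ => by ring
    · split_ifs <;> ring

/-- Evaluating at the vacuum identifies the scalar of `Neutral.ev_prod_apply`. -/
theorem Neutral.ev_prod_apply_of_even (h : Neutral Φ) (ev : V →ₗ[ℂ] ℂ)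
    (hev : ∀ (j : ℤ) (f : V), j < 0 → ev (Φ j f) = 0) {m : ℕ} (hm : Even m) {A : Fin m → ℤ → ℂ}
    (hA : ∀ i, Below (A i)) {vac u : V} (hvac : ∀ j > 0, Φ j vac = 0) (hvac1 : ev vac = 1)
    (hu : ∀ j > 0, Φ j u = 0) :
    ev ((List.ofFn fun i => field Φ (A i)).prod u) =
      ev ((List.ofFn fun i => field Φ (A i)).prod vac) * ev u := by
  obtain ⟨x, hx⟩ := h.ev_prod_apply ev hev hA
  rw [hx u hu, hx vac hvac, if_pos hm, if_pos hm, hvac1, mul_one]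

theorem Neutral.apply_prod_eq_zero (h : Neutral Φ') (hΦ : ∀ i j, Φ' i * Φ j + Φ j * Φ' i = 0)
    {m : ℕ} {A : Fin m → ℤ → ℂ} (hA : ∀ i, Below (A i)) {u : V} (hu : ∀ j > 0, Φ j u = 0) :
    ∀ j > 0, Φ j ((List.ofFn fun i => field Φ' (A i)).prod u) = 0 := fun j hj => by
  rw [← Module.End.mul_apply, mul_ofFn_prod_of_anticomm, LinearMap.smul_apply,
    Module.End.mul_apply, hu j hj, map_zero, smul_zero]
  intro i
  have := SpinKP.field_anticomm_single (s := fun _ => 0) (F := Φ') (G := Φ)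
    (fun i j => by simp [hΦ]) h.upper (hA i) j
  rw [add_comm, this, mul_zero, zero_smul]

/-! ### The bilinear identity of the BKP hierarchy -/

/-- `S_B(f ⊗ g) = ∑_j (-1)^j φ_j f ⊗ φ_{-j} g`. -/
def bilinB (Φ : ℤ → Module.End ℂ V) (f g : V) : V ⊗[ℂ] V :=
  ∑ᶠ j : ℤ, ((-1 : ℂ) ^ j) • (Φ j f ⊗ₜ[ℂ] Φ (-j) g)

theorem support_tmul_finite {F G : ℤ → Module.End ℂ V} (hF : Upper F) (hG : Upper G) (f g : V) :
    (Function.support fun j : ℤ => F j f ⊗ₜ[ℂ] G (-j) g).Finite := by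
  obtain ⟨K, hK⟩ := hF f
  obtain ⟨L, hL⟩ := hG g
  refine (Set.finite_Icc (-L) K).subset fun j hj => ⟨?_, ?_⟩
  · by_contra hlt
    exact hj (by simp only; rw [hL _ (by omega), TensorProduct.tmul_zero])
  · by_contra hlt
    exact hj (by simp only; rw [hK _ (by omega), TensorProduct.zero_tmul])

theorem support_smul_finite {M : Type*} [AddCommGroup M] [Module ℂ M] {x : ℤ → M}
    (h : (Function.support x).Finite) (c : ℤ → ℂ) : (Function.support fun j => c j • x j).Finite :=
  h.subset fun j hj h0 => hj (by simp only; rw [h0, smul_zero])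

theorem map_finsum_linear {M M' : Type*} [AddCommGroup M] [Module ℂ M] [AddCommGroup M']
    [Module ℂ M'] (T : M →ₗ[ℂ] M') {x : ℤ → M} (h : (Function.support x).Finite) :
    T (∑ᶠ j, x j) = ∑ᶠ j, T (x j) :=
  AddMonoidHom.map_finsum (T : M →+ M') h

theorem support_map_finite {M M' : Type*} [AddCommGroup M] [Module ℂ M] [AddCommGroup M']
    [Module ℂ M'] (T : M →ₗ[ℂ] M') {x : ℤ → M} (h : (Function.support x).Finite) :
    (Function.support fun j => T (x j)).Finite :=
  h.subset fun j hj h0 => hj (by simp only; rw [h0, map_zero])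

theorem finsum_neg_index {M : Type*} [AddCommMonoid M] (x : ℤ → M) :
    ∑ᶠ j, x (-j) = ∑ᶠ j, x j :=
  finsum_comp_equiv (Equiv.neg ℤ)

theorem support_neg_index_finite {M : Type*} [AddCommMonoid M] {x : ℤ → M}
    (h : (Function.support x).Finite) : (Function.support fun j => x (-j)).Finite :=
  h.preimage neg_injective.injOn

/-- Moving each $\phi_j$ past the field $w$ gives the right-hand side and three corrections. With
$w^2=\kappa/2$ they are $\kappa\,f\otimes g$, $-f\otimes w^2g$ and $-w^2f\otimes g$, which cancel.
-/
theorem Neutral.bilinB_field (h : Neutral Φ) {A : ℤ → ℂ} (hA : Below A) (f g : V) :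
    bilinB Φ (field Φ A f) (field Φ A g) =
      TensorProduct.map (field Φ A) (field Φ A) (bilinB Φ f g) := by
  set w := field Φ A with hw
  have hcomm : ∀ j v, Φ j (w v) = (A (-j) * (-1) ^ j) • v - w (Φ j v) := fun j v => by
    have := LinearMap.congr_fun (h.field_anticomm_single hA j) v
    rw [LinearMap.add_apply, add_comm] at this
    exact eq_sub_of_add_eq this
  set κ := ∑ᶠ j, A j * (A (-j) * (-1) ^ (-j)) with hκ
  have hfin : (Function.support fun j => A j * (A (-j) * (-1) ^ (-j))).Finite := by
    obtain ⟨N, hN⟩ := hA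
    exact support_mul_finite ⟨N, hN⟩ ⟨-N, fun i hi => by simp [hN (-i) (by omega)]⟩
  have hww : ∀ v, w (w v) = (κ / 2) • v := fun v => by
    have := LinearMap.congr_fun (h.field_anticomm hA hA) v
    rw [LinearMap.add_apply, ← two_smul ℂ, LinearMap.smul_apply, Module.End.one_apply] at this
    rw [div_eq_inv_mul, mul_smul, ← this, smul_smul]
    norm_num
    rfl
  have s1 := hfin
  have s2 : (Function.support fun j => A j • Φ j g).Finite := locFin_field h.upper hA g
  have s3 : (Function.support fun j => A j • Φ j f).Finite := locFin_field h.upper hA f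
  have s4 := support_smul_finite (support_tmul_finite h.upper h.upper f g) fun j => (-1) ^ j
  have key : ∀ j, ((-1 : ℂ) ^ j) • (Φ j (w f) ⊗ₜ[ℂ] Φ (-j) (w g)) =
      (A j * (A (-j) * (-1) ^ (-j))) • (f ⊗ₜ[ℂ] g) +
      ((-(TensorProduct.mk ℂ V V f ∘ₗ w)) (A (-j) • Φ (-j) g) +
      ((-((TensorProduct.mk ℂ V V).flip g ∘ₗ w)) (A j • Φ j f) +
        TensorProduct.map w w (((-1 : ℂ) ^ j) • (Φ j f ⊗ₜ[ℂ] Φ (-j) g)))) := fun j => by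
    have e1 := neg_one_zpow_mul_self j
    rw [hcomm, hcomm, neg_neg, neg_one_zpow_neg]
    simp only [TensorProduct.sub_tmul, TensorProduct.tmul_sub, ← TensorProduct.smul_tmul',
      TensorProduct.tmul_smul, smul_sub, smul_smul, LinearMap.neg_apply, LinearMap.comp_apply,
      map_smul, TensorProduct.mk_apply, LinearMap.flip_apply, TensorProduct.map_tmul]
    have e2 : (-1 : ℂ) ^ j * (A j * (-1) ^ j * (A (-j) * (-1) ^ j)) =
        A j * (A (-j) * (-1) ^ j) := by linear_combination (A j * A (-j) * (-1) ^ j) * e1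
    have e3 : (-1 : ℂ) ^ j * (A j * (-1) ^ j) = A j := by linear_combination A j * e1
    have e4 : (-1 : ℂ) ^ j * (A (-j) * (-1) ^ j) = A (-j) := by linear_combination A (-j) * e1
    rw [e2, e3, e4]
    simp only [smul_neg]
    abel
  rw [bilinB, finsum_congr key, finsum_add_distrib, finsum_add_distrib, finsum_add_distrib,
    ← finsum_smul' s1, ← hκ, ← map_finsum_linear _ (support_neg_index_finite s2),
    finsum_neg_index (fun j => A j • Φ j g), ← map_finsum_linear _ s3,
    ← map_finsum_linear _ s4, bilinB]
  · rw [← field_apply h.upper hA, ← field_apply h.upper hA, ← hw]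
    simp only [LinearMap.neg_apply, LinearMap.comp_apply, hww, map_smul, TensorProduct.mk_apply,
      LinearMap.flip_apply]
    module
  · exact support_map_finite _ s3
  · exact support_map_finite _ s4
  · exact support_map_finite _ (support_neg_index_finite s2)
  · exact ((support_map_finite _ s3).union (support_map_finite _ s4)).subset
      (Function.support_add _ _)
  · exact s1.subset fun j hj h0 => hj (by simp only at h0 ⊢; rw [h0, zero_smul])
  · exact ((support_map_finite _ (support_neg_index_finite s2)).union
      (((support_map_finite _ s3).union (support_map_finite _ s4)).subset
        (Function.support_add _ _))).subset (Function.support_add _ _)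

theorem Neutral.bilinB_prod (h : Neutral Φ) {m : ℕ} {A : Fin m → ℤ → ℂ} (hA : ∀ i, Below (A i))
    (f g : V) :
    bilinB Φ ((List.ofFn fun i => field Φ (A i)).prod f)
      ((List.ofFn fun i => field Φ (A i)).prod g) =
      TensorProduct.map (List.ofFn fun i => field Φ (A i)).prod
        (List.ofFn fun i => field Φ (A i)).prod (bilinB Φ f g) := by
  induction m with
  | zero =>
    simp only [List.ofFn_zero, List.prod_nil, Module.End.one_eq_id,
      TensorProduct.map_id, LinearMap.id_apply]
  | succ m ih =>
    rw [List.ofFn_succ, List.prod_cons, Module.End.mul_apply, Module.End.mul_apply,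
      h.bilinB_field (hA 0), ih fun i => hA _, TensorProduct.map_mul]
    rfl

theorem bilinB_vacuum {u : V} (hu : ∀ j > 0, Φ j u = 0) : bilinB Φ u u = Φ 0 u ⊗ₜ Φ 0 u := by
  rw [bilinB, finsum_eq_single _ 0]
  · simp
  · intro j hj
    rcases lt_or_gt_of_ne hj with hj | hj
    · rw [hu (-j) (by omega), TensorProduct.tmul_zero, smul_zero]
    · rw [hu j hj, TensorProduct.zero_tmul, smul_zero]

/-! ### Approximation by elements of the even Clifford algebra -/

/-- Each field is an infinite sum and need not lie in the algebra generated by the modes, but on two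
given vectors a finite subsum agrees with it. The odd case is phrased through `Φ i * g` so that the
induction stays in the even subalgebra. -/
theorem exists_even_approximation (hΦ : Upper Φ) {m : ℕ} {A : Fin m → ℤ → ℂ}
    (hA : ∀ i, Below (A i)) (u v : V) :
    ∃ g : Module.End ℂ V, g u = (List.ofFn fun i => field Φ (A i)).prod u ∧
      g v = (List.ofFn fun i => field Φ (A i)).prod v ∧
      (Even m → g ∈ Algebra.adjoin ℂ {x | ∃ i j : ℤ, x = Φ i * Φ j}) ∧
      (¬ Even m → ∀ i, Φ i * g ∈ Algebra.adjoin ℂ {x | ∃ i j : ℤ, x = Φ i * Φ j}) := by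
  induction m with
  | zero => exact ⟨1, rfl, rfl, fun _ => one_mem _, fun h => absurd Even.zero h⟩
  | succ m ih =>
    obtain ⟨g, hu, hv, he, ho⟩ := ih (A := fun i => A i.succ) fun i => hA _
    have s := (locFin_field hΦ (hA 0) (g u)).union (locFin_field hΦ (hA 0) (g v))
    refine ⟨(∑ i ∈ s.toFinset, A 0 i • Φ i) * g, ?_, ?_, fun hm => ?_, fun hm i => ?_⟩
    · rw [List.ofFn_succ, List.prod_cons, Module.End.mul_apply, Module.End.mul_apply, ← hu,
        field_apply hΦ (hA 0), LinearMap.sum_apply, finsum_eq_sum_of_support_subset]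
      · rfl
      · rw [Set.Finite.coe_toFinset]; exact Set.subset_union_left
    · rw [List.ofFn_succ, List.prod_cons, Module.End.mul_apply, Module.End.mul_apply, ← hv,
        field_apply hΦ (hA 0), LinearMap.sum_apply, finsum_eq_sum_of_support_subset]
      · rfl
      · rw [Set.Finite.coe_toFinset]; exact Set.subset_union_right
    · rw [Finset.sum_mul]
      refine Subalgebra.sum_mem _ fun j _ => ?_
      rw [smul_mul_assoc]
      exact Subalgebra.smul_mem _ (ho (Nat.even_add_one.mp hm) j) _
    · rw [Finset.sum_mul, Finset.mul_sum]
      refine Subalgebra.sum_mem _ fun j _ => ?_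
      rw [smul_mul_assoc, mul_smul_comm, ← mul_assoc]
      refine Subalgebra.smul_mem _ (mul_mem (Algebra.subset_adjoin (by exact ⟨i, j, rfl⟩)) (he ?_)) _
      rwa [Nat.even_add_one, not_not] at hm

end Neutral

/-! ### Neutral fermions inside the charged ones -/

theorem sh_expSeries_tilde (N : ℤ) (c : Times) (i : ℤ) :
    (-1 : ℂ) ^ i * sh N (expSeries c) i = (-1) ^ N * sh N (expSeries (tilde c)) i := by
  simp only [sh]
  split_ifs with h
  · obtain ⟨n, hn⟩ := Int.eq_ofNat_of_zero_le h
    have hi : i = n - N := by omega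
    rw [hn, Int.toNat_natCast, coeff_expSeries, coeff_expSeries, schur_tilde, hi,
      zpow_sub₀ (by norm_num), zpow_natCast, div_eq_mul_inv, ← zpow_neg, neg_one_zpow_neg]
    ring
  · simp

theorem tilde_add (s t : Times) : tilde (s + t) = tilde s + tilde t := by
  funext k; simp [tilde, mul_add]

theorem tilde_of_evenTimesVanish {t : Times} (ht : EvenTimesVanish t) : tilde t = -t := by
  funext k
  rw [tilde, Pi.neg_apply]
  rcases Nat.even_or_odd (k : ℕ) with hk | hk
  · rw [ht k hk, mul_zero, neg_zero]
  · rw [hk.neg_one_pow, neg_one_mul]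

namespace Fermions

variable {V : Type*} [AddCommGroup V] [Module ℂ V] (Ψ : Fermions V)

/-- The operators `x ψ⁺_{i+1/2} + (-1)^i y ψ⁻_{i-1/2}`. -/
def mix (x y : ℂ) (i : ℤ) : Module.End ℂ V := x • Ψ.F i + (y * (-1) ^ i) • Ψ.G i

theorem upper_mix (x y : ℂ) : Upper (Ψ.mix x y) := fun f => by
  obtain ⟨K, hK⟩ := Ψ.upper_F f
  obtain ⟨L, hL⟩ := Ψ.upper_G f
  exact ⟨max K L, fun i hi => by simp [mix, hK i (by omega), hL i (by omega)]⟩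

/-- Covers both families at once: $xy=\frac12$ makes a family neutral, and $xy'+yx'=0$ makes two
families anticommute, as for $(\kappa,\kappa)$ and $(\sqrt{-1}\kappa,-\sqrt{-1}\kappa)$. -/
theorem mix_anticomm (x y x' y' : ℂ) (i j : ℤ) :
    Ψ.mix x y i * Ψ.mix x' y' j + Ψ.mix x' y' j * Ψ.mix x y i =
      (if i = -j then (x * y' + y * x') * (-1) ^ i else 0) • 1 := by
  have h1 := Ψ.F_anticomm i j
  have h2 := Ψ.G_anticomm i j
  have h3 := Ψ.F_G i j
  have h4 := Ψ.F_G j i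
  have h5 : (j = -i) ↔ (i = -j) := by omega
  rw [if_congr h5 rfl rfl] at h4
  calc _ = (x * x') • (Ψ.F i * Ψ.F j + Ψ.F j * Ψ.F i) +
      (y * (-1) ^ i * (y' * (-1) ^ j)) • (Ψ.G i * Ψ.G j + Ψ.G j * Ψ.G i) +
      (x * (y' * (-1) ^ j)) • (Ψ.F i * Ψ.G j + Ψ.G j * Ψ.F i) +
      (y * (-1) ^ i * x') • (Ψ.F j * Ψ.G i + Ψ.G i * Ψ.F j) := by
        simp only [mix, mul_add, add_mul, smul_mul_smul_comm, smul_add]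
        rw [mul_comm x' x, mul_comm (y' * _) (y * _), mul_comm (y' * _) x, mul_comm x' (y * _)]
        abel
    _ = _ := by
        rw [h1, h2, h3, h4]
        split_ifs with h
        · rw [h, neg_one_zpow_neg, smul_zero, smul_zero]
          module
        · simp

theorem neutral_mix {x y : ℂ} (h : x * y = 1 / 2) : Neutral (Ψ.mix x y) where
  upper := Ψ.upper_mix x y
  anticomm i j := by
    rw [Ψ.mix_anticomm, mul_comm y x, h]
    norm_num

theorem mix_vac (x y : ℂ) : ∀ i > 0, Ψ.mix x y i Ψ.vac = 0 := fun i hi => by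
  simp [mix, Ψ.F_vac i (by omega), Ψ.G_vac i hi]

theorem ev_mix (x y : ℂ) (i : ℤ) (f : V) (hi : i < 0) : Ψ.ev (Ψ.mix x y i f) = 0 := by
  simp [mix, Ψ.ev_F i hi, Ψ.ev_G i hi.le]

/-- The operator `∑_j (x p_{j+N} ψ⁺_{j+1/2} + (-1)^N y q_{j+N} ψ⁻_{j-1/2})`. -/
def mixOp (x y : ℂ) (N : ℕ) (p q : PowerSeries ℂ) : Module.End ℂ V :=
  Ψ.op (sh N (x • p)) (sh N ((y * (-1) ^ N) • q))

/-- The sign $(-1)^i$ on the $\psi^-$ modes turns the coefficients for $c$ into those for $\tilde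
c$, up to $(-1)^N$. -/
theorem field_mix (x y : ℂ) (N : ℕ) (c : Times) :
    field (Ψ.mix x y) (sh N (expSeries c)) =
      Ψ.mixOp x y N (expSeries c) (expSeries (tilde c)) := by
  ext f
  have hF := locFin_field Ψ.upper_F (below_sh N (x • expSeries c))
  have hG := locFin_field Ψ.upper_G (below_sh N ((y * (-1) ^ N) • expSeries (tilde c)))
  rw [field_apply (Ψ.upper_mix x y) (below_sh _ _), mixOp, op, field, field, locSum_add hF hG,
    locSum_apply (hF.add hG)]
  refine finsum_congr fun i => ?_
  have h := sh_expSeries_tilde N c i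
  rw [zpow_natCast] at h
  simp only [mix, sh_smul, LinearMap.add_apply, LinearMap.smul_apply, smul_add, smul_smul]
  rw [mul_assoc y ((-1) ^ N), ← h]
  congr 2 <;> ring

theorem mixOp_anticomm_field_mix {x y x' y' : ℂ} (h : x * y' + y * x' = 0) {A B : ℤ → ℂ}
    (hA : Below A) (hB : Below B) :
    field (Ψ.mix x y) A * field (Ψ.mix x' y') B + field (Ψ.mix x' y') B * field (Ψ.mix x y) A =
      0 :=
  field_anticomm_zero (fun i j => by rw [Ψ.mix_anticomm, h]; simp) (Ψ.upper_mix x y)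
    (Ψ.upper_mix x' y') hA hB

/-- The KP flow shifts the $\psi^+$ part by $t$ and the $\psi^-$ part by $-t$, so the evolved
operator is in general no longer a neutral field. This is why `mixOp` carries two independent
series. -/
theorem intertwines_mixOp (x y : ℂ) (N : ℕ) (t c : Times) :
    Intertwines (Ψ.hamiltonian t) (Ψ.mixOp x y N (expSeries c) (expSeries (tilde c)))
      (Ψ.mixOp x y N (expSeries (t + c)) (expSeries (-(t - tilde c)))) := by
  have h : -(t - tilde c) = -t + tilde c := by abel
  rw [h, mixOp, mixOp, expSeries_add, expSeries_add, ← mul_smul_comm, ← mul_smul_comm]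
  exact Ψ.intertwines_op t N _ _

/-! ### Vacuum expectation values -/

theorem pair_contraction (x y x' y' : ℂ) (N M : ℕ) (p q p' q' : PowerSeries ℂ) :
    pair (cut 0 (sh N (x • p))) (sh M ((y' * (-1) ^ M) • q')) +
      pair (cut 1 (sh N ((y * (-1) ^ N) • q))) (sh M (x' • p')) =
    x * y' * (-1) ^ M * ∑ k ∈ Finset.Icc 0 M,
      PowerSeries.coeff (N + k) p * PowerSeries.coeff (M - k) q' +
    y * x' * (-1) ^ N * ∑ k ∈ Finset.Icc 1 M,
      PowerSeries.coeff (N + k) q * PowerSeries.coeff (M - k) p' := by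
  have h0 := pair_cut_sh 0 N M (x • p) ((y' * (-1) ^ M) • q')
  have h1 := pair_cut_sh 1 N M ((y * (-1) ^ N) • q) (x' • p')
  rw [Nat.cast_zero] at h0
  rw [Nat.cast_one] at h1
  rw [h0, h1, Finset.mul_sum, Finset.mul_sum]
  simp only [map_smul, smul_eq_mul]
  congr 1 <;> exact Finset.sum_congr rfl fun k _ => by ring

theorem ev_prod_mixOp {m : ℕ} (x y : Fin m → ℂ) (N : Fin m → ℕ) (p q : Fin m → PowerSeries ℂ) :
    Ψ.ev ((List.ofFn fun i => Ψ.mixOp (x i) (y i) (N i) (p i) (q i)).prod Ψ.vac) =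
      pf m (Matrix.of fun i j =>
        x i * y j * (-1) ^ N j * ∑ k ∈ Finset.Icc 0 (N j),
          PowerSeries.coeff (N i + k) (p i) * PowerSeries.coeff (N j - k) (q j) +
        y i * x j * (-1) ^ N i * ∑ k ∈ Finset.Icc 1 (N j),
          PowerSeries.coeff (N i + k) (q i) * PowerSeries.coeff (N j - k) (p j)) := by
  simp only [mixOp, Ψ.ev_prod_op (fun i => below_sh (N i) (x i • p i))
    (fun i => below_sh (N i) ((y i * (-1) ^ N i) • q i)), pair_contraction]

/-- Only the product $xy$ enters the contractions, so $\phi$ and $\hat\phi$ yield the same Pfaffian.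
-/
theorem ev_prod_field_mix {x y : ℂ} (hxy : x * y = 1 / 2) {m : ℕ} (lam : Fin m → ℕ)
    (c : Fin m → Times) (t : Times) :
    Ψ.ev ((List.ofFn fun i => field (Ψ.mix x y) (sh (lam i) (expSeries (t + c i)))).prod Ψ.vac) =
      tauB lam c t := by
  simp only [field_mix]
  rw [Ψ.ev_prod_mixOp (fun _ => x) (fun _ => y), tauB]
  congr 1
  ext i j
  simp only [Matrix.of_apply, coeff_expSeries, schur_tilde, chiBar]
  -- The term $k=0$ occurs in only one of the two contractions and keeps the factor $\frac12$; for
  -- $k\ge1$ the two halves coincide and add up.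
  have hIcc : Finset.Icc 0 (lam j) = insert 0 (Finset.Icc 1 (lam j)) := by
    ext k; simp only [Finset.mem_Icc, Finset.mem_insert]; omega
  have sq (k : ℕ) : (-1 : ℂ) ^ k * (-1) ^ k = 1 := by rw [← mul_pow]; simp
  have e : ∀ k ∈ Finset.Icc 1 (lam j), (-1 : ℂ) ^ k * schur (lam i + k) (t + c i) *
      schur (lam j - k) (t + c j) =
      x * y * (-1) ^ lam j * (schur (lam i + k) (t + c i) * ((-1) ^ (lam j - k) *
        schur (lam j - k) (t + c j))) +
      y * x * (-1) ^ lam i * ((-1) ^ (lam i + k) * schur (lam i + k) (t + c i) *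
        schur (lam j - k) (t + c j)) := fun k hk => by
    obtain ⟨d, hd⟩ := Nat.exists_eq_add_of_le (Finset.mem_Icc.mp hk).2
    rw [mul_comm y x, hxy, show lam j - k = d by omega, hd, pow_add, pow_add]
    linear_combination (-(1 / 2 : ℂ) * (-1) ^ k * schur (lam i + k) (t + c i) *
      schur d (t + c j)) * (sq d + sq (lam i))
  rw [hIcc, Finset.sum_insert (by simp), Finset.sum_congr rfl e, Finset.sum_add_distrib,
    ← Finset.mul_sum, ← Finset.mul_sum, mul_add, hxy, add_zero, Nat.sub_zero]
  linear_combination ((1 / 2 : ℂ) * schur (lam i) (t + c i) * schur (lam j) (t + c j)) * sq (lam j)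

/-- Here $\delta$ is the scalar in front of the block and $\varepsilon$ the sign of $\chi^\pm$: the
diagonal blocks have $\delta=\varepsilon=1$, the upper right one $\delta=-\sqrt{-1}$,
$\varepsilon=-1$. -/
theorem contraction_eq_chi {x y x' y' δ ε : ℂ} (h₁ : x * y' = δ / 2) (h₂ : y * x' = δ * ε / 2)
    (N M : ℕ) (s t u v : Times) :
    x * y' * (-1) ^ M * ∑ k ∈ Finset.Icc 0 M, schur (N + k) s * schur (M - k) (-t) +
    y * x' * (-1) ^ N * ∑ k ∈ Finset.Icc 1 M, schur (N + k) (-u) * schur (M - k) v =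
      (-1) ^ N * (-1) ^ M * (δ * chi ε N M s t u v) := by
  have sq (k : ℕ) : (-1 : ℂ) ^ k * (-1) ^ k = 1 := by rw [← mul_pow]; simp
  simp only [chi, mul_assoc ((-1 : ℂ) ^ _), ← Finset.mul_sum]
  rw [h₁, h₂]
  generalize ∑ k ∈ Finset.Icc 0 M, schur (N + k) s * schur (M - k) (-t) = X
  generalize ∑ k ∈ Finset.Icc 1 M, schur (N + k) (-u) * schur (M - k) v = Y
  linear_combination (-(δ / 2) * (-1) ^ M * X) * sq N - (δ * ε / 2 * (-1) ^ N * Y) * sq M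

theorem ev_prod_mixOp_prod_mixOp {κ : ℂ} (hκ : κ * κ = 1 / 2) {m : ℕ} (lam : Fin m → ℕ)
    (c : Fin m → Times) (t : Times) :
    Ψ.ev ((List.ofFn fun i => Ψ.mixOp κ κ (lam i) (expSeries (t + c i))
        (expSeries (-(t - tilde (c i))))).prod
      ((List.ofFn fun i => Ψ.mixOp (Complex.I * κ) (-(Complex.I * κ)) (lam i)
        (expSeries (t + c i)) (expSeries (-(t - tilde (c i))))).prod Ψ.vac)) = tauKP lam c t := by
  have h := Ψ.ev_prod_mixOp (Fin.append (fun _ : Fin m => κ) fun _ : Fin m => Complex.I * κ)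
    (Fin.append (fun _ : Fin m => κ) fun _ : Fin m => -(Complex.I * κ)) (Fin.append lam lam)
    (Fin.append (fun i => expSeries (t + c i)) fun i => expSeries (t + c i))
    (Fin.append (fun i => expSeries (-(t - tilde (c i)))) fun i => expSeries (-(t - tilde (c i))))
  have happ : (fun i => Ψ.mixOp
      (Fin.append (fun _ : Fin m => κ) (fun _ : Fin m => Complex.I * κ) i)
      (Fin.append (fun _ : Fin m => κ) (fun _ : Fin m => -(Complex.I * κ)) i)
      (Fin.append lam lam i)
      (Fin.append (fun i => expSeries (t + c i)) (fun i => expSeries (t + c i)) i)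
      (Fin.append (fun i => expSeries (-(t - tilde (c i))))
        (fun i => expSeries (-(t - tilde (c i)))) i)) =
      Fin.append (fun i => Ψ.mixOp κ κ (lam i) (expSeries (t + c i))
        (expSeries (-(t - tilde (c i))))) (fun i => Ψ.mixOp (Complex.I * κ) (-(Complex.I * κ))
          (lam i) (expSeries (t + c i)) (expSeries (-(t - tilde (c i))))) := by
    funext i
    refine Fin.addCases (fun i => ?_) (fun i => ?_) i <;>
      simp only [Fin.append_left, Fin.append_right]
  rw [happ, List.ofFn_fin_append, List.prod_append, Module.End.mul_apply] at h
  rw [h]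
  -- The signs $(-1)^{\lambda_i}$ by which the contractions differ from the matrix entries occur
  -- once in each half, so rescaling rows and columns by them leaves the Pfaffian unchanged.
  have hprod : ∏ i, Fin.append (fun i => (-1 : ℂ) ^ lam i) (fun i => (-1 : ℂ) ^ lam i) i = 1 := by
    rw [Fin.prod_univ_add]
    simp only [Fin.append_left, Fin.append_right]
    rw [← Finset.prod_mul_distrib]
    exact Finset.prod_eq_one fun i _ => by rw [← mul_pow]; simp
  have hI : Complex.I * κ * -(Complex.I * κ) = 1 / 2 := by
    linear_combination hκ - κ * κ * Complex.I_mul_I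
  have hscale := pf_scale (Fin.append (fun i => (-1 : ℂ) ^ lam i) fun i => (-1 : ℂ) ^ lam i)
    (Matrix.reindex finSumFinEquiv finSumFinEquiv
      (Matrix.fromBlocks (matA 1 lam c t) (-Complex.I • matA (-1) lam c t)
        (Complex.I • (matA (-1) lam c t).transpose) (matA 1 lam c t)))
  rw [hprod, one_mul] at hscale
  rw [tauKP, ← hscale]
  refine pf_congr fun i j hij => ?_
  simp only [Matrix.of_apply, Matrix.reindex_apply, Matrix.submatrix_apply]
  induction i using Fin.addCases with
  | left i =>
    induction j using Fin.addCases with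
    | left j =>
      simp only [Fin.append_left, finSumFinEquiv_symm_apply_castAdd, Matrix.fromBlocks_apply₁₁,
        matA, Matrix.of_apply, coeff_expSeries]
      rw [contraction_eq_chi (δ := 1) (ε := 1) hκ (by rw [hκ]; norm_num), one_mul]
    | right j =>
      simp only [Fin.append_left, Fin.append_right, finSumFinEquiv_symm_apply_castAdd,
        finSumFinEquiv_symm_apply_natAdd, Matrix.fromBlocks_apply₁₂, Matrix.smul_apply,
        matA, Matrix.of_apply, coeff_expSeries, smul_eq_mul]
      rw [contraction_eq_chi (δ := -Complex.I) (ε := -1)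
        (by linear_combination -Complex.I * hκ) (by linear_combination Complex.I * hκ)]
  | right i =>
    induction j using Fin.addCases with
    | left j =>
      -- The lower left block lies below the diagonal and does not enter the Pfaffian.
      exfalso
      rw [Fin.lt_def] at hij
      simp only [Fin.val_natAdd, Fin.val_castAdd] at hij
      omega
    | right j =>
      simp only [Fin.append_right, finSumFinEquiv_symm_apply_natAdd, Matrix.fromBlocks_apply₂₂,
        matA, Matrix.of_apply, coeff_expSeries]
      rw [contraction_eq_chi (δ := 1) (ε := 1) hI (by linear_combination hI), one_mul]

/-- An odd number of linear fields has zero expectation: $\psi^+_{1/2}$ is itself such a field, so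
Wick's theorem gives a Pfaffian of odd size. -/
theorem ev_F_zero_prod_field_mix (x y : ℂ) {m : ℕ} (hm : Even m) (lam : Fin m → ℕ)
    (c : Fin m → Times) :
    Ψ.ev (Ψ.F 0 ((List.ofFn fun i =>
      field (Ψ.mix x y) (sh (lam i) (expSeries (c i)))).prod Ψ.vac)) = 0 := by
  have h0 : Ψ.mixOp 1 0 0 1 0 = Ψ.F 0 := by
    ext f
    have hs : sh (0 : ℕ) (((0 : ℂ) * (-1) ^ 0) • (0 : PowerSeries ℂ)) = fun _ => 0 := by
      funext i; simp [sh]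
    rw [mixOp, op, hs, LinearMap.add_apply, field_sh_eq_finsum Ψ.upper_F, field_apply Ψ.upper_G
      ⟨0, fun _ _ => rfl⟩, finsum_eq_single _ 0]
    · simp
    · intro n hn
      simp [PowerSeries.coeff_one, hn]
  have h := Ψ.ev_prod_mixOp (Fin.cons 1 fun _ : Fin m => x) (Fin.cons 0 fun _ : Fin m => y)
    (Fin.cons 0 lam) (Fin.cons 1 fun i => expSeries (c i))
    (Fin.cons 0 fun i => expSeries (tilde (c i)))
  rw [pf_of_odd hm.add_one, List.ofFn_succ, List.prod_cons] at h
  simp only [Fin.cons_zero, Fin.cons_succ, h0, ← field_mix] at h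
  exact h

/-! ### The bilinear identity of the KP hierarchy -/

/-- `S(f ⊗ g) = ∑_i ψ⁺_i f ⊗ ψ⁻_{-i} g`. -/
def bilin (f g : V) : V ⊗[ℂ] V := ∑ᶠ i : ℤ, Ψ.F i f ⊗ₜ[ℂ] Ψ.G (-i) g

theorem bilin_vac : Ψ.bilin Ψ.vac Ψ.vac = 0 :=
  finsum_eq_zero_of_forall_eq_zero fun i => by
    by_cases hi : 0 ≤ i
    · rw [Ψ.F_vac i hi, TensorProduct.zero_tmul]
    · rw [Ψ.G_vac (-i) (by omega), TensorProduct.tmul_zero]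

theorem bilin_smul (a : ℂ) (f g : V) : Ψ.bilin (a • f) (a • g) = (a * a) • Ψ.bilin f g := by
  rw [bilin, bilin, smul_finsum]
  refine finsum_congr fun i => ?_
  rw [map_smul, map_smul, TensorProduct.smul_tmul_smul]

theorem F_anticomm_field_F {A : ℤ → ℂ} (hA : Below A) (i : ℤ) (f : V) :
    Ψ.F i (field Ψ.F A f) = -field Ψ.F A (Ψ.F i f) := by
  refine eq_neg_of_anticomm ?_ f
  have := field_anticomm_single (s := fun _ => 0) (F := Ψ.F) (G := Ψ.F)
    (fun i j => by simp [Ψ.F_anticomm]) Ψ.upper_F hA i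
  rw [add_comm, this, mul_zero, zero_smul]

theorem G_anticomm_field_G {A : ℤ → ℂ} (hA : Below A) (i : ℤ) (f : V) :
    Ψ.G i (field Ψ.G A f) = -field Ψ.G A (Ψ.G i f) := by
  refine eq_neg_of_anticomm ?_ f
  have := field_anticomm_single (s := fun _ => 0) (F := Ψ.G) (G := Ψ.G)
    (fun i j => by simp [Ψ.G_anticomm]) Ψ.upper_G hA i
  rw [add_comm, this, mul_zero, zero_smul]

theorem G_field_F {A : ℤ → ℂ} (hA : Below A) (i : ℤ) (f : V) :
    Ψ.G i (field Ψ.F A f) = A (-i) • f - field Ψ.F A (Ψ.G i f) := by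
  have := LinearMap.congr_fun
    (field_anticomm_single (s := fun _ => 1) Ψ.F_G Ψ.upper_F hA i) f
  rw [add_comm, mul_one] at this
  exact eq_sub_of_add_eq this

theorem F_field_G {B : ℤ → ℂ} (hB : Below B) (i : ℤ) (f : V) :
    Ψ.F i (field Ψ.G B f) = B (-i) • f - field Ψ.G B (Ψ.F i f) := by
  have h : ∀ i j, Ψ.G i * Ψ.F j + Ψ.F j * Ψ.G i = (if i = -j then (1 : ℂ) else 0) • 1 :=
    fun i j => by
      rw [add_comm, Ψ.F_G, if_congr (show (j = -i) ↔ (i = -j) by omega) rfl rfl]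
  have := LinearMap.congr_fun (field_anticomm_single (s := fun _ => 1) h Ψ.upper_G hB i) f
  rw [add_comm, mul_one] at this
  exact eq_sub_of_add_eq this

theorem field_mul_self_of_anticomm {T : Module.End ℂ V} (h : T * T + T * T = 0) : T * T = 0 := by
  rw [← two_smul ℂ] at h
  exact (smul_eq_zero.mp h).resolve_left two_ne_zero

/-- From $P^2=Q^2=0$ and $PQ+QP=\kappa$ one gets $wP=-\kappa P$ and $wQ=\kappa Q$ for $w=QP-PQ$.
Commuting $w$ past the modes produces multiples of $Pf\otimes Qg$ with coefficients $2\kappa$,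
$2\kappa$ and $-4\kappa$, which cancel. -/
theorem bilin_commutator {A B : ℤ → ℂ} (hA : Below A) (hB : Below B) (f g : V) :
    Ψ.bilin ((field Ψ.G B * field Ψ.F A - field Ψ.F A * field Ψ.G B) f)
      ((field Ψ.G B * field Ψ.F A - field Ψ.F A * field Ψ.G B) g) =
      TensorProduct.map (field Ψ.G B * field Ψ.F A - field Ψ.F A * field Ψ.G B)
        (field Ψ.G B * field Ψ.F A - field Ψ.F A * field Ψ.G B) (Ψ.bilin f g) := by
  set P := field Ψ.F A with hP
  set Q := field Ψ.G B with hQ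
  set w := Q * P - P * Q with hw
  set κ := pair A B with hκ
  have hPQ : ∀ v, P (Q v) + Q (P v) = κ • v := LinearMap.congr_fun (Ψ.field_F_G hA hB)
  have hPP : ∀ v, P (P v) = 0 :=
    LinearMap.congr_fun (field_mul_self_of_anticomm (Ψ.field_F_F hA hA))
  have hQQ : ∀ v, Q (Q v) = 0 :=
    LinearMap.congr_fun (field_mul_self_of_anticomm (Ψ.field_G_G hB hB))
  have hwv : ∀ v, w v = Q (P v) - P (Q v) := fun v => rfl
  have hPQP : ∀ v, P (Q (P v)) = κ • P v := fun v => by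
    have := hPQ (P v)
    rwa [hPP, map_zero, add_zero] at this
  have hQPQ : ∀ v, Q (P (Q v)) = κ • Q v := fun v => by
    have := hPQ (Q v)
    rwa [hQQ, map_zero, zero_add] at this
  have hwP : ∀ v, w (P v) = -(κ • P v) := fun v => by
    rw [hwv, hPP, map_zero, zero_sub, hPQP]
  have hwQ : ∀ v, w (Q v) = κ • Q v := fun v => by
    rw [hwv, hQQ, map_zero, sub_zero, hQPQ]
  have hF : ∀ i v, Ψ.F i (w v) = w (Ψ.F i v) + (2 * B (-i)) • P v := fun i v => by
    rw [hwv, hwv, map_sub, Ψ.F_field_G hB, Ψ.F_anticomm_field_F hA, Ψ.F_anticomm_field_F hA,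
      Ψ.F_field_G hB, map_sub, map_neg, map_smul]
    module
  have hG : ∀ i v, Ψ.G i (w v) = w (Ψ.G i v) - (2 * A (-i)) • Q v := fun i v => by
    rw [hwv, hwv, map_sub, Ψ.G_field_F hA, Ψ.G_anticomm_field_G hB, Ψ.G_anticomm_field_G hB,
      Ψ.G_field_F hA, map_sub, map_neg, map_smul]
    module
  have s1 := support_tmul_finite Ψ.upper_F Ψ.upper_G f g
  have s2 : (Function.support fun i => A i • Ψ.F i f).Finite := locFin_field Ψ.upper_F hA f
  have s3 : (Function.support fun i => B i • Ψ.G i g).Finite := locFin_field Ψ.upper_G hB g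
  have s4 : (Function.support fun i => A i * B (-i)).Finite := by
    obtain ⟨N, hN⟩ := hB
    exact support_mul_finite hA ⟨-N, fun i hi => hN _ (by omega)⟩
  have s5 : (Function.support fun i =>
      (A i * B (-i)) • ((-(4 : ℂ)) • (P f ⊗ₜ[ℂ] Q g))).Finite :=
    s4.subset fun j hj h0 => hj (by simp only at h0 ⊢; rw [h0, zero_smul])
  have key : ∀ i, Ψ.F i (w f) ⊗ₜ[ℂ] Ψ.G (-i) (w g) =
      TensorProduct.map w w (Ψ.F i f ⊗ₜ[ℂ] Ψ.G (-i) g) +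
      (((-(2 : ℂ)) • ((TensorProduct.mk ℂ V V).flip (Q g) ∘ₗ w)) (A i • Ψ.F i f) +
      (((2 : ℂ) • (TensorProduct.mk ℂ V V (P f) ∘ₗ w)) (B (-i) • Ψ.G (-i) g) +
        (A i * B (-i)) • ((-(4 : ℂ)) • (P f ⊗ₜ[ℂ] Q g)))) := fun i => by
    rw [hF, hG, neg_neg]
    simp only [TensorProduct.add_tmul, TensorProduct.tmul_sub, ← TensorProduct.smul_tmul',
      TensorProduct.tmul_smul, smul_smul, LinearMap.smul_apply, LinearMap.comp_apply,
      map_smul, TensorProduct.mk_apply, LinearMap.flip_apply, TensorProduct.map_tmul]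
    module
  rw [bilin, finsum_congr key, finsum_add_distrib, finsum_add_distrib, finsum_add_distrib,
    ← finsum_smul' s4, ← map_finsum_linear _ (support_neg_index_finite s3),
    finsum_neg_index (fun i => B i • Ψ.G i g), ← map_finsum_linear _ s2,
    ← map_finsum_linear _ s1, ← field_apply Ψ.upper_F hA, ← field_apply Ψ.upper_G hB, bilin,
    ← hP, ← hQ]
  · have hκ' : ∑ᶠ i, A i * B (-i) = κ := rfl
    rw [hκ']
    simp only [LinearMap.smul_apply, LinearMap.comp_apply, LinearMap.flip_apply,
      TensorProduct.mk_apply, hwP, hwQ, TensorProduct.neg_tmul, ← TensorProduct.smul_tmul',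
      TensorProduct.tmul_smul]
    module
  · exact support_map_finite _ (support_neg_index_finite s3)
  · exact s5
  · exact support_map_finite _ s2
  · exact ((support_map_finite _ (support_neg_index_finite s3)).union s5).subset
      (Function.support_add _ _)
  · exact support_map_finite _ s1
  · exact ((support_map_finite _ s2).union (((support_map_finite _
      (support_neg_index_finite s3)).union s5).subset (Function.support_add _ _))).subset
      (Function.support_add _ _)

/-- The factors are $P+Q$ and $\sqrt{-1}(P-Q)$ with $P^2=Q^2=0$, so only the commutator survives. -/
theorem mixOp_mul_mixOp_hat (κ : ℂ) (N : ℕ) (p q : PowerSeries ℂ) :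
    Ψ.mixOp κ κ N p q * Ψ.mixOp (Complex.I * κ) (-(Complex.I * κ)) N p q =
      Complex.I • (field Ψ.G (sh N ((κ * (-1) ^ N) • q)) * field Ψ.F (sh N (κ • p)) -
        field Ψ.F (sh N (κ • p)) * field Ψ.G (sh N ((κ * (-1) ^ N) • q))) := by
  have hp := below_sh N (κ • p)
  have hq := below_sh N ((κ * (-1) ^ N) • q)
  have e : -(Complex.I * κ) * (-1) ^ N = -Complex.I * (κ * (-1) ^ N) := by ring
  rw [mixOp, mixOp, e, mul_smul Complex.I κ p, mul_smul (-Complex.I) _ q, sh_smul _ Complex.I,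
    sh_smul _ (-Complex.I), op, op, field_smul Ψ.upper_F hp, field_smul Ψ.upper_G hq]
  have hPP := field_mul_self_of_anticomm (Ψ.field_F_F hp hp)
  have hQQ := field_mul_self_of_anticomm (Ψ.field_G_G hq hq)
  simp only [add_mul, mul_add, mul_smul_comm, hPP, hQQ, zero_add, add_zero]
  module

theorem bilin_prod_mixOp {κ : ℂ} {m : ℕ} (N : Fin m → ℕ) (p q : Fin m → PowerSeries ℂ) {f : V}
    (hf : Ψ.bilin f f = 0) :
    Ψ.bilin ((List.ofFn fun i => Ψ.mixOp κ κ (N i) (p i) (q i) *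
        Ψ.mixOp (Complex.I * κ) (-(Complex.I * κ)) (N i) (p i) (q i)).prod f)
      ((List.ofFn fun i => Ψ.mixOp κ κ (N i) (p i) (q i) *
        Ψ.mixOp (Complex.I * κ) (-(Complex.I * κ)) (N i) (p i) (q i)).prod f) = 0 := by
  induction m with
  | zero => simpa using hf
  | succ m ih =>
    rw [List.ofFn_succ, List.prod_cons, Module.End.mul_apply, mixOp_mul_mixOp_hat,
      LinearMap.smul_apply, bilin_smul, Ψ.bilin_commutator (below_sh _ _) (below_sh _ _),
      ih (fun i => N i.succ), map_zero, smul_zero]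

/-! ### Charge -/

theorem field_mem {F : ℤ → Module.End ℂ V} (hF : Upper F) {A : ℤ → ℂ} (hA : Below A)
    {S : Submodule ℂ V} {f : V} (h : ∀ i, F i f ∈ S) : field F A f ∈ S := by
  rw [field_apply hF hA, finsum_eq_sum (fun i => A i • F i f) (locFin_field hF hA f)]
  exact S.sum_mem fun i _ => S.smul_mem _ (h i)

/-- A single factor mixes charges, but each pair is a multiple of $QP-PQ$ and preserves the charge.
-/
theorem prod_mixOp_mem {S : ℤ → Submodule ℂ V} (hF : ∀ k i, ∀ f ∈ S k, Ψ.F i f ∈ S (k + 1))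
    (hG : ∀ k i, ∀ f ∈ S k, Ψ.G i f ∈ S (k - 1)) {κ : ℂ} {m : ℕ} (N : Fin m → ℕ)
    (p q : Fin m → PowerSeries ℂ) {f : V} {k : ℤ} (hf : f ∈ S k) :
    (List.ofFn fun i => Ψ.mixOp κ κ (N i) (p i) (q i) *
      Ψ.mixOp (Complex.I * κ) (-(Complex.I * κ)) (N i) (p i) (q i)).prod f ∈ S k := by
  have hF' {A : ℤ → ℂ} (hA : Below A) {k l : ℤ} (hl : l = k + 1) {f : V} (hf : f ∈ S k) :
      field Ψ.F A f ∈ S l := field_mem Ψ.upper_F hA fun i => hl ▸ hF k i f hf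
  have hG' {A : ℤ → ℂ} (hA : Below A) {k l : ℤ} (hl : l = k + 1) {f : V} (hf : f ∈ S l) :
      field Ψ.G A f ∈ S k := field_mem Ψ.upper_G hA fun i => by
    have := hG l i f hf
    rwa [hl, add_sub_cancel_right] at this
  induction m with
  | zero => simpa using hf
  | succ m ih =>
    rw [List.ofFn_succ, List.prod_cons, Module.End.mul_apply, mixOp_mul_mixOp_hat,
      LinearMap.smul_apply, LinearMap.sub_apply, Module.End.mul_apply, Module.End.mul_apply]
    have h := ih (fun i => N i.succ) (fun i => p i.succ) (fun i => q i.succ)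
    refine (S k).smul_mem _ ((S k).sub_mem ?_ ?_)
    · exact hG' (below_sh _ _) rfl (hF' (below_sh _ _) rfl h)
    · exact hF' (below_sh _ _) (sub_add_cancel k 1).symm
        (hG' (below_sh _ _) (sub_add_cancel k 1).symm h)

end Fermions

/-! ### The semi-infinite wedge space as a representation of the charged fermions -/

theorem exists_bound (f : Fock) :
    ∃ K : ℤ, ∀ i ≥ K, wedge (-i) f = 0 ∧ contract i f = 0 := by
  induction f using Finsupp.induction_linear with
  | zero => exact ⟨0, fun i _ => ⟨map_zero _, map_zero _⟩⟩
  | add f g hf hg =>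
    obtain ⟨K, hK⟩ := hf
    obtain ⟨L, hL⟩ := hg
    refine ⟨max K L, fun i hi => ⟨?_, ?_⟩⟩
    · rw [map_add, (hK i (by omega)).1, (hL i (by omega)).1, add_zero]
    · rw [map_add, (hK i (by omega)).2, (hL i (by omega)).2, add_zero]
  | single S x =>
    obtain ⟨b, hb⟩ := S.2.1
    obtain ⟨c, hc⟩ := S.2.2
    refine ⟨max (b + 1) (1 - c), fun i hi => ⟨wedge_single_of_mem ?_ x,
      contract_single_of_notMem (fun h => ?_) x⟩⟩
    · by_contra h
      have := hc h
      omega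
    · have := hb h
      omega

/-- The charged fermions acting on the semi-infinite wedge space. -/
def fockFermions : Fermions Fock where
  F i := wedge (-i)
  G i := contract i
  F_anticomm i j := wedge_anticomm (-i) (-j)
  G_anticomm := contract_anticomm
  F_G i j := by
    rw [wedge_contract, if_congr (show (-i = j) ↔ (i = -j) by omega) rfl rfl]
  upper_F f := by
    obtain ⟨K, hK⟩ := exists_bound f
    exact ⟨K, fun i hi => (hK i hi).1⟩
  upper_G f := by
    obtain ⟨K, hK⟩ := exists_bound f
    exact ⟨K, fun i hi => (hK i hi).2⟩
  vac := ket 0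
  ev := Finsupp.lapply (vacuumIndex 0)
  F_vac i hi := wedge_ket (by omega)
  G_vac i hi := contract_ket hi
  ev_F i hi f := bra_zero_wedge (by omega) f
  ev_G i hi f := bra_zero_contract hi f
  ev_vac := bra_ket_zero

/-- `1 / √2`. -/
def invSqrtTwo : ℂ := (Real.sqrt 2 : ℂ)⁻¹

theorem phi_eq_mix : phi = fockFermions.mix invSqrtTwo invSqrtTwo := by
  funext i
  refine LinearMap.ext fun f => ?_
  simp only [phi, Fermions.mix, LinearMap.add_apply, LinearMap.smul_apply, smul_add, smul_smul]
  rfl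

theorem phiHat_eq_mix :
    phiHat = fockFermions.mix (Complex.I * invSqrtTwo) (-(Complex.I * invSqrtTwo)) := by
  funext i
  refine LinearMap.ext fun f => ?_
  simp only [phiHat, Fermions.mix, LinearMap.add_apply, LinearMap.sub_apply, LinearMap.smul_apply,
    smul_sub, smul_smul, neg_mul, neg_smul, ← sub_eq_add_neg]
  rfl

theorem invSqrtTwo_mul_self : invSqrtTwo * invSqrtTwo = 1 / 2 := sqrt_two_inv_sq

theorem hat_mul_hat : Complex.I * invSqrtTwo * -(Complex.I * invSqrtTwo) = 1 / 2 := by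
  linear_combination invSqrtTwo_mul_self - invSqrtTwo * invSqrtTwo * Complex.I_mul_I

theorem neutral_phi : Neutral (V := Fock) phi :=
  phi_eq_mix ▸ fockFermions.neutral_mix invSqrtTwo_mul_self

theorem neutral_phiHat : Neutral (V := Fock) phiHat :=
  phiHat_eq_mix ▸ fockFermions.neutral_mix hat_mul_hat

theorem phi_anticomm_phiHat (i j : ℤ) : phiHat i * phi j + phi j * phiHat i = 0 := by
  rw [phi_eq_mix, phiHat_eq_mix]
  refine (fockFermions.mix_anticomm _ _ _ _ i j).trans ?_
  rw [show Complex.I * invSqrtTwo * invSqrtTwo + -(Complex.I * invSqrtTwo) * invSqrtTwo = 0 by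
    ring]
  simp

theorem phi_ket (i : ℤ) (hi : i > 0) : phi i (ket 0) = 0 := by
  rw [phi_eq_mix]; exact fockFermions.mix_vac _ _ i hi

theorem phiHat_ket (i : ℤ) (hi : i > 0) : phiHat i (ket 0) = 0 := by
  rw [phiHat_eq_mix]; exact fockFermions.mix_vac _ _ i hi

/-! ### Translation of the concrete sums into the abstract operators -/

theorem foldr_ofFn_apply {m : ℕ} (T : Fin m → Module.End ℂ Fock) (f : Fock) :
    (List.ofFn fun i => (T i : Fock → Fock)).foldr (fun T h => T h) f = (List.ofFn T).prod f := by
  induction m with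
  | zero => rfl
  | succ m ih =>
    rw [List.ofFn_succ, List.ofFn_succ, List.prod_cons, List.foldr_cons, ih fun i => T i.succ]
    rfl

theorem vProd_eq {m : ℕ} (lam : Fin m → ℕ) (c : Fin m → Times) (f : Fock) :
    vProd lam c f = (List.ofFn fun i => field (V := Fock) phi
      (sh (lam i) (expSeries (c i)))).prod f := by
  rw [← foldr_ofFn_apply, vProd]
  congr 2
  funext i
  exact funext fun g => (field_sh_eq_finsum neutral_phi.upper (lam i) (expSeries (c i)) g).symm

theorem vHatProd_eq {m : ℕ} (lam : Fin m → ℕ) (c : Fin m → Times) (f : Fock) :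
    vHatProd lam c f = (List.ofFn fun i => field (V := Fock) phiHat
      (sh (lam i) (expSeries (c i)))).prod f := by
  rw [← foldr_ofFn_apply, vHatProd]
  congr 2
  funext i
  exact funext fun g => (field_sh_eq_finsum neutral_phiHat.upper (lam i) (expSeries (c i)) g).symm

theorem expOp_eq (A : Module.End ℂ Fock) (f : Fock) : expOp A f = expEnd A f := by
  rw [expOp, expEnd]
  refine finsum_congr fun n => ?_
  rw [Module.End.pow_apply]

theorem hamiltonian_eq (t : Times) : hamiltonian t = fockFermions.hamiltonian t := by
  funext f
  rw [hamiltonian, Fermions.hamiltonian, locSum_apply (fockFermions.locFin_alpha.smul t)]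
  refine finsum_congr fun k => ?_
  rw [LinearMap.smul_apply]
  congr 1
  have hk := k.pos
  -- The two sums are indexed by the added and by the removed index, which differ by $k$.
  rw [alpha, Fermions.alpha, quad, locSum_apply (locFin_quad fockFermions.upper_F
    fockFermions.upper_G (fun b => fockFermions.F_G_of_ne (by omega)) 1),
    ← finsum_comp_equiv (Equiv.subRight ((k : ℕ) : ℤ))]
  refine finsum_congr fun b => ?_
  have h1 : -(((k : ℕ) : ℤ) - b) = b - ((k : ℕ) : ℤ) := by ring
  simp only [Equiv.subRight_apply, sub_add_cancel, Pi.one_apply, one_smul,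
    Module.End.mul_apply, fockFermions, h1]

theorem hamiltonianB_eq (t s : Times) :
    hamiltonianB t s = hamiltonianBOp (V := Fock) phi phiHat t s := by
  funext f
  rw [hamiltonianB, hamiltonianBOp,
    locSum_apply (locFin_hamiltonianBTerm neutral_phi neutral_phiHat t s)]
  refine finsum_congr fun k => ?_
  have hk := k.pos
  have h1 : beta k f = betaOp (V := Fock) phi k f := by
    rw [betaOp, quad, locSum_apply (locFin_quad neutral_phi.upper neutral_phi.upper
      (fun b => neutral_phi.anticomm_of_ne (by omega)) _)]
    rfl
  have h2 : betaHat k f = betaOp (V := Fock) phiHat k f := by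
    rw [betaOp, quad, locSum_apply (locFin_quad neutral_phiHat.upper neutral_phiHat.upper
      (fun b => neutral_phiHat.anticomm_of_ne (by omega)) _)]
    rfl
  rw [h1, h2, hamiltonianBTerm]
  split_ifs <;> rfl

theorem kpOp_eq (f g : Fock) : kpOp f g = fockFermions.bilin f g := by
  rw [kpOp, Fermions.bilin, ← finsum_comp_equiv (Equiv.neg ℤ)]
  rfl

/-! ### Charge -/

/-- A nonpositive index fills a hole and a positive one adds a particle; either way the charge rises
by one. -/
theorem charge_adjoin {S : Monomial} {m : ℤ} (hm : m ∉ S.1) :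
    charge (S.adjoin m) = charge S + 1 := by
  have hfin : (Set.Iic 0 \ S.1).Finite := by
    obtain ⟨c, hc⟩ := S.2.2
    exact (Set.finite_Icc c 0).subset fun x hx => ⟨hc hx.2, hx.1⟩
  rw [charge, charge]
  rcases le_or_gt m 0 with h | h
  · have h1 : (S.adjoin m).1 ∩ Set.Ioi 0 = S.1 ∩ Set.Ioi 0 := by
      ext x; simp only [Set.mem_inter_iff, Monomial.mem_adjoin, Set.mem_Ioi]; grind
    have h2 : Set.Iic 0 \ S.1 = insert m (Set.Iic 0 \ (S.adjoin m).1) := by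
      ext x
      simp only [Set.mem_sdiff, Set.mem_insert_iff, Monomial.mem_adjoin, Set.mem_Iic]; grind
    have h3 : m ∉ Set.Iic 0 \ (S.adjoin m).1 := fun h => h.2 (Or.inl rfl)
    have h4 : (Set.Iic 0 \ (S.adjoin m).1).Finite := hfin.subset (h2 ▸ Set.subset_insert _ _)
    rw [h1, h2, Set.ncard_insert_of_notMem h3 h4]
    push_cast; ring
  · have h1 : (S.adjoin m).1 ∩ Set.Ioi 0 = insert m (S.1 ∩ Set.Ioi 0) := by
      ext x
      simp only [Set.mem_inter_iff, Set.mem_insert_iff, Monomial.mem_adjoin, Set.mem_Ioi]; grind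
    have h2 : Set.Iic 0 \ (S.adjoin m).1 = Set.Iic 0 \ S.1 := by
      ext x
      simp only [Set.mem_sdiff, Monomial.mem_adjoin, Set.mem_Iic]; grind
    rw [h1, h2, Set.ncard_insert_of_notMem (fun h => hm h.1) (S.finite_above 0)]
    push_cast; ring

theorem charge_vacuumIndex (m : ℤ) : charge (vacuumIndex m) = m := by
  have h1 : (vacuumIndex m).1 ∩ Set.Ioi 0 = ((Finset.Ioc 0 m : Finset ℤ) : Set ℤ) := by
    ext x; simp only [vacuumIndex, Set.mem_inter_iff, Set.mem_Iic, Set.mem_Ioi, Finset.coe_Ioc,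
      Set.mem_Ioc]; tauto
  have h2 : Set.Iic 0 \ (vacuumIndex m).1 = ((Finset.Ioc m 0 : Finset ℤ) : Set ℤ) := by
    ext x; simp only [vacuumIndex, Set.mem_sdiff, Set.mem_Iic, not_le, Finset.coe_Ioc,
      Set.mem_Ioc]; tauto
  rw [charge, h1, h2, Set.ncard_coe_finset, Set.ncard_coe_finset, Int.card_Ioc, Int.card_Ioc]
  omega

theorem map_mem_sector (T : Fock →ₗ[ℂ] Fock) {k l : ℤ}
    (h : ∀ S x, charge S = k → T (Finsupp.single S x) ∈ sector l) {f : Fock}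
    (hf : f ∈ sector k) : T f ∈ sector l := by
  rw [← Finsupp.sum_single f, Finsupp.sum, map_sum]
  exact (sector l).sum_mem fun S hS => h S _ ((Finsupp.mem_supported ℂ f).mp hf hS)

theorem wedge_mem_sector (k m : ℤ) (f : Fock) (hf : f ∈ sector k) :
    wedge m f ∈ sector (k + 1) := by
  refine map_mem_sector _ (fun S x hS => ?_) hf
  by_cases hm : m ∈ S.1
  · rw [wedge_single_of_mem hm]; exact zero_mem _
  · rw [wedge_single_of_notMem hm]
    exact Finsupp.single_mem_supported ℂ _ (by rw [Set.mem_ofPred_eq, charge_adjoin hm, hS])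

theorem contract_mem_sector (k m : ℤ) (f : Fock) (hf : f ∈ sector k) :
    contract m f ∈ sector (k - 1) := by
  refine map_mem_sector _ (fun S x hS => ?_) hf
  by_cases hm : m ∈ S.1
  · rw [contract_single_of_mem hm]
    refine Finsupp.single_mem_supported ℂ _ ?_
    have := charge_adjoin (S := S.erase m) (m := m) (by simp)
    rw [Monomial.adjoin_erase hm, hS] at this
    rw [Set.mem_ofPred_eq]; omega
  · rw [contract_single_of_notMem hm]; exact zero_mem _

theorem ket_mem_sector (m : ℤ) : ket m ∈ sector m :=
  Finsupp.single_mem_supported ℂ _ (charge_vacuumIndex m)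

theorem bra_eq_zero {f : Fock} {k m : ℤ} (hf : f ∈ sector k) (h : m ≠ k) : bra m f = 0 := by
  by_contra h0
  have := (Finsupp.mem_supported ℂ f).mp hf (Finsupp.mem_support_iff.mpr h0)
  rw [Set.mem_ofPred_eq, charge_vacuumIndex] at this
  exact h this

/-! ### The main results -/

variable {m : ℕ} (lam : Fin m → ℕ) (c : Fin m → Times)

theorem upper_phi : Upper (V := Fock) phi := neutral_phi.upper

theorem phi_vHatProd_ket (j : ℤ) (hj : j > 0) : phi j (vHatProd lam c (ket 0)) = 0 := by
  rw [vHatProd_eq]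
  exact neutral_phiHat.apply_prod_eq_zero phi_anticomm_phiHat
    (fun i => below_sh (lam i) (expSeries (c i))) phi_ket j hj

theorem constantCoeff_expSeries (t : Times) :
    PowerSeries.constantCoeff (expSeries t) = 1 := by
  rw [← PowerSeries.coeff_zero_eq_constantCoeff_apply, coeff_expSeries, schur_zero]

variable {lam} in
theorem vHatProd_ket_ne_zero (hlam : StrictAnti lam) : vHatProd lam c (ket 0) ≠ 0 := by
  rw [vHatProd_eq]
  exact neutral_phiHat.prod_apply_ne_zero hlam (fun i => constantCoeff_expSeries _)
    (Finsupp.single_ne_zero.mpr one_ne_zero) phiHat_ket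

variable {lam} in
theorem vProd_ne_zero (hlam : StrictAnti lam) {u : Fock} (hu0 : u ≠ 0)
    (hu : ∀ j > 0, phi j u = 0) : vProd lam c u ≠ 0 := by
  rw [vProd_eq]
  exact neutral_phi.prod_apply_ne_zero hlam (fun i => constantCoeff_expSeries _) hu0 hu

/-- The $\hat\beta_k$ commute with every $\phi_j$ and kill the vacuum, so the times `s` drop out,
and those of `t` only shift each $c_i$. -/
theorem sigmaBar_vProd (hm : Even m) {t : Times} (ht : EvenTimesVanish t) (s : Times) :
    sigmaBar (vProd lam c (ket 0)) t s = (tauB lam c t, 0) := by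
  have h0 : hamiltonianBOp (V := Fock) phi phiHat t s (ket 0) = 0 :=
    hamiltonianBOp_vacuum neutral_phi neutral_phiHat t s phi_ket phiHat_ket
  have hE := (Intertwines.ofFn_prod fun i => intertwines_hamiltonianBOp neutral_phi
    neutral_phiHat phi_anticomm_phiHat ht s (lam i) (c i)) (ket 0) (nilAt_of_eq_zero h0)
  have hE2 : expOp (hamiltonianB t s) (vProd lam c (ket 0)) =
      vProd lam (fun i => t + c i) (ket 0) := by
    rw [hamiltonianB_eq, expOp_eq, vProd_eq, vProd_eq]
    exact hE.2.trans (by rw [expEnd_of_eq_zero h0])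
  rw [sigmaBar, hE2, ← bra_zero_wedge_zero, vProd_eq, phi_eq_mix]
  exact Prod.ext (fockFermions.ev_prod_field_mix invSqrtTwo_mul_self lam c t)
    (fockFermions.ev_F_zero_prod_field_mix _ _ hm lam fun i => t + c i)

theorem bkpOp_vProd : bkpOp (vProd lam c (ket 0)) (vProd lam c (ket 0)) =
    vProd lam c (phi 0 (ket 0)) ⊗ₜ[ℂ] vProd lam c (phi 0 (ket 0)) := by
  simp only [vProd_eq]
  refine (neutral_phi.bilinB_prod (fun i => below_sh (lam i) (expSeries (c i))) (ket 0)
    (ket 0)).trans ?_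
  rw [bilinB_vacuum phi_ket, TensorProduct.map_tmul]

variable {lam} in
theorem isBKPTau_tauB (hlam : StrictAnti lam) (hm : Even m) : IsBKPTau (tauB lam c) := by
  obtain ⟨g, h1, h2, h3, -⟩ := exists_even_approximation upper_phi
    (fun i => below_sh (lam i) (expSeries (c i))) (ket 0) (phi 0 (ket 0))
  rw [← vProd_eq] at h1 h2
  refine ⟨g, h3 hm, ?_, ?_, fun t s ht _ => ?_⟩
  · rw [h1]
    exact vProd_ne_zero c hlam (Finsupp.single_ne_zero.mpr one_ne_zero) phi_ket
  · rw [h1, h2, bkpOp_vProd]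
  · rw [h1, sigmaBar_vProd lam c hm ht]

/-- The operator `v_i v̂_i`, with arbitrary power series in place of the coefficients. -/
def vPair (N : ℕ) (p q : PowerSeries ℂ) : Module.End ℂ Fock :=
  fockFermions.mixOp invSqrtTwo invSqrtTwo N p q *
    fockFermions.mixOp (Complex.I * invSqrtTwo) (-(Complex.I * invSqrtTwo)) N p q

theorem exists_vProd_vHatProd_eq : ∃ e : ℕ, vProd lam c (vHatProd lam c (ket 0)) =
    (-1 : ℂ) ^ e • (List.ofFn fun i =>
      vPair (lam i) (expSeries (c i)) (expSeries (tilde (c i)))).prod (ket 0) := by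
  obtain ⟨e, he⟩ := ofFn_prod_mul_ofFn_prod
    (a := fun i => field (fockFermions.mix invSqrtTwo invSqrtTwo)
      (sh (lam i) (expSeries (c i))))
    (b := fun i => field (fockFermions.mix (Complex.I * invSqrtTwo) (-(Complex.I * invSqrtTwo)))
      (sh (lam i) (expSeries (c i))))
    (fun i j => fockFermions.mixOp_anticomm_field_mix (by ring) (below_sh _ _) (below_sh _ _))
  refine ⟨e, ?_⟩
  rw [vProd_eq, vHatProd_eq, phi_eq_mix, phiHat_eq_mix]
  refine (LinearMap.congr_fun he (ket 0)).trans ?_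
  simp only [Fermions.field_mix]
  rfl

theorem kpOp_vProd_vHatProd : kpOp (vProd lam c (vHatProd lam c (ket 0)))
    (vProd lam c (vHatProd lam c (ket 0))) = 0 := by
  obtain ⟨e, he⟩ := exists_vProd_vHatProd_eq lam c
  rw [he, kpOp_eq]
  refine (fockFermions.bilin_smul _ _ _).trans ?_
  have h := fockFermions.bilin_prod_mixOp (κ := invSqrtTwo) lam (fun i => expSeries (c i))
    (fun i => expSeries (tilde (c i))) fockFermions.bilin_vac
  exact (congrArg _ h).trans (smul_zero _)

theorem vPair_prod_mem_sector (p q : Fin m → PowerSeries ℂ) :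
    (List.ofFn fun i => vPair (lam i) (p i) (q i)).prod (ket 0) ∈ sector 0 :=
  fockFermions.prod_mixOp_mem (S := sector) (fun k i => wedge_mem_sector k (-i))
    contract_mem_sector lam p q (ket_mem_sector 0)

theorem vProd_vHatProd_mem_sector : vProd lam c (vHatProd lam c (ket 0)) ∈ sector 0 := by
  obtain ⟨e, he⟩ := exists_vProd_vHatProd_eq lam c
  rw [he]
  exact (sector 0).smul_mem _ (vPair_prod_mem_sector lam _ _)

theorem sigma_vProd_vHatProd_zero (t : Times) :
    sigma (vProd lam c (vHatProd lam c (ket 0))) t 0 = tauKP lam c t := by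
  have h0 := fockFermions.hamiltonian_vac t
  have hE := ((Intertwines.ofFn_prod fun i => fockFermions.intertwines_mixOp invSqrtTwo
    invSqrtTwo (lam i) t (c i)).mul (Intertwines.ofFn_prod fun i =>
      fockFermions.intertwines_mixOp (Complex.I * invSqrtTwo) (-(Complex.I * invSqrtTwo))
        (lam i) t (c i))) _ (nilAt_of_eq_zero h0)
  rw [expEnd_of_eq_zero h0] at hE
  rw [sigma, vProd_eq, vHatProd_eq, phi_eq_mix, phiHat_eq_mix, hamiltonian_eq, expOp_eq]
  simp only [Fermions.field_mix]
  exact (congrArg (bra 0) hE.2).trans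
    (fockFermions.ev_prod_mixOp_prod_mixOp invSqrtTwo_mul_self lam c t)

/-- Here the factors are taken in the paired order, where charge conservation of the evolved
operators is visible; the charge-zero coefficient uses the original order, which matches the block
Pfaffian. -/
theorem sigma_vProd_vHatProd_of_ne (t : Times) {k : ℤ} (hk : k ≠ 0) :
    sigma (vProd lam c (vHatProd lam c (ket 0))) t k = 0 := by
  obtain ⟨e, he⟩ := exists_vProd_vHatProd_eq lam c
  have h0 := fockFermions.hamiltonian_vac t
  have hE := ((Intertwines.ofFn_prod fun i => (fockFermions.intertwines_mixOp invSqrtTwo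
    invSqrtTwo (lam i) t (c i)).mul (fockFermions.intertwines_mixOp (Complex.I * invSqrtTwo)
      (-(Complex.I * invSqrtTwo)) (lam i) t (c i))).smul ((-1) ^ e)) _ (nilAt_of_eq_zero h0)
  rw [expEnd_of_eq_zero h0] at hE
  rw [sigma, he, hamiltonian_eq, expOp_eq]
  refine (congrArg (bra k) hE.2).trans (bra_eq_zero ?_ hk)
  exact (sector 0).smul_mem _ (vPair_prod_mem_sector lam (fun i => expSeries (t + c i))
    fun i => expSeries (-(t - tilde (c i))))

theorem sigma_vProd_vHatProd (t : Times) (k : ℤ) :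
    sigma (vProd lam c (vHatProd lam c (ket 0))) t k = if k = 0 then tauKP lam c t else 0 := by
  split_ifs with hk
  · rw [hk, sigma_vProd_vHatProd_zero]
  · exact sigma_vProd_vHatProd_of_ne lam c t hk

/-- When the even times vanish, $\tilde t=-t$, so the evolved $\psi^-$ series is the one belonging
to $t+c_i$ and the KP-evolved operators are neutral fields again. The $\hat\phi$ product then acts
as a second vacuum for the $\phi_j$, and the expectation factors. -/
theorem tauB_sq (hm : Even m) {t : Times} (ht : EvenTimesVanish t) :
    tauB lam c t ^ 2 = tauKP lam c t := by
  have h1 := fockFermions.ev_prod_mixOp_prod_mixOp invSqrtTwo_mul_self lam c t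
  have ht' (i : Fin m) : -(t - tilde (c i)) = tilde (t + c i) := by
    rw [tilde_add, tilde_of_evenTimesVanish ht]; abel
  simp only [ht', ← Fermions.field_mix] at h1
  rw [← h1, (fockFermions.neutral_mix invSqrtTwo_mul_self).ev_prod_apply_of_even fockFermions.ev
    (fun j f => fockFermions.ev_mix _ _ j f) hm (fun i => below_sh _ _)
    (fockFermions.mix_vac _ _) fockFermions.ev_vac,
    fockFermions.ev_prod_field_mix invSqrtTwo_mul_self, fockFermions.ev_prod_field_mix hat_mul_hat,
    sq]
  refine (fockFermions.neutral_mix hat_mul_hat).apply_prod_eq_zero (fun i j => ?_)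
    (fun i => below_sh _ _) (fockFermions.mix_vac _ _)
  have := phi_anticomm_phiHat i j
  rwa [phi_eq_mix, phiHat_eq_mix] at this

end SpinKP

end

theorem mainTheorem1 (n : ℕ) (lam : Fin (2 * n) → ℕ) (hlam : StrictAnti lam)
    (c : Fin (2 * n) → SpinKP.Times) :
    SpinKP.IsBKPTau (SpinKP.tauB lam c) ∧
    (∀ t s : SpinKP.Times, SpinKP.EvenTimesVanish t → SpinKP.EvenTimesVanish s →
      SpinKP.sigmaBar (SpinKP.vProd lam c (SpinKP.ket 0)) t s = (SpinKP.tauB lam c t, 0)) ∧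
    (SpinKP.vProd lam c (SpinKP.vHatProd lam c (SpinKP.ket 0)) ≠ 0 ∧
      SpinKP.vProd lam c (SpinKP.vHatProd lam c (SpinKP.ket 0)) ∈ SpinKP.sector 0 ∧
      SpinKP.kpOp (SpinKP.vProd lam c (SpinKP.vHatProd lam c (SpinKP.ket 0)))
        (SpinKP.vProd lam c (SpinKP.vHatProd lam c (SpinKP.ket 0))) = 0) ∧
    (∀ (t : SpinKP.Times) (m : ℤ),
      SpinKP.sigma (SpinKP.vProd lam c (SpinKP.vHatProd lam c (SpinKP.ket 0))) t m =
        if m = 0 then SpinKP.tauKP lam c t else 0) ∧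
    SpinKP.IsKPTau (SpinKP.tauKP lam c) ∧
    (∀ t : SpinKP.Times, SpinKP.EvenTimesVanish t →
      SpinKP.tauB lam c t ^ 2 = SpinKP.tauKP lam c t) := by
  have hn : Even (2 * n) := even_two_mul n
  -- Nonvanishing is used twice: for the $\hat v$ product on the vacuum, and for the $v$ product on
  -- the resulting vector, which the positive modes $\phi_j$ still kill.
  have hne : SpinKP.vProd lam c (SpinKP.vHatProd lam c (SpinKP.ket 0)) ≠ 0 :=
    SpinKP.vProd_ne_zero c hlam (SpinKP.vHatProd_ket_ne_zero c hlam)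
      (SpinKP.phi_vHatProd_ket lam c)
  have hmem := SpinKP.vProd_vHatProd_mem_sector lam c
  have hkp := SpinKP.kpOp_vProd_vHatProd lam c
  have hsigma := SpinKP.sigma_vProd_vHatProd lam c
  exact ⟨SpinKP.isBKPTau_tauB c hlam hn, fun t s ht _ => SpinKP.sigmaBar_vProd lam c hn ht s,
    ⟨hne, hmem, hkp⟩, hsigma, ⟨_, hne, hmem, hkp, hsigma⟩, fun t ht => SpinKP.tauB_sq lam c hn ht⟩
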